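/- Let $T>0$, $1/2<H<1$, $s_0,\sigma,\nu>0$ and $\mu\in\mathbb{R}$. Consider the mixed fractional Black–Scholes model: on a probability space $(\Omega,\mathcal F,\mathbf P)$ the discounted stock price $S=(S_t)_{t\in[0,T]}$ is a process with positive continuous paths, $S_0=s_0$, having the law of $$s_0\exp\left(\mu t+\sigma W_t-\tfrac12\sigma^2t+\nu B_t\right),\qquad 0\le t\le T,$$ where $W$ is a standard Brownian motion and $B$ is a fractional Brownian motion with Hurst index $H$ (a continuous centered Gaussian process with $B_0=0$ and $\mathrm{Cov}[B_t,B_s]=\frac12(t^{2H}+s^{2H}-|t-s|^{2H})$), independent of $W$. (For instance, $\Omega$ is the space of positive continuous functions on $[0,T]$ starting from $s_0$, with $S$ the coordinate process.) Let $(\mathcal F_t)_{t\in[0,T]}$ be the filtration generated by $S$, augmented to satisfy the usual conditions. A portfolio is an adapted pair $\mathbf\Phi=(\Phi^0_t,\Phi_t)_{t\in[0,T]}$, with value $V_t(\mathbf\Phi)=\Phi^0_t+\Phi_tS_t$. For processes $Y$ and $X$, the forward integral is the limit along dyadic partitions $$\int_0^tY_s\,dX_s=\lim_{n\to\infty}\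 \sum_{\substack{0\le i<2^n\\ Ti/2^n\le t}}Y_{Ti/2^n}\left(X_{T(i+1)/2^n}-X_{Ti/2^n}\right),$$ if it exists almost surely; at $t=T$, if this limit does not exist, the integral is understood in the improper sense, as the a.s. limit for $t\uparrow T$ of a continuous version on $[0,T)$. The portfolio is self-financing if $V_t(\mathbf\Phi)=V_0(\mathbf\Phi)+\int_0^t\Phi_u\,dS_u$ a.s., for every $0\le t\le T$. It is an arbitrage if $V_0(\mathbf\Phi)=0$, $V_T(\mathbf\Phi)\ge0$ a.s. and $\mathbf P[V_T(\mathbf\Phi)>0]>0$; it is a strong arbitrage if $V_0(\mathbf\Phi)=0$ and there is a constant $c>0$ such that $V_T(\mathbf\Phi)\ge c$ a.s. It is nds-admissible (no doubling strategies) if there is a constant $a\ge0$ such that $\inf_{t\in[0,T]}V_t(\mathbf\Phi)\ge-a$ a.s. Then: (i) There is a strong arbitrage among the spot strategies, i.e. among the self-financing portfolios for which $\Phi_t=\varphi(t,S_t)$ for some deterministic function $\varphi$. (ii) There is no nds-admissible arbitrage among the self-financing portfolios of the form $$\Phi_t=\varphi\left(t,\max_{0\le u\le t}S_u,\min_{0\le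 u\le t}S_u,\int_0^tS_u\,du,S_t\right),$$ where $\varphi$ is a $C^1$ function on $[0,T]\times(0,\infty)\times(0,\infty)\times[0,\infty)\times(0,\infty)$ (in particular, where $\varphi$ is $C^1$ on $[0,T]\times[0,\infty)^4$). -/

import Mathlib

open MeasureTheory ProbabilityTheory Filter Topology
open scoped NNReal ENNReal

noncomputable section

namespace MixedFBS

/-- Fractional Brownian motion `(B_t)`, `0 ≤ t ≤ T`, with Hurst index `H`: a centered Gaussian
process with `B_0 = 0`, covariance `(t^{2H} + s^{2H} - |t - s|^{2H}) / 2`, and continuous paths. -/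
structure IsFractionalBrownianMotion {Ω : Type*} [MeasurableSpace Ω] {T : ℝ} (H : ℝ)
    (B : Set.Icc (0 : ℝ) T → Ω → ℝ) (P : Measure Ω) : Prop where
  gaussian : IsGaussianProcess B P
  centered : ∀ t, ∫ ω, B t ω ∂P = 0
  start : ∀ t : Set.Icc (0 : ℝ) T, (t : ℝ) = 0 → ∀ᵐ ω ∂P, B t ω = 0
  covariance : ∀ s t : Set.Icc (0 : ℝ) T, cov[B t, B s; P] =
    ((t : ℝ) ^ (2 * H) + (s : ℝ) ^ (2 * H) - |(t : ℝ) - (s : ℝ)| ^ (2 * H)) / 2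
  cont : ∀ᵐ ω ∂P, Continuous fun t ↦ B t ω

/-- The process `S` on `(Ω, P)` is the (discounted) stock price of the mixed fractional
Black-Scholes model on `[0, T]`: its paths are positive, continuous and start at `s₀`, and its law
on path space is that of `s₀ exp (μ t + σ W_t - σ² t / 2 + ν B_t)`, where `W` is a Brownian motion,
`B` is a fractional Brownian motion with Hurst index `H`, and `W` and `B` are independent.

One instance is the canonical model, in which `Ω` is the space of positive continuous functions on
`[0, T]` starting from `s₀`, `S` is the coordinate process and `P` is the law of the model; another
is `S = s₀ exp (…)` itself on a space that carries `W` and `B`. -/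
structure IsMixedFractionalBlackScholes {Ω : Type*} [MeasurableSpace Ω] (P : Measure Ω)
    (T H s₀ μ σ ν : ℝ) (S : ℝ → Ω → ℝ) : Prop where
  measurable : ∀ t ∈ Set.Icc 0 T, Measurable (S t)
  cont : ∀ ω, ContinuousOn (fun t ↦ S t ω) (Set.Icc 0 T)
  pos : ∀ ω, ∀ t ∈ Set.Icc 0 T, 0 < S t ω
  start : ∀ ω, S 0 ω = s₀
  law : ∃ (Ω' : Type) (_ : MeasurableSpace Ω') (P' : Measure Ω') (_ : IsProbabilityMeasure P')
      (W : ℝ≥0 → Ω' → ℝ) (B : Set.Icc (0 : ℝ) T → Ω' → ℝ),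
    IsBrownianReal W P' ∧ IsFractionalBrownianMotion H B P' ∧
    IndepFun (fun ω (t : Set.Icc (0 : ℝ) T) ↦ W (t : ℝ).toNNReal ω) (fun ω t ↦ B t ω) P' ∧
    IdentDistrib (fun ω (t : Set.Icc (0 : ℝ) T) ↦ S t ω)
      (fun ω (t : Set.Icc (0 : ℝ) T) ↦
        s₀ * Real.exp (μ * t + σ * W (t : ℝ).toNNReal ω - σ ^ 2 * t / 2 + ν * B t ω)) P P'

section Market

variable {Ω : Type*} [MeasurableSpace Ω] (P : Measure Ω) (T : ℝ) (S : ℝ → Ω → ℝ)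

/-- The σ-algebra generated by `S_u`, `u ∈ [0, T]`, `u ≤ t`. -/
@[reducible] def rawInformation (t : ℝ) : MeasurableSpace Ω :=
  ⨆ u ∈ {u : ℝ | u ∈ Set.Icc 0 T ∧ u ≤ t}, MeasurableSpace.comap (S u) inferInstance

/-- The information `𝓕_t` generated by the price, augmented to satisfy the usual conditions of
completeness and right-continuity. -/
@[reducible] def information (t : ℝ) : MeasurableSpace Ω :=
  ⨅ s ∈ Set.Ioi t, eventuallyMeasurableSpace (rawInformation T S s) (ae P)

/-- A portfolio: a pair of adapted processes `Φ⁰` (bonds) and `Φ` (shares) on `[0, T]`. -/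
structure Portfolio where
  bonds : ℝ → Ω → ℝ
  shares : ℝ → Ω → ℝ
  adapted_bonds : ∀ t ∈ Set.Icc 0 T, Measurable[information P T S t] (bonds t)
  adapted_shares : ∀ t ∈ Set.Icc 0 T, Measurable[information P T S t] (shares t)

/-- The `n`-th dyadic sum, over `0 ≤ i < 2 ^ n` with `T i / 2 ^ n ≤ t`, in the definition of the
forward integral `∫_0^t Y dX`. -/
def forwardSum (Y X : ℝ → Ω → ℝ) (n : ℕ) (t : ℝ) (ω : Ω) : ℝ :=
  ∑ i ∈ (Finset.range (2 ^ n)).filter (fun i : ℕ ↦ T * i / 2 ^ n ≤ t),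
    Y (T * i / 2 ^ n) ω * (X (T * (i + 1) / 2 ^ n) ω - X (T * i / 2 ^ n) ω)

/-- `I` is the forward integral `∫_0^t Y dX` along dyadic partitions: the dyadic sums converge to
`I` almost surely. -/
def IsDyadicForwardIntegral (Y X : ℝ → Ω → ℝ) (t : ℝ) (I : Ω → ℝ) : Prop :=
  ∀ᵐ ω ∂P, Tendsto (fun n ↦ forwardSum T Y X n t ω) atTop (𝓝 (I ω))

/-- `I` is the improper forward integral at `T`: `I = lim_{t ↑ T} J_t` almost surely, where `J` is
a version of `t ↦ ∫_0^t Y dX` on `[0, T)` with continuous paths. -/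
def IsImproperForwardIntegral (Y X : ℝ → Ω → ℝ) (I : Ω → ℝ) : Prop :=
  ∃ J : ℝ → Ω → ℝ, (∀ t ∈ Set.Ico 0 T, IsDyadicForwardIntegral P T Y X t (J t)) ∧
    (∀ᵐ ω ∂P, ContinuousOn (fun t ↦ J t ω) (Set.Ico 0 T)) ∧
    ∀ᵐ ω ∂P, Tendsto (fun t ↦ J t ω) (𝓝[<] T) (𝓝 (I ω))

/-- `I` is the forward integral `∫_0^t Y dX`, which at `t = T` is read in the improper sense if it
does not exist as a limit of dyadic sums. -/
def IsForwardIntegral (Y X : ℝ → Ω → ℝ) (t : ℝ) (I : Ω → ℝ) : Prop :=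
  IsDyadicForwardIntegral P T Y X t I ∨
    (t = T ∧ (¬ ∃ I', IsDyadicForwardIntegral P T Y X T I') ∧ IsImproperForwardIntegral P T Y X I)

namespace Portfolio

variable {P T S} (Φ : Portfolio P T S)

/-- The value `V_t(Φ) = Φ⁰_t + Φ_t S_t`. -/
def value (t : ℝ) (ω : Ω) : ℝ := Φ.bonds t ω + Φ.shares t ω * S t ω

/-- `V_t(Φ) = V_0(Φ) + ∫_0^t Φ_u dS_u` for all `t ∈ [0, T]`. -/
def IsSelfFinancing : Prop :=
  ∀ t ∈ Set.Icc 0 T, IsForwardIntegral P T Φ.shares S t (fun ω ↦ Φ.value t ω - Φ.value 0 ω)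

/-- A spot strategy: self-financing, with `Φ_t = φ(t, S_t)` for a deterministic function `φ`. -/
def IsSpot : Prop :=
  Φ.IsSelfFinancing ∧
    ∃ φ : ℝ → ℝ → ℝ, ∀ᵐ ω ∂P, ∀ t ∈ Set.Icc 0 T, Φ.shares t ω = φ t (S t ω)

/-- A smooth strategy: self-financing, with
`Φ_t = φ(t, max_{u ≤ t} S_u, min_{u ≤ t} S_u, ∫_0^t S_u du, S_t)`, where `φ` is `C¹` in time and in
the four path variables. The price, its maximum and its minimum are positive, while the integral
vanishes at `t = 0`; `φ` need not be defined where the first three of these are zero. -/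
def IsSmooth : Prop :=
  Φ.IsSelfFinancing ∧
    ∃ φ : ℝ × ℝ × ℝ × ℝ × ℝ → ℝ,
      ContDiffOn ℝ 1 φ
        (Set.Icc 0 T ×ˢ Set.Ioi 0 ×ˢ Set.Ioi 0 ×ˢ Set.Ici 0 ×ˢ Set.Ioi 0) ∧
      ∀ᵐ ω ∂P, ∀ t ∈ Set.Icc 0 T, Φ.shares t ω =
        φ (t, sSup ((fun u ↦ S u ω) '' Set.Icc 0 t), sInf ((fun u ↦ S u ω) '' Set.Icc 0 t),
          ∫ u in (0 : ℝ)..t, S u ω, S t ω)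

/-- No doubling strategies: the value is bounded from below by a constant. -/
def IsNDSAdmissible : Prop :=
  ∃ a : ℝ, 0 ≤ a ∧ ∀ᵐ ω ∂P, ∀ t ∈ Set.Icc 0 T, -a ≤ Φ.value t ω

def IsArbitrage : Prop :=
  (∀ᵐ ω ∂P, Φ.value 0 ω = 0) ∧ (∀ᵐ ω ∂P, 0 ≤ Φ.value T ω) ∧ 0 < P {ω | 0 < Φ.value T ω}

def IsStrongArbitrage : Prop :=
  (∀ᵐ ω ∂P, Φ.value 0 ω = 0) ∧ ∃ c : ℝ, 0 < c ∧ ∀ᵐ ω ∂P, c ≤ Φ.value T ω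

end Portfolio

end Market

end MixedFBS

end

open MeasureTheory ProbabilityTheory Filter Topology
open scoped NNReal ENNReal

noncomputable section

namespace MixedFBS

/-! Both halves rest on a pathwise Itô calculus. The log-price is `log s₀ + σ W` plus a continuous
process, independent of `W`, whose quadratic variation along dyadic partitions vanishes: a linear
drift and `ν` times a fractional Brownian motion with `H > 1/2`. So the log of almost every price
path has quadratic variation `σ² t`, as in the Black–Scholes model, and limits of dyadic sums can be
computed path by path from this fact alone, without reference to the law
(`ae_hasLogQuadraticVariation`, `eventually_abs_pathSum_sub_le`).

For (i), sell at time 0 the claim that pays the Dirac mass of `S_T` at `s₀` and replicate it. Its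
Black–Scholes price `diracPrice` is, up to a factor, the lognormal transition density: it solves the
Black–Scholes equation and tends to 0 at maturity away from the strike. Since `S_T ≠ s₀` almost
surely, the Itô formula holds up to and including `T` (`tendsto_pathSum_diracDelta`), and the seller
keeps the premium. The density is unbounded near the strike at maturity, so the construction yields
no lower bound on the value and does not conflict with (ii).

For (ii), the gain of a smooth strategy is a function of the path, and it is continuous in the
uniform distance among paths with log-quadratic variation `σ² t` (`exists_abs_limit_sub_limit_le`).
This is shown by comparing the dyadic sums with an ordinary integral along a nearby `C¹` path
(`exists_eventually_abs_pathSum_functional_sub_le`). The price has full support among positive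
continuous paths from `s₀` (`measure_near_pos`), so the almost sure bounds `V ≥ -a` and `V_T ≥ 0`
extend to all such paths with this quadratic variation (`le_of_tendsto_pathGain`), in particular to
almost every path of a driftless geometric Brownian motion. If `V_T > 0` on one path of the price,
then `V_T` exceeds some `c > 0` on a uniform neighbourhood of it, which geometric Brownian motion
visits with positive probability. But under geometric Brownian motion the gains, stopped on leaving
`[1/R, R]`, are centered and bounded in `L²` (`exists_integral_stoppedGain`), so their limit cannot
have positive mean; letting `R` grow gives a contradiction (`not_pathGain_arbitrage`). -/

/-! ### Dyadic Riemann and Stieltjes sums -/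

/-- The indices `i < 2 ^ n` of the dyadic points `T i / 2 ^ n ≤ t`. -/
def dyadicIndices (T : ℝ) (n : ℕ) (t : ℝ) : Finset ℕ :=
  (Finset.range (2 ^ n)).filter (fun i : ℕ ↦ T * i / 2 ^ n ≤ t)

theorem mem_dyadicIndices {T t : ℝ} {n i : ℕ} :
    i ∈ dyadicIndices T n t ↔ i < 2 ^ n ∧ T * i / 2 ^ n ≤ t := by
  simp [dyadicIndices]

theorem dyadicIndices_subset {T s t : ℝ} (n : ℕ) (h : s ≤ t) :
    dyadicIndices T n s ⊆ dyadicIndices T n t := by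
  intro i hi
  rw [mem_dyadicIndices] at *
  exact ⟨hi.1, hi.2.trans h⟩

theorem dyadic_mem_Icc {T : ℝ} (hT : 0 < T) {n i : ℕ} (hi : i ≤ 2 ^ n) :
    T * i / 2 ^ n ∈ Set.Icc 0 T := by
  have h2 : (i : ℝ) ≤ 2 ^ n := by exact_mod_cast hi
  refine ⟨by positivity, ?_⟩
  rw [div_le_iff₀ (by positivity)]
  exact mul_le_mul_of_nonneg_left h2 hT.le

theorem dyadic_succ_mem_Icc {T : ℝ} (hT : 0 < T) {n i : ℕ} (hi : i < 2 ^ n) :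
    T * ((i : ℝ) + 1) / 2 ^ n ∈ Set.Icc 0 T := by
  have := dyadic_mem_Icc hT (n := n) (i := i + 1) hi
  push_cast at this
  exact this

theorem dyadic_succ_sub (T : ℝ) (n i : ℕ) :
    T * ((i : ℝ) + 1) / 2 ^ n - T * i / 2 ^ n = T / 2 ^ n := by
  ring

theorem tendsto_mesh (T : ℝ) : Tendsto (fun n : ℕ ↦ T / 2 ^ n) atTop (𝓝 0) := by
  have := (tendsto_pow_atTop_nhds_zero_of_lt_one (r := (1 / 2 : ℝ)) (by norm_num)
    (by norm_num)).const_mul T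
  rw [mul_zero] at this
  refine this.congr fun n ↦ ?_
  rw [one_div, inv_pow, div_eq_mul_inv]

/-- The sums include every interval that starts at or before `t`, so they overshoot `t` by at most
one mesh: `N` is the index of the first dyadic point after `t`, capped at `2 ^ n`. Being an initial
segment, the index set allows telescoping. -/
theorem exists_dyadicIndices_eq_range {T : ℝ} (hT : 0 < T) (n : ℕ) {t : ℝ}
    (ht : t ∈ Set.Icc 0 T) :
    ∃ N ≤ 2 ^ n, dyadicIndices T n t = Finset.range N ∧
      t ≤ T * N / 2 ^ n ∧ T * N / 2 ^ n ≤ t + T / 2 ^ n := by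
  have h2 : (0 : ℝ) < 2 ^ n := by positivity
  have key : ∀ x : ℝ, T * x / 2 ^ n ≤ t ↔ x ≤ t * 2 ^ n / T := fun x ↦ by
    rw [div_le_iff₀ h2, le_div_iff₀ hT, mul_comm]
  have hnn : 0 ≤ t * 2 ^ n / T := by have := ht.1; positivity
  refine ⟨min (2 ^ n) (⌊t * 2 ^ n / T⌋₊ + 1), min_le_left _ _, ?_, ?_, ?_⟩
  · ext i
    rw [mem_dyadicIndices, key, Finset.mem_range, lt_min_iff, Nat.lt_succ_iff, Nat.le_floor_iff hnn]
  · rcases le_total (2 ^ n) (⌊t * 2 ^ n / T⌋₊ + 1) with h | h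
    · rw [min_eq_left h]
      push_cast
      rw [mul_div_assoc, div_self h2.ne', mul_one]
      exact ht.2
    · rw [min_eq_right h]
      by_contra hc
      have := (key _).1 (not_le.1 hc).le
      have h3 := Nat.lt_floor_add_one (t * 2 ^ n / T)
      push_cast at this
      linarith
  · have h1 : T * (⌊t * 2 ^ n / T⌋₊ : ℝ) / 2 ^ n ≤ t := (key _).2 (Nat.floor_le hnn)
    have h4 : ((min (2 ^ n) (⌊t * 2 ^ n / T⌋₊ + 1) : ℕ) : ℝ) ≤ (⌊t * 2 ^ n / T⌋₊ : ℝ) + 1 := by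
      exact_mod_cast min_le_right _ _
    calc T * ((min (2 ^ n) (⌊t * 2 ^ n / T⌋₊ + 1) : ℕ) : ℝ) / 2 ^ n
        ≤ T * ((⌊t * 2 ^ n / T⌋₊ : ℝ) + 1) / 2 ^ n := by gcongr
      _ = T * (⌊t * 2 ^ n / T⌋₊ : ℝ) / 2 ^ n + T / 2 ^ n := by ring
      _ ≤ _ := by linarith

theorem dyadicIndices_self {T : ℝ} (hT : 0 < T) (n : ℕ) :
    dyadicIndices T n T = Finset.range (2 ^ n) := by
  ext i
  rw [mem_dyadicIndices, Finset.mem_range, and_iff_left_iff_imp]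
  exact fun hi ↦ (dyadic_mem_Icc hT hi.le).2

theorem eventually_abs_sub_le_of_continuousOn {T : ℝ} {f : ℝ → ℝ}
    (hf : ContinuousOn f (Set.Icc 0 T)) {ε : ℝ} (hε : 0 < ε) :
    ∀ᶠ n : ℕ in atTop, ∀ s ∈ Set.Icc 0 T, ∀ u ∈ Set.Icc 0 T, |s - u| ≤ T / 2 ^ n →
      |f s - f u| ≤ ε := by
  have huc := isCompact_Icc.uniformContinuousOn_of_continuous hf
  rw [Metric.uniformContinuousOn_iff] at huc
  obtain ⟨δ, hδ, h⟩ := huc ε hε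
  filter_upwards [(tendsto_mesh T).eventually_lt_const hδ] with n hn s hs u hu hsu
  exact (h s hs u hu (lt_of_le_of_lt hsu hn)).le

/-- Comparison of a Riemann-Stieltjes type sum with the integral over one interval. -/
theorem abs_sum_sub_integral_le {T : ℝ} {w : ℕ → ℝ} (hw : ∀ i, 0 ≤ w i) {c : ℝ}
    (hc : 0 ≤ c) {g : ℝ → ℝ} (hg : ContinuousOn g (Set.Icc 0 T)) {a b ε : ℝ} (n : ℕ)
    (ha : 0 ≤ a) (hab : a ≤ b) (hb : b ≤ T) (hε : ∀ x ∈ Set.Icc a b, |g x - g b| ≤ ε) :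
    |(∑ i ∈ dyadicIndices T n b, g (T * i / 2 ^ n) * w i) -
        (∑ i ∈ dyadicIndices T n a, g (T * i / 2 ^ n) * w i) - c * ∫ s in a..b, g s| ≤
      ε * ((∑ i ∈ dyadicIndices T n b, w i) - ∑ i ∈ dyadicIndices T n a, w i) +
      |g b| * |(∑ i ∈ dyadicIndices T n b, w i) - (∑ i ∈ dyadicIndices T n a, w i) - c * (b - a)| +
      c * ε * (b - a) := by
  have hsub := dyadicIndices_subset (T := T) n hab
  have hsd : ∀ f : ℕ → ℝ, (∑ i ∈ dyadicIndices T n b, f i) - ∑ i ∈ dyadicIndices T n a, f i =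
      ∑ i ∈ dyadicIndices T n b \ dyadicIndices T n a, f i := fun f ↦ by
    rw [← Finset.sum_sdiff hsub]; ring
  have hint : IntervalIntegrable g volume a b :=
    (hg.mono (by rw [Set.uIcc_of_le hab]; exact Set.Icc_subset_Icc ha hb)).intervalIntegrable
  have h1 : |∑ i ∈ dyadicIndices T n b \ dyadicIndices T n a, (g (T * i / 2 ^ n) - g b) * w i| ≤
      ε * ∑ i ∈ dyadicIndices T n b \ dyadicIndices T n a, w i := by
    rw [Finset.mul_sum]
    refine (Finset.abs_sum_le_sum_abs _ _).trans (Finset.sum_le_sum fun i hi ↦ ?_)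
    rw [Finset.mem_sdiff, mem_dyadicIndices, mem_dyadicIndices] at hi
    rw [abs_mul, abs_of_nonneg (hw i)]
    refine mul_le_mul_of_nonneg_right (hε _ ⟨?_, hi.1.2⟩) (hw i)
    by_contra hcon
    exact hi.2 ⟨hi.1.1, (not_le.1 hcon).le⟩
  have h2 : |(∫ s in a..b, g s) - g b * (b - a)| ≤ ε * (b - a) := by
    have : (∫ s in a..b, g s) - g b * (b - a) = ∫ s in a..b, (g s - g b) := by
      rw [intervalIntegral.integral_sub hint (by simp), intervalIntegral.integral_const,
        smul_eq_mul, mul_comm]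
    rw [this]
    have := intervalIntegral.norm_integral_le_of_norm_le_const (a := a) (b := b) (C := ε)
      (f := fun s ↦ g s - g b) (fun x hx ↦ by
        rw [Set.uIoc_of_le hab] at hx
        exact hε x ⟨hx.1.le, hx.2⟩)
    rwa [Real.norm_eq_abs, abs_of_nonneg (by linarith : 0 ≤ b - a)] at this
  rw [hsd, hsd]
  set A := ∑ i ∈ dyadicIndices T n b \ dyadicIndices T n a, w i
  have h3 : (∑ i ∈ dyadicIndices T n b \ dyadicIndices T n a, g (T * i / 2 ^ n) * w i) -
      c * ∫ s in a..b, g s =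
      (∑ i ∈ dyadicIndices T n b \ dyadicIndices T n a, (g (T * i / 2 ^ n) - g b) * w i) +
      g b * (A - c * (b - a)) - c * ((∫ s in a..b, g s) - g b * (b - a)) := by
    simp only [sub_mul, Finset.sum_sub_distrib, ← Finset.mul_sum]
    ring
  rw [h3]
  have h4 : |c * ((∫ s in a..b, g s) - g b * (b - a))| ≤ c * ε * (b - a) := by
    rw [abs_mul, abs_of_nonneg hc, mul_assoc]
    exact mul_le_mul_of_nonneg_left h2 hc
  have h5 := abs_mul (g b) (A - c * (b - a))
  have h6 := abs_le.1 h1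
  have h7 := abs_le.1 h4
  have h8 := abs_le.1 h5.le
  rw [abs_le]
  constructor <;> linarith

/-- If the masses of `[0, t]` under discrete measures carried by the dyadic points converge to
`c t` for every `t`, then the integrals of continuous functions converge as well. -/
theorem tendsto_sum_mul_of_tendsto_sum {T : ℝ} (hT : 0 < T) {w : ℕ → ℕ → ℝ}
    (hw : ∀ n i, 0 ≤ w n i) {c : ℝ} (hc : 0 ≤ c)
    (hA : ∀ t ∈ Set.Icc 0 T,
      Tendsto (fun n ↦ ∑ i ∈ dyadicIndices T n t, w n i) atTop (𝓝 (c * t)))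
    {g : ℝ → ℝ} (hg : ContinuousOn g (Set.Icc 0 T)) {t : ℝ} (ht : t ∈ Set.Icc 0 T) :
    Tendsto (fun n ↦ ∑ i ∈ dyadicIndices T n t, g (T * i / 2 ^ n) * w n i) atTop
      (𝓝 (c * ∫ s in (0 : ℝ)..t, g s)) := by
  have h0 : (0 : ℝ) ∈ Set.Icc 0 T := ⟨le_rfl, hT.le⟩
  have hz : Tendsto (fun n ↦ ∑ i ∈ dyadicIndices T n 0, g (T * i / 2 ^ n) * w n i) atTop
      (𝓝 0) := by
    have h1 := (hA 0 h0).const_mul (g 0)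
    rw [mul_zero, mul_zero] at h1
    refine h1.congr fun n ↦ ?_
    rw [Finset.mul_sum]
    refine Finset.sum_congr rfl fun i hi ↦ ?_
    rw [mem_dyadicIndices] at hi
    have : T * (i : ℝ) / 2 ^ n = 0 := le_antisymm hi.2 (by positivity)
    rw [this]
  rw [Metric.tendsto_atTop']
  -- The oscillation of `g` costs `ε c t` twice, once for the discrete mass and once for the
  -- integral; the extra `1` makes the inequality strict even if `c t = 0`.
  suffices H : ∀ ε > 0, ∀ᶠ n in atTop,
      |(∑ i ∈ dyadicIndices T n t, g (T * i / 2 ^ n) * w n i) - c * ∫ s in (0 : ℝ)..t, g s| <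
        ε * (2 * c * t + 1) by
    intro ε hε
    have hp : 0 < 2 * c * t + 1 := by have := ht.1; positivity
    obtain ⟨n, hn⟩ := eventually_atTop.1 (H (ε / (2 * c * t + 1)) (by positivity))
    refine ⟨n, fun m hm ↦ ?_⟩
    have := hn m hm.le
    rwa [div_mul_cancel₀ _ hp.ne'] at this
  intro ε hε
  have huc := isCompact_Icc.uniformContinuousOn_of_continuous hg
  rw [Metric.uniformContinuousOn_iff] at huc
  obtain ⟨δ, hδ, hmod⟩ := huc ε hε
  obtain ⟨K, hK⟩ := exists_nat_gt (t / δ)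
  have hKpos : 0 < (K : ℝ) + 1 := by positivity
  -- A fixed subdivision of `[0, t]`, chosen before `n` tends to infinity, on whose pieces `g`
  -- oscillates by at most `ε`.
  set s : ℕ → ℝ := fun k ↦ k * t / (K + 1) with hs
  have hs0 : s 0 = 0 := by simp [hs]
  have hsK : s (K + 1) = t := by
    simp only [hs]; push_cast; field_simp
  have hstep : ∀ k, s (k + 1) - s k = t / (K + 1) := fun k ↦ by
    simp only [hs]; push_cast; ring
  have htK : t / (K + 1) < δ := by
    rw [div_lt_iff₀ hKpos]
    rw [div_lt_iff₀ hδ] at hK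
    nlinarith
  have htK0 : 0 ≤ t / (K + 1) := by have := ht.1; positivity
  have hs_nonneg : ∀ k, 0 ≤ s k := fun k ↦ by
    have := ht.1; simp only [hs]; positivity
  have hs_le : ∀ k ≤ K + 1, s k ≤ T := fun k hk ↦ by
    refine le_trans ?_ ht.2
    rw [← hsK]
    have : (k : ℝ) ≤ ((K + 1 : ℕ) : ℝ) := by exact_mod_cast hk
    have := ht.1
    simp only [hs]; gcongr
  set F : ℕ → ℝ → ℝ := fun n x ↦ (∑ i ∈ dyadicIndices T n x, g (T * i / 2 ^ n) * w n i) with hF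
  set A : ℕ → ℝ → ℝ := fun n x ↦ ∑ i ∈ dyadicIndices T n x, w n i with hAdef
  set bd : ℕ → ℝ := fun n ↦ |F n 0| + (ε * (A n t - A n 0) +
    ∑ k ∈ Finset.range (K + 1), |g (s (k + 1))| *
      |A n (s (k + 1)) - A n (s k) - c * (s (k + 1) - s k)| + c * ε * t) with hbd
  have hbound : ∀ n, |F n t - c * ∫ x in (0 : ℝ)..t, g x| ≤ bd n := by
    intro n
    have hII : ∀ k < K + 1, IntervalIntegrable g volume (s k) (s (k + 1)) := fun k hk ↦
      (hg.mono (by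
        rw [Set.uIcc_of_le (by linarith [hstep k])]
        exact Set.Icc_subset_Icc (hs_nonneg k) (hs_le _ hk))).intervalIntegrable
    have h1 : F n t - c * ∫ x in (0 : ℝ)..t, g x = F n 0 + ∑ k ∈ Finset.range (K + 1),
        (F n (s (k + 1)) - F n (s k) - c * ∫ x in (s k)..(s (k + 1)), g x) := by
      rw [Finset.sum_sub_distrib, Finset.sum_range_sub (fun k ↦ F n (s k)), ← Finset.mul_sum,
        intervalIntegral.sum_integral_adjacent_intervals hII, hs0, hsK]
      ring
    rw [h1]
    refine (abs_add_le _ _).trans ?_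
    rw [hbd]
    refine add_le_add le_rfl ?_
    refine (Finset.abs_sum_le_sum_abs _ _).trans ?_
    have h2 : ∀ k ∈ Finset.range (K + 1),
        |F n (s (k + 1)) - F n (s k) - c * ∫ x in (s k)..(s (k + 1)), g x| ≤
        ε * (A n (s (k + 1)) - A n (s k)) + |g (s (k + 1))| *
          |A n (s (k + 1)) - A n (s k) - c * (s (k + 1) - s k)| +
          c * ε * (s (k + 1) - s k) := by
      intro k hk
      have hk := Finset.mem_range.1 hk
      refine abs_sum_sub_integral_le (hw n) hc hg n (hs_nonneg k) (by linarith [hstep k])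
        (hs_le _ hk) fun x hx ↦ ?_
      refine (hmod x ⟨(hs_nonneg k).trans hx.1, hx.2.trans (hs_le _ hk)⟩ _
        ⟨hs_nonneg _, hs_le _ hk⟩ ?_).le
      rw [Real.dist_eq, abs_sub_comm, abs_of_nonneg (by linarith [hx.2])]
      linarith [hx.1, hstep k]
    refine (Finset.sum_le_sum h2).trans (le_of_eq ?_)
    rw [Finset.sum_add_distrib, Finset.sum_add_distrib, ← Finset.mul_sum, ← Finset.mul_sum,
      Finset.sum_range_sub (fun k ↦ A n (s k)), Finset.sum_range_sub s, hs0, hsK, sub_zero]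
  have hlim : Tendsto bd atTop (𝓝 (|0| + (ε * (c * t - c * 0) +
      ∑ k ∈ Finset.range (K + 1), |g (s (k + 1))| *
        |c * s (k + 1) - c * s k - c * (s (k + 1) - s k)| + c * ε * t))) := by
    refine hz.abs.add (Tendsto.add (Tendsto.add (((hA t ht).sub (hA 0 h0)).const_mul _)
      (tendsto_finsetSum _ fun k hk ↦ ?_)) tendsto_const_nhds)
    have hk := Finset.mem_range.1 hk
    exact ((((hA _ ⟨hs_nonneg _, hs_le _ hk⟩).sub
      (hA _ ⟨hs_nonneg _, hs_le _ hk.le⟩)).sub tendsto_const_nhds).abs).const_mul _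
  have hlim' : |0| + (ε * (c * t - c * 0) +
      ∑ k ∈ Finset.range (K + 1), |g (s (k + 1))| *
        |c * s (k + 1) - c * s k - c * (s (k + 1) - s k)| + c * ε * t) = ε * (2 * c * t) := by
    have : ∀ k, |c * s (k + 1) - c * s k - c * (s (k + 1) - s k)| = 0 := fun k ↦ by
      rw [abs_eq_zero]; ring
    simp only [this, mul_zero, Finset.sum_const_zero, abs_zero]
    ring
  rw [hlim'] at hlim
  filter_upwards [hlim.eventually_lt_const (show ε * (2 * c * t) < ε * (2 * c * t + 1) by
    linarith)] with n hn
  exact (hbound n).trans_lt hn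

/-- Convergence of dyadic Riemann sums. -/
theorem tendsto_riemann_sum {T : ℝ} (hT : 0 < T) {g : ℝ → ℝ}
    (hg : ContinuousOn g (Set.Icc 0 T)) {t : ℝ} (ht : t ∈ Set.Icc 0 T) :
    Tendsto (fun n ↦ ∑ i ∈ dyadicIndices T n t, g (T * i / 2 ^ n) * (T / 2 ^ n)) atTop
      (𝓝 (∫ s in (0 : ℝ)..t, g s)) := by
  have := tendsto_sum_mul_of_tendsto_sum hT (w := fun n _ ↦ T / 2 ^ n) (c := 1)
    (fun n i ↦ by positivity) zero_le_one (fun t ht ↦ ?_) hg ht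
  · simpa using this
  · rw [one_mul]
    have hup : Tendsto (fun n : ℕ ↦ t + T / 2 ^ n) atTop (𝓝 t) := by
      simpa using (tendsto_mesh T).const_add t
    refine tendsto_of_tendsto_of_tendsto_of_le_of_le tendsto_const_nhds hup (fun n ↦ ?_)
      (fun n ↦ ?_) <;>
    · obtain ⟨N, -, hN, h1, h2⟩ := exists_dyadicIndices_eq_range hT n ht
      simp only [hN, Finset.sum_const, Finset.card_range, nsmul_eq_mul]
      have : (N : ℝ) * (T / 2 ^ n) = T * N / 2 ^ n := by ring
      linarith

/-- Convergence of masses at the dyadic points implies convergence at all points. -/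
theorem tendsto_sum_of_tendsto_sum_dyadic {T : ℝ} (hT : 0 < T) {w : ℕ → ℕ → ℝ}
    (hw : ∀ n i, 0 ≤ w n i) {c : ℝ} (hc : 0 ≤ c)
    (hA : ∀ m i : ℕ, i ≤ 2 ^ m →
      Tendsto (fun n ↦ ∑ j ∈ dyadicIndices T n (T * i / 2 ^ m), w n j) atTop
        (𝓝 (c * (T * i / 2 ^ m))))
    {t : ℝ} (ht : t ∈ Set.Icc 0 T) :
    Tendsto (fun n ↦ ∑ j ∈ dyadicIndices T n t, w n j) atTop (𝓝 (c * t)) := by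
  have hmono : ∀ n, ∀ a b, a ≤ b → ∑ j ∈ dyadicIndices T n a, w n j ≤
      ∑ j ∈ dyadicIndices T n b, w n j := fun n a b hab ↦
    Finset.sum_le_sum_of_subset_of_nonneg (dyadicIndices_subset n hab) fun j _ _ ↦ hw n j
  rw [Metric.tendsto_atTop']
  intro ε hε
  have hmesh : Tendsto (fun m : ℕ ↦ c * (T / 2 ^ m)) atTop (𝓝 0) := by
    simpa using (tendsto_mesh T).const_mul c
  obtain ⟨m, hm⟩ := (hmesh.eventually_lt_const (half_pos hε)).exists
  -- Masses increase with time, so the mass at `t` lies between those at the points `N - 1` and `N`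
  -- of a fixed level `m`. Truncated subtraction takes care of `N = 0`.
  obtain ⟨N, hN, -, h1, h2⟩ := exists_dyadicIndices_eq_range hT m ht
  have hup := (hA m N hN).eventually_lt_const
    (show c * (T * N / 2 ^ m) < c * (T * N / 2 ^ m) + ε / 2 by linarith)
  have hlow := (hA m (N - 1) ((Nat.sub_le _ _).trans hN)).eventually_const_lt
    (show c * (T * (N - 1 : ℕ) / 2 ^ m) - ε / 2 < c * (T * (N - 1 : ℕ) / 2 ^ m) by linarith)
  have hle : T * (N - 1 : ℕ) / 2 ^ m ≤ t ∧ T * N / 2 ^ m ≤ T * (N - 1 : ℕ) / 2 ^ m + T / 2 ^ m := by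
    rcases Nat.eq_zero_or_pos N with rfl | hpos
    · simp only [Nat.zero_sub, Nat.cast_zero, mul_zero, zero_div, zero_add]
      exact ⟨ht.1, by positivity⟩
    · have : ((N - 1 : ℕ) : ℝ) = N - 1 := by rw [Nat.cast_sub hpos]; simp
      rw [this]
      constructor
      · have : T * ((N : ℝ) - 1) / 2 ^ m = T * N / 2 ^ m - T / 2 ^ m := by ring
        linarith
      · apply le_of_eq; ring
  obtain ⟨n0, hn0⟩ := eventually_atTop.1 (hup.and hlow)
  refine ⟨n0, fun n hn ↦ ?_⟩
  obtain ⟨h3, h4⟩ := hn0 n hn.le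
  have h5 := hmono n _ _ h1
  have h6 := hmono n _ _ hle.1
  have h7 : c * (T * N / 2 ^ m) ≤ c * (T * (N - 1 : ℕ) / 2 ^ m) + c * (T / 2 ^ m) := by
    rw [← mul_add]; exact mul_le_mul_of_nonneg_left hle.2 hc
  have h8 := mul_le_mul_of_nonneg_left h1 hc
  have h9 := mul_le_mul_of_nonneg_left hle.1 hc
  rw [Real.dist_eq, abs_lt]
  constructor <;> linarith

/-! ### Pathwise quadratic variation and the discrete Itô formula -/

/-- The dyadic forward sum of a pair of paths. -/
def pathSum (T : ℝ) (y x : ℝ → ℝ) (n : ℕ) (t : ℝ) : ℝ :=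
  ∑ i ∈ dyadicIndices T n t, y (T * i / 2 ^ n) * (x (T * (i + 1) / 2 ^ n) - x (T * i / 2 ^ n))

theorem forwardSum_eq_pathSum {Ω : Type*} (T : ℝ) (Y X : ℝ → Ω → ℝ) (n : ℕ) (t : ℝ) (ω : Ω) :
    forwardSum T Y X n t ω = pathSum T (fun s ↦ Y s ω) (fun s ↦ X s ω) n t := rfl

theorem pathSum_congr {T : ℝ} (hT : 0 < T) {y y' x x' : ℝ → ℝ}
    (hy : ∀ s ∈ Set.Icc 0 T, y s = y' s) (hx : ∀ s ∈ Set.Icc 0 T, x s = x' s) (n : ℕ) (t : ℝ) :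
    pathSum T y x n t = pathSum T y' x' n t := by
  refine Finset.sum_congr rfl fun i hi ↦ ?_
  have hi := (mem_dyadicIndices.1 hi).1
  rw [hy _ (dyadic_mem_Icc hT hi.le), hx _ (dyadic_mem_Icc hT hi.le),
    hx _ (dyadic_succ_mem_Icc hT hi)]

/-- The logarithm of the path `η` has quadratic variation `σ² t` along dyadic partitions. -/
def HasLogQuadraticVariation (T σ : ℝ) (η : ℝ → ℝ) : Prop :=
  ∀ t ∈ Set.Icc 0 T, Tendsto (fun n ↦ ∑ i ∈ dyadicIndices T n t,
    (Real.log (η (T * (i + 1) / 2 ^ n)) - Real.log (η (T * i / 2 ^ n))) ^ 2) atTop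
    (𝓝 (σ ^ 2 * t))

theorem HasLogQuadraticVariation.congr {T σ : ℝ} (hT : 0 < T) {η η' : ℝ → ℝ}
    (h : HasLogQuadraticVariation T σ η) (hη : ∀ s ∈ Set.Icc 0 T, η s = η' s) :
    HasLogQuadraticVariation T σ η' := by
  intro t ht
  refine (h t ht).congr fun n ↦ Finset.sum_congr rfl fun i hi ↦ ?_
  have hi := (mem_dyadicIndices.1 hi).1
  rw [hη _ (dyadic_mem_Icc hT hi.le), hη _ (dyadic_succ_mem_Icc hT hi)]

theorem abs_exp_sub_one_sq_sub_sq_le {x : ℝ} (hx : |x| ≤ 1) :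
    |(Real.exp x - 1) ^ 2 - x ^ 2| ≤ 3 * |x| * x ^ 2 := by
  have h1 := Real.abs_exp_sub_one_sub_id_le hx
  have h2 : (Real.exp x - 1) ^ 2 - x ^ 2 =
      (Real.exp x - 1 - x) * (2 * x + (Real.exp x - 1 - x)) := by ring
  rw [h2, abs_mul, mul_comm (3 * |x|)]
  have h4 : |x| ^ 2 = x ^ 2 := sq_abs x
  have h3 : |2 * x + (Real.exp x - 1 - x)| ≤ 3 * |x| := by
    calc _ ≤ |2 * x| + |Real.exp x - 1 - x| := abs_add_le _ _
      _ ≤ 2 * |x| + x ^ 2 := by rw [abs_mul, abs_two]; gcongr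
      _ ≤ 3 * |x| := by nlinarith [abs_nonneg x]
  exact mul_le_mul h1 h3 (abs_nonneg _) (sq_nonneg _)

theorem eventually_abs_increment_le {T : ℝ} (hT : 0 < T) {f : ℝ → ℝ}
    (hf : ContinuousOn f (Set.Icc 0 T)) {ε : ℝ} (hε : 0 < ε) :
    ∀ᶠ n : ℕ in atTop, ∀ i : ℕ, i < 2 ^ n →
      |f (T * ((i : ℝ) + 1) / 2 ^ n) - f (T * i / 2 ^ n)| ≤ ε := by
  filter_upwards [eventually_abs_sub_le_of_continuousOn hf hε] with n hn i hi
  refine hn _ (dyadic_succ_mem_Icc hT hi) _ (dyadic_mem_Icc hT hi.le) ?_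
  rw [dyadic_succ_sub, abs_of_pos (by positivity)]

/-- If `x` is an increment of the logarithm, the increment of `η` is `η (exp x - 1)`, and `(exp x -
1)²` differs from `x²` by `O(|x|³)`. Uniform continuity makes all `|x|` small while the sum of the
`x²` stays bounded, so the squared price increments can be replaced by `η²` times the squared
log-increments. -/
theorem tendsto_sum_mul_increment_sq {T σ : ℝ} (hT : 0 < T) {η : ℝ → ℝ}
    (hη : ContinuousOn η (Set.Icc 0 T)) (hpos : ∀ s ∈ Set.Icc 0 T, 0 < η s)
    (hqv : HasLogQuadraticVariation T σ η) {g : ℝ → ℝ} (hg : ContinuousOn g (Set.Icc 0 T))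
    {t : ℝ} (ht : t ∈ Set.Icc 0 T) :
    Tendsto (fun n ↦ ∑ i ∈ dyadicIndices T n t,
      g (T * i / 2 ^ n) * (η (T * (i + 1) / 2 ^ n) - η (T * i / 2 ^ n)) ^ 2) atTop
      (𝓝 (σ ^ 2 * ∫ s in (0 : ℝ)..t, g s * η s ^ 2)) := by
  have hgη : ContinuousOn (fun s ↦ g s * η s ^ 2) (Set.Icc 0 T) := hg.mul (hη.pow 2)
  set w : ℕ → ℕ → ℝ := fun n i ↦
    (Real.log (η (T * (i + 1) / 2 ^ n)) - Real.log (η (T * i / 2 ^ n))) ^ 2 with hw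
  have hmain := tendsto_sum_mul_of_tendsto_sum hT (w := w) (fun n i ↦ sq_nonneg _) (sq_nonneg σ)
    hqv hgη ht
  obtain ⟨C, hC⟩ := isCompact_Icc.exists_bound_of_continuousOn hgη
  have hC0 : 0 ≤ C := (norm_nonneg _).trans (hC 0 ⟨le_rfl, hT.le⟩)
  have hlog : ContinuousOn (fun s ↦ Real.log (η s)) (Set.Icc 0 T) :=
    hη.log fun s hs ↦ (hpos s hs).ne'
  have hdiff : Tendsto (fun n ↦ (∑ i ∈ dyadicIndices T n t,
      g (T * i / 2 ^ n) * (η (T * (i + 1) / 2 ^ n) - η (T * i / 2 ^ n)) ^ 2) -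
      ∑ i ∈ dyadicIndices T n t, g (T * i / 2 ^ n) * η (T * i / 2 ^ n) ^ 2 * w n i) atTop
      (𝓝 0) := by
    rw [Metric.tendsto_atTop']
    intro ε hε
    set M := σ ^ 2 * t + 1 with hM
    have hMpos : 0 < M := by have := ht.1; positivity
    set δ := min 1 (ε / (2 * (C + 1) * 3 * M)) with hδ
    have hδpos : 0 < δ := by positivity
    obtain ⟨n0, hn0⟩ := eventually_atTop.1 ((eventually_abs_increment_le hT hlog hδpos).and
      ((hqv t ht).eventually_lt_const (show σ ^ 2 * t < M by linarith)))
    refine ⟨n0, fun n hn ↦ ?_⟩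
    obtain ⟨h1, h2⟩ := hn0 n hn.le
    rw [Real.dist_eq, sub_zero, ← Finset.sum_sub_distrib]
    have hterm : ∀ i ∈ dyadicIndices T n t,
        |g (T * i / 2 ^ n) * (η (T * (i + 1) / 2 ^ n) - η (T * i / 2 ^ n)) ^ 2 -
          g (T * i / 2 ^ n) * η (T * i / 2 ^ n) ^ 2 * w n i| ≤ C * (3 * δ) * w n i := by
      intro i hi
      have hi := (mem_dyadicIndices.1 hi).1
      have p0 := hpos _ (dyadic_mem_Icc hT hi.le)
      have p1 := hpos _ (dyadic_succ_mem_Icc hT hi)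
      have hx := h1 i hi
      set a := η (T * i / 2 ^ n)
      set b := η (T * (i + 1) / 2 ^ n)
      have hwx : w n i = (Real.log b - Real.log a) ^ 2 := rfl
      rw [hwx]
      set x := Real.log b - Real.log a with hxdef
      have hb : b = a * Real.exp x := by
        rw [hxdef, Real.exp_sub, Real.exp_log p0, Real.exp_log p1]
        field_simp
      have hfac : g (T * i / 2 ^ n) * (b - a) ^ 2 - g (T * i / 2 ^ n) * a ^ 2 * x ^ 2 =
          (g (T * i / 2 ^ n) * a ^ 2) * ((Real.exp x - 1) ^ 2 - x ^ 2) := by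
        rw [hb]; ring
      rw [hfac, abs_mul, mul_assoc C]
      refine mul_le_mul (hC _ (dyadic_mem_Icc hT hi.le)) ?_ (abs_nonneg _) hC0
      refine (abs_exp_sub_one_sq_sub_sq_le (hx.trans (min_le_left _ _))).trans ?_
      gcongr
    calc _ ≤ ∑ i ∈ dyadicIndices T n t, C * (3 * δ) * w n i :=
        (Finset.abs_sum_le_sum_abs _ _).trans (Finset.sum_le_sum hterm)
      _ = C * (3 * δ) * ∑ i ∈ dyadicIndices T n t, w n i := by rw [Finset.mul_sum]
      _ ≤ C * (3 * δ) * M := by gcongr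
      _ ≤ C * (3 * (ε / (2 * (C + 1) * 3 * M))) * M := by gcongr; exact min_le_right _ _
      _ = ε * (C / (2 * (C + 1))) := by field_simp
      _ < ε * 1 := by
        gcongr
        rw [div_lt_one (by positivity)]
        linarith
      _ = ε := mul_one _
  have := hdiff.add hmain
  simpa using this

/-- A discrete Itô formula with error terms. -/
theorem eventually_abs_pathSum_sub_le {T σ : ℝ} (hT : 0 < T) {η : ℝ → ℝ}
    (hη : ContinuousOn η (Set.Icc 0 T)) (hpos : ∀ s ∈ Set.Icc 0 T, 0 < η s)
    (hqv : HasLogQuadraticVariation T σ η) {y U k₁ k₂ : ℝ → ℝ}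
    (hk₁ : ContinuousOn k₁ (Set.Icc 0 T)) (hk₂ : ContinuousOn k₂ (Set.Icc 0 T))
    {ε E : ℝ} (hε : 0 < ε) {e : ℕ → ℕ → ℝ} (he : ∀ n, ∀ i : ℕ, i < 2 ^ n → 0 ≤ e n i)
    (hE : ∀ n, ∑ i ∈ Finset.range (2 ^ n), e n i ≤ E)
    (h : ∀ᶠ n : ℕ in atTop, ∀ i : ℕ, i < 2 ^ n →
      |y (T * i / 2 ^ n) * (η (T * (i + 1) / 2 ^ n) - η (T * i / 2 ^ n)) -
        (U (T * (i + 1) / 2 ^ n) - U (T * i / 2 ^ n)) - k₁ (T * i / 2 ^ n) * (T / 2 ^ n) -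
        k₂ (T * i / 2 ^ n) * (η (T * (i + 1) / 2 ^ n) - η (T * i / 2 ^ n)) ^ 2| ≤
      ε * (T / 2 ^ n + (η (T * (i + 1) / 2 ^ n) - η (T * i / 2 ^ n)) ^ 2) + e n i)
    {t : ℝ} (ht : t ∈ Set.Icc 0 T) :
    ∀ᶠ n : ℕ in atTop, ∃ s ∈ Set.Icc 0 T, |s - t| ≤ T / 2 ^ n ∧
      |pathSum T y η n t - (U s - U 0 + ((∫ u in (0 : ℝ)..t, k₁ u) +
        σ ^ 2 * ∫ u in (0 : ℝ)..t, k₂ u * η u ^ 2))| ≤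
      ε * (T + σ ^ 2 * (∫ u in (0 : ℝ)..T, η u ^ 2) + 2) + E := by
  have hTT : T ∈ Set.Icc 0 T := ⟨hT.le, le_rfl⟩
  have l1 := tendsto_riemann_sum hT hk₁ ht
  have l2 := tendsto_sum_mul_increment_sq hT hη hpos hqv hk₂ ht
  have l3 := tendsto_sum_mul_increment_sq hT hη hpos hqv (g := fun _ ↦ 1) continuousOn_const hTT
  simp only [one_mul] at l3
  -- The summand `2` in the final bound: one `ε` pays for these two limits, the other for replacing
  -- the discrete quadratic variation on `[0, T]` by its limit.
  have l12 := l1.add l2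
  rw [Metric.tendsto_atTop'] at l12
  obtain ⟨n1, hn1⟩ := l12 ε hε
  filter_upwards [h, l3.eventually_lt_const (lt_add_one _), eventually_gt_atTop n1]
    with n hn h3 hn12
  have h12 := hn1 n hn12
  obtain ⟨N, hN2, hN, ht1, ht2⟩ := exists_dyadicIndices_eq_range hT n ht
  -- The sum telescopes to `U` at the end of the last interval rather than at `t`. Nothing is
  -- assumed about the continuity of `U`, so this point stays in the statement.
  refine ⟨T * N / 2 ^ n, dyadic_mem_Icc hT hN2, ?_, ?_⟩
  · rw [abs_of_nonneg (by linarith)]; linarith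
  rw [dyadicIndices_self hT] at h3
  rw [Real.dist_eq] at h12
  have hUtel : ∑ i ∈ Finset.range N, (U (T * ((i : ℝ) + 1) / 2 ^ n) - U (T * i / 2 ^ n)) =
      U (T * N / 2 ^ n) - U 0 := by
    have := Finset.sum_range_sub (fun i : ℕ ↦ U (T * i / 2 ^ n)) N
    simpa using this
  have hmain : |∑ i ∈ Finset.range N,
      (y (T * i / 2 ^ n) * (η (T * (i + 1) / 2 ^ n) - η (T * i / 2 ^ n)) -
        (U (T * (i + 1) / 2 ^ n) - U (T * i / 2 ^ n)) - k₁ (T * i / 2 ^ n) * (T / 2 ^ n) -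
        k₂ (T * i / 2 ^ n) * (η (T * (i + 1) / 2 ^ n) - η (T * i / 2 ^ n)) ^ 2)| ≤
      ε * (T + (σ ^ 2 * (∫ u in (0 : ℝ)..T, η u ^ 2) + 1)) + E := by
    calc _ ≤ ∑ i ∈ Finset.range N,
          (ε * (T / 2 ^ n + (η (T * (i + 1) / 2 ^ n) - η (T * i / 2 ^ n)) ^ 2) + e n i) :=
          (Finset.abs_sum_le_sum_abs _ _).trans (Finset.sum_le_sum fun i hi ↦
            hn i ((Finset.mem_range.1 hi).trans_le hN2))
      _ ≤ ∑ i ∈ Finset.range (2 ^ n),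
          (ε * (T / 2 ^ n + (η (T * (i + 1) / 2 ^ n) - η (T * i / 2 ^ n)) ^ 2) + e n i) := by
          refine Finset.sum_le_sum_of_subset_of_nonneg (Finset.range_mono hN2) fun i hi _ ↦ ?_
          have := he n i (Finset.mem_range.1 hi)
          positivity
      _ = ε * (T + ∑ i ∈ Finset.range (2 ^ n),
            (η (T * (i + 1) / 2 ^ n) - η (T * i / 2 ^ n)) ^ 2) +
            ∑ i ∈ Finset.range (2 ^ n), e n i := by
          rw [Finset.sum_add_distrib, ← Finset.mul_sum, Finset.sum_add_distrib, Finset.sum_const,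
            Finset.card_range, nsmul_eq_mul]
          push_cast
          rw [mul_div_cancel₀ _ (by positivity)]
      _ ≤ _ := by
          have := hE n
          gcongr
  simp only [Finset.sum_sub_distrib, hUtel] at hmain
  rw [pathSum]
  rw [hN] at h12 ⊢
  have a1 := abs_le.1 hmain
  have a2 := abs_lt.1 h12
  rw [abs_le]
  constructor <;> linarith

/-! ### The state of a path: running extrema and integral -/

/-- Time, running maximum, running minimum and running integral of the path `η` at time `t`,
together with a price `x`. -/
def pathState (η : ℝ → ℝ) (t x : ℝ) : ℝ × ℝ × ℝ × ℝ × ℝ :=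
  (t, sSup ((fun u ↦ η u) '' Set.Icc 0 t), sInf ((fun u ↦ η u) '' Set.Icc 0 t),
    ∫ u in (0 : ℝ)..t, η u, x)

/-- The set on which the coefficient of a smooth strategy is continuously differentiable. -/
def stateDomain (T : ℝ) : Set (ℝ × ℝ × ℝ × ℝ × ℝ) :=
  Set.Icc 0 T ×ˢ Set.Ioi 0 ×ˢ Set.Ioi 0 ×ˢ Set.Ici 0 ×ˢ Set.Ioi 0

/-- The states of the paths with values in `[r, R]`. -/
def stateBox (T r R : ℝ) : Set (ℝ × ℝ × ℝ × ℝ × ℝ) :=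
  Set.Icc 0 T ×ˢ Set.Icc r R ×ˢ Set.Icc r R ×ˢ Set.Icc 0 (R * T) ×ˢ Set.Icc r R

theorem isCompact_stateBox (T r R : ℝ) : IsCompact (stateBox T r R) :=
  isCompact_Icc.prod (isCompact_Icc.prod (isCompact_Icc.prod (isCompact_Icc.prod isCompact_Icc)))

theorem convex_stateBox (T r R : ℝ) : Convex ℝ (stateBox T r R) :=
  (convex_Icc _ _).prod ((convex_Icc _ _).prod ((convex_Icc _ _).prod
    ((convex_Icc _ _).prod (convex_Icc _ _))))

theorem stateBox_subset_stateDomain {T r R : ℝ} (hr : 0 < r) :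
    stateBox T r R ⊆ stateDomain T := by
  rintro ⟨t, M, m, I, x⟩ ⟨h1, h2, h3, h4, h5⟩
  exact ⟨h1, lt_of_lt_of_le hr h2.1, lt_of_lt_of_le hr h3.1, h4.1, lt_of_lt_of_le hr h5.1⟩

theorem uniqueDiffOn_stateDomain {T : ℝ} (hT : 0 < T) : UniqueDiffOn ℝ (stateDomain T) :=
  (uniqueDiffOn_Icc hT).prod ((uniqueDiffOn_Ioi 0).prod ((uniqueDiffOn_Ioi 0).prod
    ((uniqueDiffOn_Ici 0).prod (uniqueDiffOn_Ioi 0))))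

/-- Only the price coordinate carries quadratic variation, so only its partial derivative enters the
Itô correction; in the other coordinates a Lipschitz bound is enough. The price ranges over an open
half-line, which makes the derivative two-sided in this direction although the domain has a boundary
in time and in the integral. -/
theorem exists_hasDerivAt_last {T : ℝ} (hT : 0 < T) {φ : ℝ × ℝ × ℝ × ℝ × ℝ → ℝ}
    (hφ : ContDiffOn ℝ 1 φ (stateDomain T)) :
    ∃ ψ : ℝ × ℝ × ℝ × ℝ × ℝ → ℝ, ContinuousOn ψ (stateDomain T) ∧
      ∀ t M m I x, (t, M, m, I, x) ∈ stateDomain T →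
        HasDerivAt (fun y ↦ φ (t, M, m, I, y)) (ψ (t, M, m, I, x)) x := by
  refine ⟨fun p ↦ fderivWithin ℝ φ (stateDomain T) p (0, 0, 0, 0, 1), ?_, ?_⟩
  · exact (hφ.continuousOn_fderivWithin (uniqueDiffOn_stateDomain hT) le_rfl).clm_apply
      continuousOn_const
  · intro t M m I x hp
    have h1 := (hφ.differentiableOn one_ne_zero _ hp).hasFDerivWithinAt
    have h2 : HasDerivWithinAt (fun y : ℝ ↦ (t, M, m, I, y)) (0, 0, 0, 0, 1) (Set.Ioi 0) x :=
      ((hasDerivAt_const x t).prodMk ((hasDerivAt_const x M).prodMk ((hasDerivAt_const x m).prodMk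
        ((hasDerivAt_const x I).prodMk (hasDerivAt_id x))))).hasDerivWithinAt
    have hmaps : Set.MapsTo (fun y : ℝ ↦ (t, M, m, I, y)) (Set.Ioi 0) (stateDomain T) :=
      fun y hy ↦ ⟨hp.1, hp.2.1, hp.2.2.1, hp.2.2.2.1, hy⟩
    have h3 := h1.comp_hasDerivWithinAt x h2 hmaps
    exact h3.hasDerivAt (Ioi_mem_nhds hp.2.2.2.2)

theorem exists_lipschitz_stateBox {T : ℝ} (hT : 0 < T) {φ : ℝ × ℝ × ℝ × ℝ × ℝ → ℝ}
    (hφ : ContDiffOn ℝ 1 φ (stateDomain T)) {r R : ℝ} (hr : 0 < r) :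
    ∃ L, 0 ≤ L ∧ ∀ p ∈ stateBox T r R, ∀ q ∈ stateBox T r R, |φ p - φ q| ≤ L * dist p q := by
  have hsub := stateBox_subset_stateDomain (T := T) (R := R) hr
  obtain ⟨L, hL⟩ := (isCompact_stateBox T r R).exists_bound_of_continuousOn
    ((hφ.continuousOn_fderivWithin (uniqueDiffOn_stateDomain hT) le_rfl).mono hsub)
  refine ⟨max L 0, le_max_right _ _, fun p hp q hq ↦ ?_⟩
  have := (convex_stateBox T r R).norm_image_sub_le_of_norm_hasFDerivWithin_le (f := φ)
    (f' := fderivWithin ℝ φ (stateDomain T)) (C := max L 0)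
    (fun x hx ↦ ((hφ.differentiableOn one_ne_zero _ (hsub hx)).hasFDerivWithinAt).mono hsub)
    (fun x hx ↦ (hL x hx).trans (le_max_left _ _)) hq hp
  rwa [Real.norm_eq_abs, ← dist_eq_norm] at this

section Paths

variable {η η' : ℝ → ℝ} {r R T s t : ℝ}

/-- Rescaling turns the running extrema into extrema over a compact set that does not move with `t`;
their continuity in `t` is then a compactness fact. -/
theorem image_Icc_eq (η : ℝ → ℝ) (ht : 0 ≤ t) :
    (fun u ↦ η u) '' Set.Icc 0 t = (fun u ↦ η (t * u)) '' Set.Icc 0 1 := by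
  have : Set.Icc 0 t = (fun u ↦ t * u) '' Set.Icc (0 : ℝ) 1 := by
    rw [Set.image_mul_left_Icc ht zero_le_one, mul_zero, mul_one]
  rw [this, Set.image_image]

theorem continuousOn_sSup_image (hη : Continuous η) :
    ContinuousOn (fun t ↦ sSup ((fun u ↦ η u) '' Set.Icc 0 t)) (Set.Ici 0) := by
  have h : Continuous fun t ↦ sSup ((fun u ↦ η (t * u)) '' Set.Icc (0 : ℝ) 1) :=
    isCompact_Icc.continuous_sSup (f := fun t u ↦ η (t * u)) (by
      change Continuous fun p : ℝ × ℝ ↦ η (p.1 * p.2)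
      fun_prop)
  exact h.continuousOn.congr fun t ht ↦ by rw [image_Icc_eq η ht]

theorem continuousOn_sInf_image (hη : Continuous η) :
    ContinuousOn (fun t ↦ sInf ((fun u ↦ η u) '' Set.Icc 0 t)) (Set.Ici 0) := by
  have h : Continuous fun t ↦ sInf ((fun u ↦ η (t * u)) '' Set.Icc (0 : ℝ) 1) :=
    isCompact_Icc.continuous_sInf (f := fun t u ↦ η (t * u)) (by
      change Continuous fun p : ℝ × ℝ ↦ η (p.1 * p.2)
      fun_prop)
  exact h.continuousOn.congr fun t ht ↦ by rw [image_Icc_eq η ht]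

theorem continuousOn_pathState (hη : Continuous η) {x : ℝ → ℝ}
    (hx : ContinuousOn x (Set.Icc 0 T)) :
    ContinuousOn (fun t ↦ pathState η t (x t)) (Set.Icc 0 T) := by
  have hsub : Set.Icc 0 T ⊆ Set.Ici 0 := fun t ht ↦ ht.1
  have hI : Continuous fun t ↦ ∫ u in (0 : ℝ)..t, η u :=
    intervalIntegral.continuous_primitive (fun a b ↦ hη.intervalIntegrable a b) 0
  exact continuousOn_id.prodMk (((continuousOn_sSup_image hη).mono hsub).prodMk
    (((continuousOn_sInf_image hη).mono hsub).prodMk (hI.continuousOn.prodMk hx)))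

theorem nonempty_image_Icc (η : ℝ → ℝ) (ht : 0 ≤ t) :
    ((fun u ↦ η u) '' Set.Icc 0 t).Nonempty := (Set.nonempty_Icc.2 ht).image _

theorem bddAbove_image_Icc (hη : Continuous η) (t : ℝ) :
    BddAbove ((fun u ↦ η u) '' Set.Icc 0 t) := (isCompact_Icc.image hη).bddAbove

theorem bddBelow_image_Icc (hη : Continuous η) (t : ℝ) :
    BddBelow ((fun u ↦ η u) '' Set.Icc 0 t) := (isCompact_Icc.image hη).bddBelow

theorem sSup_image_mono (hη : Continuous η) (hs : 0 ≤ s) (hst : s ≤ t) :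
    sSup ((fun u ↦ η u) '' Set.Icc 0 s) ≤ sSup ((fun u ↦ η u) '' Set.Icc 0 t) :=
  csSup_le_csSup (bddAbove_image_Icc hη t) (nonempty_image_Icc η hs)
    (Set.image_mono (Set.Icc_subset_Icc_right hst))

theorem sInf_image_anti (hη : Continuous η) (hs : 0 ≤ s) (hst : s ≤ t) :
    sInf ((fun u ↦ η u) '' Set.Icc 0 t) ≤ sInf ((fun u ↦ η u) '' Set.Icc 0 s) :=
  csInf_le_csInf (bddBelow_image_Icc hη t) (nonempty_image_Icc η hs)
    (Set.image_mono (Set.Icc_subset_Icc_right hst))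

theorem sSup_image_mem (hη : Continuous η) (ht : 0 ≤ t)
    (hR : ∀ u ∈ Set.Icc 0 t, η u ∈ Set.Icc r R) :
    sSup ((fun u ↦ η u) '' Set.Icc 0 t) ∈ Set.Icc r R := by
  have h0 : (0 : ℝ) ∈ Set.Icc 0 t := ⟨le_rfl, ht⟩
  refine ⟨(hR 0 h0).1.trans (le_csSup (bddAbove_image_Icc hη t) ⟨0, h0, rfl⟩), ?_⟩
  refine csSup_le (nonempty_image_Icc η ht) ?_
  rintro _ ⟨u, hu, rfl⟩
  exact (hR u hu).2

theorem sInf_image_mem (hη : Continuous η) (ht : 0 ≤ t)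
    (hR : ∀ u ∈ Set.Icc 0 t, η u ∈ Set.Icc r R) :
    sInf ((fun u ↦ η u) '' Set.Icc 0 t) ∈ Set.Icc r R := by
  have h0 : (0 : ℝ) ∈ Set.Icc 0 t := ⟨le_rfl, ht⟩
  refine ⟨?_, (csInf_le (bddBelow_image_Icc hη t) ⟨0, h0, rfl⟩).trans (hR 0 h0).2⟩
  refine le_csInf (nonempty_image_Icc η ht) ?_
  rintro _ ⟨u, hu, rfl⟩
  exact (hR u hu).1

theorem integral_mono_of_nonneg (hη : Continuous η) (hst : s ≤ t)
    (h0 : ∀ u ∈ Set.Icc s t, 0 ≤ η u) :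
    ∫ u in (0 : ℝ)..s, η u ≤ ∫ u in (0 : ℝ)..t, η u := by
  have h1 := intervalIntegral.integral_add_adjacent_intervals
    (hη.intervalIntegrable (μ := volume) 0 s)
    (hη.intervalIntegrable s t)
  have h2 := intervalIntegral.integral_nonneg hst h0 (μ := volume)
  linarith

theorem integral_mem (hη : Continuous η) (hr : 0 ≤ r) (ht : t ∈ Set.Icc 0 T)
    (hR : ∀ u ∈ Set.Icc 0 t, η u ∈ Set.Icc r R) :
    ∫ u in (0 : ℝ)..t, η u ∈ Set.Icc 0 (R * T) := by
  have hR0 : 0 ≤ R := (hr.trans (hR 0 ⟨le_rfl, ht.1⟩).1).trans (hR 0 ⟨le_rfl, ht.1⟩).2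
  refine ⟨intervalIntegral.integral_nonneg ht.1 fun u hu ↦ hr.trans (hR u hu).1, ?_⟩
  have h := intervalIntegral.integral_mono_on ht.1 (hη.intervalIntegrable (μ := volume) 0 t)
    (intervalIntegrable_const (c := R)) (fun u hu ↦ (hR u hu).2)
  rw [intervalIntegral.integral_const, smul_eq_mul, sub_zero] at h
  calc _ ≤ t * R := h
    _ ≤ T * R := by have := ht.2; gcongr
    _ = R * T := mul_comm _ _

theorem pathState_mem_stateBox (hη : Continuous η) (hr : 0 ≤ r) (ht : t ∈ Set.Icc 0 T)
    (hR : ∀ u ∈ Set.Icc 0 t, η u ∈ Set.Icc r R) {x : ℝ} (hx : x ∈ Set.Icc r R) :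
    pathState η t x ∈ stateBox T r R :=
  ⟨ht, sSup_image_mem hη ht.1 hR, sInf_image_mem hη ht.1 hR, integral_mem hη hr ht hR, hx⟩

theorem abs_sSup_image_sub_le (hη : Continuous η) (hη' : Continuous η') {δ : ℝ} (ht : 0 ≤ t)
    (h : ∀ s, |η s - η' s| ≤ δ) :
    |sSup ((fun u ↦ η u) '' Set.Icc 0 t) - sSup ((fun u ↦ η' u) '' Set.Icc 0 t)| ≤ δ := by
  have aux : ∀ f g : ℝ → ℝ, Continuous f → Continuous g → (∀ s, |f s - g s| ≤ δ) →
      sSup ((fun u ↦ f u) '' Set.Icc 0 t) ≤ sSup ((fun u ↦ g u) '' Set.Icc 0 t) + δ := by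
    intro f g hf hg hfg
    refine csSup_le (nonempty_image_Icc f ht) ?_
    rintro _ ⟨u, hu, rfl⟩
    have h1 := le_csSup (bddAbove_image_Icc hg t) (Set.mem_image_of_mem (fun u ↦ g u) hu)
    have h2 := abs_le.1 (hfg u)
    simp only at h1 ⊢
    linarith
  have h1 := aux η η' hη hη' h
  have h2 := aux η' η hη' hη fun s ↦ by rw [abs_sub_comm]; exact h s
  rw [abs_le]; constructor <;> linarith

theorem abs_sInf_image_sub_le (hη : Continuous η) (hη' : Continuous η') {δ : ℝ} (ht : 0 ≤ t)
    (h : ∀ s, |η s - η' s| ≤ δ) :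
    |sInf ((fun u ↦ η u) '' Set.Icc 0 t) - sInf ((fun u ↦ η' u) '' Set.Icc 0 t)| ≤ δ := by
  have aux : ∀ f g : ℝ → ℝ, Continuous f → Continuous g → (∀ s, |f s - g s| ≤ δ) →
      sInf ((fun u ↦ f u) '' Set.Icc 0 t) - δ ≤ sInf ((fun u ↦ g u) '' Set.Icc 0 t) := by
    intro f g hf hg hfg
    refine le_csInf (nonempty_image_Icc g ht) ?_
    rintro _ ⟨u, hu, rfl⟩
    have h1 := csInf_le (bddBelow_image_Icc hf t) (Set.mem_image_of_mem (fun u ↦ f u) hu)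
    have h2 := abs_le.1 (hfg u)
    simp only at h1 ⊢
    linarith
  have h1 := aux η η' hη hη' h
  have h2 := aux η' η hη' hη fun s ↦ by rw [abs_sub_comm]; exact h s
  rw [abs_le]; constructor <;> linarith

theorem dist_pathState_le (hη : Continuous η) (hη' : Continuous η') {δ : ℝ}
    (ht : t ∈ Set.Icc 0 T) (h : ∀ s, |η s - η' s| ≤ δ) {x x' : ℝ} (hx : |x - x'| ≤ δ) :
    dist (pathState η t x) (pathState η' t x') ≤ (1 + T) * δ := by
  have hδ : 0 ≤ δ := (abs_nonneg _).trans hx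
  have hTδ : 0 ≤ T * δ := mul_nonneg (ht.1.trans ht.2) hδ
  have hI : |(∫ u in (0 : ℝ)..t, η u) - ∫ u in (0 : ℝ)..t, η' u| ≤ T * δ := by
    rw [← intervalIntegral.integral_sub (hη.intervalIntegrable _ _) (hη'.intervalIntegrable _ _)]
    have := intervalIntegral.norm_integral_le_of_norm_le_const (a := 0) (b := t) (C := δ)
      (f := fun s ↦ η s - η' s) (fun x _ ↦ h x)
    rw [Real.norm_eq_abs, sub_zero, abs_of_nonneg ht.1] at this
    refine this.trans ?_
    rw [mul_comm]
    exact mul_le_mul_of_nonneg_right ht.2 hδ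
  have h1 := abs_sSup_image_sub_le hη hη' ht.1 h
  have h2 := abs_sInf_image_sub_le hη hη' ht.1 h
  simp only [pathState, Prod.dist_eq, Real.dist_eq, sub_self, abs_zero]
  refine max_le (by linarith) (max_le (by linarith) (max_le (by linarith) (max_le ?_ ?_))) <;>
    linarith

/-- The sum of time and of the variations of the running maximum, minimum and integral. -/
def stateVariation (η : ℝ → ℝ) (t : ℝ) : ℝ :=
  t + sSup ((fun u ↦ η u) '' Set.Icc 0 t) - sInf ((fun u ↦ η u) '' Set.Icc 0 t) +
    ∫ u in (0 : ℝ)..t, η u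

/-- Time, maximum and integral increase and the minimum decreases, so one increasing function
dominates the motion of all these coordinates. Summed over a partition, the bound telescopes and
does not depend on the mesh. -/
theorem dist_pathState_le_stateVariation (hη : Continuous η) (hs : 0 ≤ s) (hst : s ≤ t)
    (h0 : ∀ u ∈ Set.Icc s t, 0 ≤ η u) (x : ℝ) :
    dist (pathState η t x) (pathState η s x) ≤ stateVariation η t - stateVariation η s := by
  have h1 := sSup_image_mono hη hs hst
  have h2 := sInf_image_anti hη hs hst
  have h3 := integral_mono_of_nonneg hη hst h0
  simp only [pathState, Prod.dist_eq, Real.dist_eq, sub_self, abs_zero, stateVariation]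
  rw [abs_of_nonneg (sub_nonneg.2 hst), abs_of_nonneg (sub_nonneg.2 h1),
    abs_of_nonpos (sub_nonpos.2 h2), abs_of_nonneg (sub_nonneg.2 h3)]
  refine max_le (by linarith) (max_le (by linarith) (max_le (by linarith) (max_le ?_ ?_))) <;>
    linarith

theorem stateVariation_sub_le (hη : Continuous η) (hr : 0 ≤ r) (hT : 0 ≤ T)
    (hR : ∀ u, η u ∈ Set.Icc r R) :
    stateVariation η T - stateVariation η 0 ≤ T + 2 * R + R * T := by
  have a1 := sSup_image_mem hη hT (fun u _ ↦ hR u)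
  have a2 := sSup_image_mem hη le_rfl (fun u _ ↦ hR u)
  have a3 := sInf_image_mem hη hT (fun u _ ↦ hR u)
  have a4 := sInf_image_mem hη le_rfl (fun u _ ↦ hR u)
  have a5 := integral_mem hη hr (Set.right_mem_Icc.2 hT) (fun u _ ↦ hR u)
  simp only [stateVariation, intervalIntegral.integral_same]
  linarith [a1.2, a2.1, a3.1, a4.2, a5.2]

end Paths

/-! ### Pathwise integrals of smooth functionals and their continuity in the path -/

/-- A second order Taylor estimate for the integral of a differentiable function. -/
theorem abs_integral_sub_taylor_le {f f' : ℝ → ℝ} {a b ω : ℝ}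
    (hf : ∀ y ∈ Set.uIcc a b, HasDerivAt f (f' y) y)
    (hω : ∀ y ∈ Set.uIcc a b, |f' y - f' a| ≤ ω) :
    |(∫ y in a..b, f y) - f a * (b - a) - f' a / 2 * (b - a) ^ 2| ≤ ω * (b - a) ^ 2 := by
  have hcont : ContinuousOn f (Set.uIcc a b) := fun y hy ↦
    (hf y hy).continuousAt.continuousWithinAt
  have hω0 : 0 ≤ ω := (abs_nonneg _).trans (hω a Set.left_mem_uIcc)
  have h1 : ∀ y ∈ Set.uIcc a b, |f y - f a - f' a * (y - a)| ≤ ω * |b - a| := by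
    intro y hy
    have := (convex_uIcc a b).norm_image_sub_le_of_norm_hasDerivWithin_le
      (f := fun y ↦ f y - f' a * y) (f' := fun y ↦ f' y - f' a) (C := ω)
      (fun x hx ↦ ((hf x hx).sub
        (by simpa using (hasDerivAt_id x).const_mul (f' a))).hasDerivWithinAt)
      hω Set.left_mem_uIcc hy
    rw [Real.norm_eq_abs, Real.norm_eq_abs] at this
    have e : f y - f' a * y - (f a - f' a * a) = f y - f a - f' a * (y - a) := by ring
    rw [e] at this
    exact this.trans (mul_le_mul_of_nonneg_left (Set.abs_sub_left_of_mem_uIcc hy) hω0)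
  have h2 : (∫ y in a..b, f y) - f a * (b - a) - f' a / 2 * (b - a) ^ 2 =
      ∫ y in a..b, (f y - f a - f' a * (y - a)) := by
    rw [intervalIntegral.integral_sub (hcont.intervalIntegrable.sub (by simp))
      (Continuous.intervalIntegrable (by fun_prop) _ _),
      intervalIntegral.integral_sub hcont.intervalIntegrable (by simp),
      intervalIntegral.integral_const_mul, intervalIntegral.integral_sub (by simp) (by simp)]
    simp
    ring
  rw [h2]
  have h3 := intervalIntegral.norm_integral_le_of_norm_le_const (a := a) (b := b)
    (C := ω * |b - a|) (f := fun y ↦ f y - f a - f' a * (y - a))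
    (fun x hx ↦ h1 x (Set.uIoc_subset_uIcc hx))
  rw [Real.norm_eq_abs, mul_assoc, ← sq, sq_abs] at h3
  exact h3

/-- First order expansion of the integral of a Lipschitz function along a `C¹` path. -/
theorem eventually_abs_integral_path_sub_le {T r R L C : ℝ} (hT : 0 < T) {F : ℝ → ℝ → ℝ}
    (hL0 : 0 ≤ L)
    (hFc : ∀ s ∈ Set.Icc 0 T, ContinuousOn (F s) (Set.Icc r R))
    (hL : ∀ s ∈ Set.Icc 0 T, ∀ x ∈ Set.Icc r R, ∀ y ∈ Set.Icc r R, |F s x - F s y| ≤ L * |x - y|)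
    (hC : ∀ s ∈ Set.Icc 0 T, ∀ x ∈ Set.Icc r R, |F s x| ≤ C)
    {ζ ζ' : ℝ → ℝ} (hζ : ∀ s, HasDerivAt ζ (ζ' s) s) (hζ' : Continuous ζ')
    (hζR : ∀ s ∈ Set.Icc 0 T, ζ s ∈ Set.Icc r R) {ε : ℝ} (hε : 0 < ε) :
    ∀ᶠ n : ℕ in atTop, ∀ i : ℕ, i < 2 ^ n →
      |(∫ y in (ζ (T * i / 2 ^ n))..(ζ (T * (i + 1) / 2 ^ n)), F (T * i / 2 ^ n) y) -
        F (T * i / 2 ^ n) (ζ (T * i / 2 ^ n)) * ζ' (T * i / 2 ^ n) * (T / 2 ^ n)| ≤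
      ε * (T / 2 ^ n) := by
  have h00 : (0 : ℝ) ∈ Set.Icc 0 T := ⟨le_rfl, hT.le⟩
  have hC0 : 0 ≤ C := (abs_nonneg _).trans (hC 0 h00 _ (hζR 0 h00))
  obtain ⟨Z, hZ⟩ := isCompact_Icc.exists_bound_of_continuousOn (hζ'.continuousOn (s := Set.Icc 0 T))
  have hZ0 : 0 ≤ Z := (norm_nonneg _).trans (hZ 0 h00)
  have hε1 : 0 < ε / (2 * (C + 1)) := by positivity
  have hlim : Tendsto (fun n : ℕ ↦ L * Z ^ 2 * (T / 2 ^ n)) atTop (𝓝 0) := by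
    simpa using (tendsto_mesh T).const_mul (L * Z ^ 2)
  filter_upwards [eventually_abs_sub_le_of_continuousOn (hζ'.continuousOn (s := Set.Icc 0 T)) hε1,
    hlim.eventually_lt_const (half_pos hε)] with n h1 h2 i hi
  set a := T * (i : ℝ) / 2 ^ n with ha
  set b := T * ((i : ℝ) + 1) / 2 ^ n with hb
  have hba : b - a = T / 2 ^ n := dyadic_succ_sub T n i
  have hpos : 0 < T / 2 ^ n := by positivity
  have haI : a ∈ Set.Icc 0 T := dyadic_mem_Icc hT hi.le
  have hbI : b ∈ Set.Icc 0 T := dyadic_succ_mem_Icc hT hi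
  have hab : a ≤ b := by linarith
  have hsub : Set.Icc a b ⊆ Set.Icc 0 T := Set.Icc_subset_Icc haI.1 hbI.2
  have hd1 : |ζ b - ζ a| ≤ Z * (T / 2 ^ n) := by
    have := (convex_Icc a b).norm_image_sub_le_of_norm_hasDerivWithin_le (f := ζ) (f' := ζ')
      (C := Z) (fun x _ ↦ (hζ x).hasDerivWithinAt) (fun x hx ↦ hZ x (hsub hx))
      (Set.left_mem_Icc.2 hab) (Set.right_mem_Icc.2 hab)
    rwa [Real.norm_eq_abs, Real.norm_eq_abs, hba, abs_of_pos hpos] at this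
  have hd2 : |ζ b - ζ a - ζ' a * (T / 2 ^ n)| ≤ ε / (2 * (C + 1)) * (T / 2 ^ n) := by
    have := (convex_Icc a b).norm_image_sub_le_of_norm_hasDerivWithin_le
      (f := fun s ↦ ζ s - ζ' a * s) (f' := fun s ↦ ζ' s - ζ' a)
      (C := ε / (2 * (C + 1)))
      (fun x _ ↦ ((hζ x).sub (by simpa using (hasDerivAt_id x).const_mul (ζ' a))).hasDerivWithinAt)
      (fun x hx ↦ h1 x (hsub hx) a haI (by
        rw [abs_of_nonneg (by linarith [hx.1])]; linarith [hx.2]))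
      (Set.left_mem_Icc.2 hab) (Set.right_mem_Icc.2 hab)
    rw [Real.norm_eq_abs, Real.norm_eq_abs, hba, abs_of_pos hpos] at this
    have e : ζ b - ζ' a * b - (ζ a - ζ' a * a) = ζ b - ζ a - ζ' a * (T / 2 ^ n) := by
      rw [← hba]; ring
    rwa [e] at this
  have hu : Set.uIcc (ζ a) (ζ b) ⊆ Set.Icc r R :=
    Set.uIcc_subset_Icc (hζR a haI) (hζR b hbI)
  have hi3 : |(∫ y in (ζ a)..(ζ b), F a y) - F a (ζ a) * (ζ b - ζ a)| ≤
      L * (Z * (T / 2 ^ n)) ^ 2 := by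
    have e : (∫ y in (ζ a)..(ζ b), F a y) - F a (ζ a) * (ζ b - ζ a) =
        ∫ y in (ζ a)..(ζ b), (F a y - F a (ζ a)) := by
      rw [intervalIntegral.integral_sub ((hFc a haI).mono hu).intervalIntegrable (by simp),
        intervalIntegral.integral_const, smul_eq_mul, mul_comm]
    rw [e]
    have := intervalIntegral.norm_integral_le_of_norm_le_const (a := ζ a) (b := ζ b)
      (C := L * (Z * (T / 2 ^ n))) (f := fun y ↦ F a y - F a (ζ a)) (fun x hx ↦ by
        have hx' := Set.uIoc_subset_uIcc hx
        refine (hL a haI x (hu hx') _ (hζR a haI)).trans ?_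
        exact mul_le_mul_of_nonneg_left ((Set.abs_sub_left_of_mem_uIcc hx').trans hd1) hL0)
    rw [Real.norm_eq_abs] at this
    refine this.trans ?_
    calc _ ≤ L * (Z * (T / 2 ^ n)) * (Z * (T / 2 ^ n)) := by gcongr
      _ = _ := by ring
  have hi4 : |F a (ζ a) * (ζ b - ζ a - ζ' a * (T / 2 ^ n))| ≤
      C * (ε / (2 * (C + 1)) * (T / 2 ^ n)) := by
    rw [abs_mul]
    exact mul_le_mul (hC a haI _ (hζR a haI)) hd2 (abs_nonneg _) hC0
  have e : (∫ y in (ζ a)..(ζ b), F a y) - F a (ζ a) * ζ' a * (T / 2 ^ n) =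
      ((∫ y in (ζ a)..(ζ b), F a y) - F a (ζ a) * (ζ b - ζ a)) +
      F a (ζ a) * (ζ b - ζ a - ζ' a * (T / 2 ^ n)) := by ring
  rw [e]
  refine (abs_add_le _ _).trans ((add_le_add hi3 hi4).trans ?_)
  have h5 : L * (Z * (T / 2 ^ n)) ^ 2 ≤ ε / 2 * (T / 2 ^ n) := by
    calc L * (Z * (T / 2 ^ n)) ^ 2 = L * Z ^ 2 * (T / 2 ^ n) * (T / 2 ^ n) := by ring
      _ ≤ _ := by gcongr
  have h6 : C * (ε / (2 * (C + 1)) * (T / 2 ^ n)) ≤ ε / 2 * (T / 2 ^ n) := by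
    rw [← mul_assoc]
    gcongr
    rw [mul_div_assoc', div_le_div_iff₀ (by positivity) two_pos]
    nlinarith
  linarith

/-- The dyadic sums of a smooth functional of the path `η` are approximated by an ordinary
integral that involves a `C¹` path `ζ` close to `η`. -/
theorem exists_eventually_abs_pathSum_functional_sub_le {T σ : ℝ} (hT : 0 < T)
    {φ ψ : ℝ × ℝ × ℝ × ℝ × ℝ → ℝ} (hφ : ContDiffOn ℝ 1 φ (stateDomain T))
    (hψ : ContinuousOn ψ (stateDomain T))
    (hφψ : ∀ t M m I x, (t, M, m, I, x) ∈ stateDomain T →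
        HasDerivAt (fun y ↦ φ (t, M, m, I, y)) (ψ (t, M, m, I, x)) x)
    {r R : ℝ} (hr : 0 < r) :
    ∃ C, 0 ≤ C ∧ ∀ η : ℝ → ℝ, Continuous η → (∀ s, η s ∈ Set.Icc r R) →
      HasLogQuadraticVariation T σ η → ∀ ζ ζ' : ℝ → ℝ, (∀ s, HasDerivAt ζ (ζ' s) s) →
      Continuous ζ' → (∀ s ∈ Set.Icc 0 T, ζ s ∈ Set.Icc r R) → ∀ ε > 0,
      (∀ s ∈ Set.Icc 0 T, |η s - ζ s| ≤ ε) → ∀ t ∈ Set.Icc 0 T, ∀ᶠ n : ℕ in atTop,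
      |pathSum T (fun s ↦ φ (pathState η s (η s))) η n t -
        ((∫ s in (0 : ℝ)..t, φ (pathState η s (ζ s)) * ζ' s) -
          σ ^ 2 / 2 * ∫ s in (0 : ℝ)..t, ψ (pathState η s (η s)) * η s ^ 2)| ≤ C * ε := by
  have hsub := stateBox_subset_stateDomain (T := T) (R := R) hr
  obtain ⟨L, hL0, hL⟩ := exists_lipschitz_stateBox hT hφ (R := R) hr
  obtain ⟨C₀, hC₀⟩ := (isCompact_stateBox T r R).exists_bound_of_continuousOn
    (hφ.continuousOn.mono hsub)
  set V := T + 2 * R + R * T with hV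
  -- `2 |C₀|` comes from the two boundary values of the potential `U` below, `L |V|` from the total
  -- motion of the state, and `1` from the expansion errors.
  refine ⟨2 * |C₀| + L * |V| + 1, by positivity, ?_⟩
  intro η hη hηR hqv ζ ζ' hζ hζ' hζR ε hε hηζ t ht
  have hζc : Continuous ζ := continuous_iff_continuousAt.2 fun s ↦ (hζ s).continuousAt
  have hηpos : ∀ s, 0 < η s := fun s ↦ hr.trans_le (hηR s).1
  have hbox : ∀ s ∈ Set.Icc 0 T, ∀ x ∈ Set.Icc r R, pathState η s x ∈ stateBox T r R :=
    fun s hs x hx ↦ pathState_mem_stateBox hη hr.le hs (fun u _ ↦ hηR u) hx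
  have hder : ∀ s ∈ Set.Icc 0 T, ∀ x ∈ Set.Icc r R,
      HasDerivAt (fun y ↦ φ (pathState η s y)) (ψ (pathState η s x)) x :=
    fun s hs x hx ↦ hφψ _ _ _ _ _ (hsub (hbox s hs x hx))
  have hcy : ∀ s ∈ Set.Icc 0 T, ContinuousOn (fun y ↦ φ (pathState η s y)) (Set.Icc r R) :=
    fun s hs x hx ↦ (hder s hs x hx).continuousAt.continuousWithinAt
  have hII : ∀ s ∈ Set.Icc 0 T, ∀ x ∈ Set.Icc r R, ∀ y ∈ Set.Icc r R,
      IntervalIntegrable (fun y ↦ φ (pathState η s y)) volume x y := fun s hs x hx y hy ↦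
    ((hcy s hs).mono (Set.uIcc_subset_Icc hx hy)).intervalIntegrable
  have hstη := continuousOn_pathState (T := T) hη hη.continuousOn
  have hstζ := continuousOn_pathState (T := T) hη hζc.continuousOn
  have hk₁ : ContinuousOn (fun s ↦ φ (pathState η s (ζ s)) * ζ' s) (Set.Icc 0 T) :=
    ((hφ.continuousOn.mono hsub).comp hstζ fun s hs ↦ hbox s hs _ (hζR s hs)).mul
      hζ'.continuousOn
  have hk₂ : ContinuousOn (fun s ↦ -(1 / 2) * ψ (pathState η s (η s))) (Set.Icc 0 T) :=
    continuousOn_const.mul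
      ((hψ.mono hsub).comp hstη fun s hs ↦ hbox s hs _ (hηR s))
  -- Integrating in the price from `ζ`, not from a fixed level, makes `U` itself of order `ε`. It
  -- also confines the effect of the moving state to a range of width `ε`, so the finite variation
  -- terms add up to `O(ε)` and need not be computed.
  set U : ℝ → ℝ := fun s ↦ ∫ y in (ζ s)..(η s), φ (pathState η s y) with hU
  have hUb : ∀ s ∈ Set.Icc 0 T, |U s| ≤ |C₀| * ε := by
    intro s hs
    have := intervalIntegral.norm_integral_le_of_norm_le_const (a := ζ s) (b := η s)
      (C := |C₀|) (f := fun y ↦ φ (pathState η s y)) (fun x hx ↦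
        (hC₀ _ (hbox s hs x (Set.uIcc_subset_Icc (hζR s hs) (hηR s)
          (Set.uIoc_subset_uIcc hx)))).trans (le_abs_self _))
    exact this.trans (mul_le_mul_of_nonneg_left (hηζ s hs) (abs_nonneg _))
  set e : ℕ → ℕ → ℝ := fun n i ↦ ε * L *
    (stateVariation η (T * (i + 1) / 2 ^ n) - stateVariation η (T * i / 2 ^ n)) with he
  have hgrid : ∀ n i : ℕ, T * (i : ℝ) / 2 ^ n ≤ T * ((i : ℝ) + 1) / 2 ^ n := fun n i ↦ by
    gcongr; linarith
  have hvar : ∀ n i : ℕ, i < 2 ^ n → ∀ x,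
      dist (pathState η (T * (i + 1) / 2 ^ n) x) (pathState η (T * i / 2 ^ n) x) ≤
      stateVariation η (T * (i + 1) / 2 ^ n) - stateVariation η (T * i / 2 ^ n) :=
    fun n i hi x ↦ dist_pathState_le_stateVariation hη (dyadic_mem_Icc hT hi.le).1 (hgrid n i)
      (fun u _ ↦ (hηpos u).le) x
  have he0 : ∀ n, ∀ i : ℕ, i < 2 ^ n → 0 ≤ e n i := fun n i hi ↦
    mul_nonneg (by positivity) (dist_nonneg.trans (hvar n i hi 0))
  have hE : ∀ n, ∑ i ∈ Finset.range (2 ^ n), e n i ≤ ε * L * |V| := by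
    intro n
    rw [he, ← Finset.mul_sum]
    have h1 := Finset.sum_range_sub (fun i : ℕ ↦ stateVariation η (T * i / 2 ^ n)) (2 ^ n)
    push_cast at h1
    rw [h1, mul_div_cancel_right₀ _ (by positivity), mul_zero, zero_div]
    refine mul_le_mul_of_nonneg_left ?_ (by positivity)
    exact (stateVariation_sub_le hη hr.le hT.le hηR).trans (le_abs_self _)
  set Q := T + σ ^ 2 * (∫ u in (0 : ℝ)..T, η u ^ 2) + 2 with hQ
  have hQpos : 0 < Q := by
    have : 0 ≤ ∫ u in (0 : ℝ)..T, η u ^ 2 :=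
      intervalIntegral.integral_nonneg hT.le fun u _ ↦ sq_nonneg _
    positivity
  have hε1 : 0 < ε / Q := by positivity
  have huc := (isCompact_stateBox T r R).uniformContinuousOn_of_continuous (hψ.mono hsub)
  rw [Metric.uniformContinuousOn_iff] at huc
  obtain ⟨δ, hδ, hmod⟩ := huc (ε / Q) hε1
  have key : ∀ᶠ n : ℕ in atTop, ∀ i : ℕ, i < 2 ^ n →
      |φ (pathState η (T * i / 2 ^ n) (η (T * i / 2 ^ n))) *
          (η (T * (i + 1) / 2 ^ n) - η (T * i / 2 ^ n)) -
        (U (T * (i + 1) / 2 ^ n) - U (T * i / 2 ^ n)) -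
        (φ (pathState η (T * i / 2 ^ n) (ζ (T * i / 2 ^ n))) * ζ' (T * i / 2 ^ n)) * (T / 2 ^ n) -
        (-(1 / 2) * ψ (pathState η (T * i / 2 ^ n) (η (T * i / 2 ^ n)))) *
          (η (T * (i + 1) / 2 ^ n) - η (T * i / 2 ^ n)) ^ 2| ≤
      (ε / Q) * (T / 2 ^ n + (η (T * (i + 1) / 2 ^ n) - η (T * i / 2 ^ n)) ^ 2) + e n i := by
    filter_upwards [eventually_abs_increment_le hT hη.continuousOn (half_pos hδ),
      eventually_abs_integral_path_sub_le hT (F := fun s y ↦ φ (pathState η s y)) hL0 hcy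
        (fun s hs x hx y hy ↦ (hL _ (hbox s hs x hx) _ (hbox s hs y hy)).trans (by
          simp [pathState, Prod.dist_eq, Real.dist_eq]))
        (fun s hs x hx ↦ hC₀ _ (hbox s hs x hx)) hζ hζ' hζR hε1] with n h1 h2 i hi
    have hv := hvar n i hi
    have h1 := h1 i hi
    have h2 := h2 i hi
    have hei : e n i = ε * L *
      (stateVariation η (T * (i + 1) / 2 ^ n) - stateVariation η (T * i / 2 ^ n)) := rfl
    rw [hei]
    have haI : T * (i : ℝ) / 2 ^ n ∈ Set.Icc 0 T := dyadic_mem_Icc hT hi.le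
    have hbI : T * ((i : ℝ) + 1) / 2 ^ n ∈ Set.Icc 0 T := dyadic_succ_mem_Icc hT hi
    set a := T * (i : ℝ) / 2 ^ n with ha
    set b := T * ((i : ℝ) + 1) / 2 ^ n with hb
    have hUb : U b = ∫ y in (ζ b)..(η b), φ (pathState η b y) := rfl
    have hUa : U a = ∫ y in (ζ a)..(η a), φ (pathState η a y) := rfl
    have hA : |∫ y in (ζ b)..(η b), (φ (pathState η b y) - φ (pathState η a y))| ≤
        ε * L * (stateVariation η b - stateVariation η a) := by
      have := intervalIntegral.norm_integral_le_of_norm_le_const (a := ζ b) (b := η b)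
        (C := L * (stateVariation η b - stateVariation η a))
        (f := fun y ↦ φ (pathState η b y) - φ (pathState η a y)) (fun x hx ↦ by
          have hx' := Set.uIcc_subset_Icc (hζR b hbI) (hηR b) (Set.uIoc_subset_uIcc hx)
          exact (hL _ (hbox b hbI x hx') _ (hbox a haI x hx')).trans
            (mul_le_mul_of_nonneg_left (hv x) hL0))
      refine this.trans ?_
      calc _ ≤ L * (stateVariation η b - stateVariation η a) * ε :=
            mul_le_mul_of_nonneg_left (hηζ b hbI)
              (mul_nonneg hL0 (dist_nonneg.trans (hv 0)))
        _ = _ := by ring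
    have hB := abs_integral_sub_taylor_le (f := fun y ↦ φ (pathState η a y))
      (f' := fun y ↦ ψ (pathState η a y)) (a := η a) (b := η b) (ω := ε / Q)
      (fun y hy ↦ hder a haI y (Set.uIcc_subset_Icc (hηR a) (hηR b) hy))
      (fun y hy ↦ by
        refine (hmod _ (hbox a haI y (Set.uIcc_subset_Icc (hηR a) (hηR b) hy)) _
          (hbox a haI _ (hηR a)) ?_).le
        have h3 := (Set.abs_sub_left_of_mem_uIcc hy).trans h1
        simp only [pathState, Prod.dist_eq, dist_self, Real.dist_eq]
        simp only [abs_nonneg, sup_of_le_right]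
        linarith)
    -- Three causes of change. The motion of the state is an error. The motion of `η` yields the
    -- forward increment and the Itô correction. The motion of `ζ` yields the ordinary integral.
    have hsplit : U b - U a = (∫ y in (ζ b)..(η b), (φ (pathState η b y) - φ (pathState η a y))) +
        (∫ y in (η a)..(η b), φ (pathState η a y)) -
        ∫ y in (ζ a)..(ζ b), φ (pathState η a y) := by
      rw [hUb, hUa, intervalIntegral.integral_sub (hII b hbI _ (hζR b hbI) _ (hηR b))
        (hII a haI _ (hζR b hbI) _ (hηR b))]
      have e1 := intervalIntegral.integral_add_adjacent_intervals
        (hII a haI _ (hζR a haI) _ (hηR a)) (hII a haI _ (hηR a) _ (hηR b))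
      have e2 := intervalIntegral.integral_add_adjacent_intervals
        (hII a haI _ (hζR a haI) _ (hζR b hbI)) (hII a haI _ (hζR b hbI) _ (hηR b))
      linarith
    rw [hsplit]
    have a1 := abs_le.1 hA
    have a2 := abs_le.1 hB
    have a3 := abs_le.1 h2
    rw [abs_le]
    constructor <;> linarith
  filter_upwards [eventually_abs_pathSum_sub_le hT hη.continuousOn (fun s _ ↦ hηpos s) hqv
    (y := fun s ↦ φ (pathState η s (η s))) (U := U) hk₁ hk₂ hε1 he0 hE key ht]
    with n ⟨s, hs, _, hn⟩
  rw [← hQ, div_mul_cancel₀ _ hQpos.ne'] at hn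
  have hU1 := abs_le.1 (hUb s hs)
  have hU2 := abs_le.1 (hUb 0 ⟨le_rfl, hT.le⟩)
  have hn := abs_le.1 hn
  have hk : σ ^ 2 * ∫ u in (0 : ℝ)..t, -(1 / 2) * ψ (pathState η u (η u)) * η u ^ 2 =
      -(σ ^ 2 / 2 * ∫ s in (0 : ℝ)..t, ψ (pathState η s (η s)) * η s ^ 2) := by
    simp only [mul_assoc]
    rw [intervalIntegral.integral_const_mul]
    ring
  rw [hk] at hn
  rw [abs_le]
  have : (2 * |C₀| + L * |V| + 1) * ε = 2 * (|C₀| * ε) + ε * L * |V| + ε := by ring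
  rw [this]
  constructor <;> linarith

theorem exists_hasDerivAt_near {T : ℝ} {η : ℝ → ℝ} (hη : ContinuousOn η (Set.Icc 0 T)) {ε : ℝ}
    (hε : 0 < ε) : ∃ ζ ζ' : ℝ → ℝ, (∀ s, HasDerivAt ζ (ζ' s) s) ∧ Continuous ζ' ∧
      ∀ s ∈ Set.Icc 0 T, |η s - ζ s| ≤ ε := by
  obtain ⟨p, hp⟩ := exists_polynomial_near_of_continuousOn 0 T η hη ε hε
  exact ⟨fun s ↦ p.eval s, fun s ↦ p.derivative.eval s, fun s ↦ p.hasDerivAt s,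
    p.derivative.continuous, fun s hs ↦ by rw [abs_sub_comm]; exact (hp s hs).le⟩

/-- The dyadic sums of a smooth functional along a path with quadratic variation converge. -/
theorem exists_tendsto_pathSum_functional {T σ : ℝ} (hT : 0 < T)
    {φ : ℝ × ℝ × ℝ × ℝ × ℝ → ℝ} (hφ : ContDiffOn ℝ 1 φ (stateDomain T))
    {r R : ℝ} (hr : 0 < r) {η : ℝ → ℝ} (hη : Continuous η) (hηR : ∀ s, η s ∈ Set.Icc r R)
    (hqv : HasLogQuadraticVariation T σ η) {t : ℝ} (ht : t ∈ Set.Icc 0 T) :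
    ∃ v, Tendsto (fun n ↦ pathSum T (fun s ↦ φ (pathState η s (η s))) η n t) atTop (𝓝 v) := by
  obtain ⟨ψ, hψ, hφψ⟩ := exists_hasDerivAt_last hT hφ
  obtain ⟨C, hC0, hC⟩ := exists_eventually_abs_pathSum_functional_sub_le (σ := σ) hT hφ hψ hφψ
    (r := r / 2) (R := R + r) (half_pos hr)
  refine cauchySeq_tendsto_of_complete (Metric.cauchySeq_iff'.2 fun ε hε ↦ ?_)
  -- One fixed `ζ` gives the same target for all large `n`, so the late sums lie within `2 C ε₀ ≤ ε
  -- / 2` of each other. The bound `r / 2` keeps `ζ` inside the enlarged range `[r / 2, R + r]`.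
  set ε₀ := min (r / 2) (ε / (4 * (C + 1))) with hε₀
  have hε₀pos : 0 < ε₀ := by positivity
  obtain ⟨ζ, ζ', h1, h2, h3⟩ := exists_hasDerivAt_near (T := T) hη.continuousOn hε₀pos
  have hCε : C * ε₀ ≤ ε / 4 := by
    calc C * ε₀ ≤ (C + 1) * (ε / (4 * (C + 1))) := by
          gcongr
          · linarith
          · exact min_le_right _ _
      _ = ε / 4 := by field_simp
  have hev := hC η hη (fun s ↦ ⟨by linarith [(hηR s).1], by linarith [(hηR s).2]⟩) hqv ζ ζ' h1 h2
    (fun s hs ↦ by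
      have a1 := abs_le.1 ((h3 s hs).trans (min_le_left _ _))
      have a2 := hηR s
      constructor <;> linarith [a2.1, a2.2]) ε₀ hε₀pos h3 t ht
  obtain ⟨N, hN⟩ := eventually_atTop.1 hev
  refine ⟨N, fun n hn ↦ ?_⟩
  have a1 := abs_le.1 (hN n hn)
  have a2 := abs_le.1 (hN N le_rfl)
  rw [Real.dist_eq, abs_lt]
  constructor <;> linarith

theorem abs_integral_sub_integral_le {T t : ℝ} (ht : t ∈ Set.Icc 0 T) {f g : ℝ → ℝ}
    (hf : ContinuousOn f (Set.Icc 0 T)) (hg : ContinuousOn g (Set.Icc 0 T)) {ε : ℝ}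
    (h : ∀ s ∈ Set.Icc 0 T, |f s - g s| ≤ ε) :
    |(∫ s in (0 : ℝ)..t, f s) - ∫ s in (0 : ℝ)..t, g s| ≤ ε * T := by
  have hsub : Set.uIcc 0 t ⊆ Set.Icc 0 T := by
    rw [Set.uIcc_of_le ht.1]; exact Set.Icc_subset_Icc_right ht.2
  have hε : 0 ≤ ε := (abs_nonneg _).trans (h t ht)
  rw [← intervalIntegral.integral_sub (hf.mono hsub).intervalIntegrable
    (hg.mono hsub).intervalIntegrable]
  have := intervalIntegral.norm_integral_le_of_norm_le_const (a := 0) (b := t) (C := ε)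
    (f := fun s ↦ f s - g s) (fun x hx ↦ h x (hsub (Set.uIoc_subset_uIcc hx)))
  rw [Real.norm_eq_abs, sub_zero, abs_of_nonneg ht.1] at this
  exact this.trans (mul_le_mul_of_nonneg_left ht.2 hε)

/-- The forward integral of a smooth functional depends continuously on the path, among the paths
with a given quadratic variation. -/
theorem exists_abs_limit_sub_limit_le {T σ : ℝ} (hT : 0 < T)
    {φ : ℝ × ℝ × ℝ × ℝ × ℝ → ℝ} (hφ : ContDiffOn ℝ 1 φ (stateDomain T))
    {r R : ℝ} (hr : 0 < r) {η : ℝ → ℝ} (hη : Continuous η) (hηR : ∀ s, η s ∈ Set.Icc r R)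
    (hqv : HasLogQuadraticVariation T σ η) {ε : ℝ} (hε : 0 < ε) :
    ∃ δ > 0, ∀ η' : ℝ → ℝ, Continuous η' → (∀ s, |η s - η' s| ≤ δ) →
      HasLogQuadraticVariation T σ η' → ∀ t ∈ Set.Icc 0 T, ∀ v v',
      Tendsto (fun n ↦ pathSum T (fun s ↦ φ (pathState η s (η s))) η n t) atTop (𝓝 v) →
      Tendsto (fun n ↦ pathSum T (fun s ↦ φ (pathState η' s (η' s))) η' n t) atTop (𝓝 v') →
      |v - v'| ≤ ε := by
  obtain ⟨ψ, hψ, hφψ⟩ := exists_hasDerivAt_last hT hφ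
  have hr2 := half_pos hr
  obtain ⟨C, hC0, hC⟩ := exists_eventually_abs_pathSum_functional_sub_le (σ := σ) hT hφ hψ hφψ
    (r := r / 2) (R := R + r) hr2
  have hsub := stateBox_subset_stateDomain (T := T) (R := R + r) hr2
  set ε₀ := min (r / 4) (ε / (8 * (C + 1))) with hε₀
  have hε₀pos : 0 < ε₀ := by positivity
  have hCε : C * (2 * ε₀) ≤ ε / 4 := by
    calc C * (2 * ε₀) ≤ (C + 1) * (2 * (ε / (8 * (C + 1)))) := by
          gcongr
          · linarith
          · exact min_le_right _ _
      _ = ε / 4 := by field_simp; norm_num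
  obtain ⟨ζ, ζ', h1, h2, h3⟩ := exists_hasDerivAt_near (T := T) hη.continuousOn hε₀pos
  have hζc : Continuous ζ := continuous_iff_continuousAt.2 fun s ↦ (h1 s).continuousAt
  obtain ⟨Z, hZ⟩ := isCompact_Icc.exists_bound_of_continuousOn (h2.continuousOn (s := Set.Icc 0 T))
  have hZ0 : 0 ≤ Z := (norm_nonneg _).trans (hZ 0 ⟨le_rfl, hT.le⟩)
  have hg : ContinuousOn (fun p : ℝ × ℝ × ℝ × ℝ × ℝ ↦ ψ p * p.2.2.2.2 ^ 2)
      (stateBox T (r / 2) (R + r)) := (hψ.mono hsub).mul (by fun_prop)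
  have huc1 := (isCompact_stateBox T (r / 2) (R + r)).uniformContinuousOn_of_continuous
    (hφ.continuousOn.mono hsub)
  have huc2 := (isCompact_stateBox T (r / 2) (R + r)).uniformContinuousOn_of_continuous hg
  rw [Metric.uniformContinuousOn_iff] at huc1 huc2
  set ε₁ := ε / (8 * (Z + 1) * T) with hε₁
  set ε₂ := ε / (8 * (σ ^ 2 / 2 + 1) * T) with hε₂
  have hε₁pos : 0 < ε₁ := by positivity
  have hε₂pos : 0 < ε₂ := by positivity
  obtain ⟨δ₁, hδ₁, hm1⟩ := huc1 ε₁ hε₁pos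
  obtain ⟨δ₂, hδ₂, hm2⟩ := huc2 ε₂ hε₂pos
  set δ := min ε₀ (min δ₁ δ₂ / (2 * (1 + T))) with hδ
  have hδpos : 0 < δ := by positivity
  have hδlt : (1 + T) * δ < min δ₁ δ₂ := by
    calc (1 + T) * δ ≤ (1 + T) * (min δ₁ δ₂ / (2 * (1 + T))) := by
          gcongr; exact min_le_right _ _
      _ = min δ₁ δ₂ / 2 := by field_simp
      _ < _ := half_lt_self (by positivity)
  refine ⟨δ, hδpos, fun η' hη' hd hqv' t ht v v' hv hv' ↦ ?_⟩
  have hδr : δ ≤ r / 4 := (min_le_left _ _).trans (min_le_left _ _)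
  have hηB : ∀ s, η s ∈ Set.Icc (r / 2) (R + r) := fun s ↦
    ⟨by linarith [(hηR s).1], by linarith [(hηR s).2]⟩
  have hηB' : ∀ s, η' s ∈ Set.Icc (r / 2) (R + r) := fun s ↦ by
    have a1 := abs_le.1 ((hd s).trans hδr)
    have a2 := hηR s
    constructor <;> linarith [a2.1, a2.2]
  have hζB : ∀ s ∈ Set.Icc 0 T, ζ s ∈ Set.Icc (r / 2) (R + r) := fun s hs ↦ by
    have a1 := abs_le.1 ((h3 s hs).trans (min_le_left _ _))
    have a2 := hηR s
    constructor <;> linarith [a2.1, a2.2]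
  have hbox : ∀ s ∈ Set.Icc 0 T, ∀ x ∈ Set.Icc (r / 2) (R + r),
      pathState η s x ∈ stateBox T (r / 2) (R + r) :=
    fun s hs x hx ↦ pathState_mem_stateBox hη hr2.le hs (fun u _ ↦ hηB u) hx
  have hbox' : ∀ s ∈ Set.Icc 0 T, ∀ x ∈ Set.Icc (r / 2) (R + r),
      pathState η' s x ∈ stateBox T (r / 2) (R + r) :=
    fun s hs x hx ↦ pathState_mem_stateBox hη' hr2.le hs (fun u _ ↦ hηB' u) hx
  -- The same `ζ` serves both paths: it is `ε₀`-close to `η`, hence `2 ε₀`-close to `η'`. What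
  -- remains to compare are ordinary integrals, which depend continuously on the path.
  have e1 := hC η hη hηB hqv ζ ζ' h1 h2 hζB (2 * ε₀) (by positivity)
    (fun s hs ↦ by linarith [h3 s hs]) t ht
  have e2 := hC η' hη' hηB' hqv' ζ ζ' h1 h2 hζB (2 * ε₀) (by positivity)
    (fun s hs ↦ by
      have a1 := abs_le.1 (h3 s hs)
      have a2 := abs_le.1 ((hd s).trans (min_le_left _ _))
      rw [abs_le]; constructor <;> linarith) t ht
  have l1 := le_of_tendsto (hv.sub_const _).abs e1
  have l2 := le_of_tendsto (hv'.sub_const _).abs e2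
  have c1 : ContinuousOn (fun s ↦ φ (pathState η s (ζ s)) * ζ' s) (Set.Icc 0 T) :=
    ((hφ.continuousOn.mono hsub).comp (continuousOn_pathState hη hζc.continuousOn)
      fun s hs ↦ hbox s hs _ (hζB s hs)).mul h2.continuousOn
  have c1' : ContinuousOn (fun s ↦ φ (pathState η' s (ζ s)) * ζ' s) (Set.Icc 0 T) :=
    ((hφ.continuousOn.mono hsub).comp (continuousOn_pathState hη' hζc.continuousOn)
      fun s hs ↦ hbox' s hs _ (hζB s hs)).mul h2.continuousOn
  have c2 : ContinuousOn (fun s ↦ ψ (pathState η s (η s)) * η s ^ 2) (Set.Icc 0 T) :=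
    ((hψ.mono hsub).comp (continuousOn_pathState hη hη.continuousOn)
      fun s hs ↦ hbox s hs _ (hηB s)).mul (hη.pow 2).continuousOn
  have c2' : ContinuousOn (fun s ↦ ψ (pathState η' s (η' s)) * η' s ^ 2) (Set.Icc 0 T) :=
    ((hψ.mono hsub).comp (continuousOn_pathState hη' hη'.continuousOn)
      fun s hs ↦ hbox' s hs _ (hηB' s)).mul (hη'.pow 2).continuousOn
  have d1 := abs_integral_sub_integral_le ht c1 c1' (ε := ε₁ * Z) (fun s hs ↦ by
    rw [← sub_mul, abs_mul]
    refine mul_le_mul ?_ (hZ s hs) (abs_nonneg _) hε₁pos.le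
    refine (hm1 _ (hbox s hs _ (hζB s hs)) _ (hbox' s hs _ (hζB s hs)) ?_).le
    exact (dist_pathState_le hη hη' hs hd (by simpa using hδpos.le)).trans_lt
      (hδlt.trans_le (min_le_left _ _)))
  have d2 := abs_integral_sub_integral_le ht c2 c2' (ε := ε₂) (fun s hs ↦
    (hm2 _ (hbox s hs _ (hηB s)) _ (hbox' s hs _ (hηB' s))
      ((dist_pathState_le hη hη' hs hd (hd s)).trans_lt (hδlt.trans_le (min_le_right _ _)))).le)
  have d1' : ε₁ * Z * T ≤ ε / 8 := by
    calc ε₁ * Z * T ≤ ε₁ * (Z + 1) * T := by gcongr; linarith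
      _ = ε / 8 := by rw [hε₁]; field_simp
  have d2' : σ ^ 2 / 2 * (ε₂ * T) ≤ ε / 8 := by
    calc σ ^ 2 / 2 * (ε₂ * T) ≤ (σ ^ 2 / 2 + 1) * (ε₂ * T) := by gcongr; linarith
      _ = ε / 8 := by rw [hε₂]; field_simp
  have d3 : |σ ^ 2 / 2 * ((∫ s in (0 : ℝ)..t, ψ (pathState η s (η s)) * η s ^ 2) -
      ∫ s in (0 : ℝ)..t, ψ (pathState η' s (η' s)) * η' s ^ 2)| ≤ ε / 8 := by
    rw [abs_mul, abs_of_nonneg (by positivity)]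
    exact (mul_le_mul_of_nonneg_left d2 (by positivity)).trans d2'
  have a1 := abs_le.1 l1
  have a2 := abs_le.1 l2
  have a3 := abs_le.1 d1
  have a4 := abs_le.1 d3
  rw [mul_sub] at a4
  rw [abs_le]
  constructor <;> linarith

/-! ### The Black–Scholes price of a Dirac claim -/

/-- The logarithmic distance of `x` to the strike `K`, with the risk neutral drift. -/
def logDistance (T σ K t x : ℝ) : ℝ := Real.log (x / K) - σ ^ 2 * (T - t) / 2

/-- Up to a factor, the Black-Scholes price at time `t` of the claim that pays the Dirac mass of
the strike `K` at time `T`. -/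
def diracPrice (T σ K t x : ℝ) : ℝ :=
  (√(T - t))⁻¹ * Real.exp (-(logDistance T σ K t x ^ 2 * ((2 * σ ^ 2)⁻¹ * (T - t)⁻¹)))

/-- The derivative of `diracPrice` in the price. -/
def diracDelta (T σ K t x : ℝ) : ℝ :=
  -(logDistance T σ K t x * (σ ^ 2)⁻¹ * x⁻¹) * ((T - t)⁻¹ * diracPrice T σ K t x)

/-- The second derivative of `diracPrice` in the price. -/
def diracGamma (T σ K t x : ℝ) : ℝ :=
  (x⁻¹) ^ 2 * (((logDistance T σ K t x - 1) * (σ ^ 2)⁻¹) * ((T - t)⁻¹ ^ 1 * diracPrice T σ K t x) +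
    (logDistance T σ K t x * (σ ^ 2)⁻¹) ^ 2 * ((T - t)⁻¹ ^ 2 * diracPrice T σ K t x))

section Derivatives

variable {T σ K t x : ℝ}

theorem hasDerivAt_logDistance (hK : 0 < K) (hx : 0 < x) :
    HasDerivAt (fun x ↦ logDistance T σ K t x) x⁻¹ x := by
  have h1 : HasDerivAt (fun x ↦ Real.log (x / K)) ((1 / K) / (x / K)) x :=
    ((hasDerivAt_id x).div_const K).log (by positivity)
  have e : (1 / K) / (x / K) = x⁻¹ := by field_simp
  rw [e] at h1
  exact h1.sub_const _

theorem hasDerivAt_logDistance_time : HasDerivAt (fun t ↦ logDistance T σ K t x) (σ ^ 2 / 2) t := by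
  have h1 := ((((hasDerivAt_id t).const_sub T).const_mul (σ ^ 2)).div_const 2).const_sub
    (Real.log (x / K))
  convert! h1 using 1
  ring

theorem hasDerivAt_diracPrice (hσ : 0 < σ) (hK : 0 < K) (ht : t < T) (hx : 0 < x) :
    HasDerivAt (fun x ↦ diracPrice T σ K t x) (diracDelta T σ K t x) x := by
  have hτ : 0 < T - t := sub_pos.2 ht
  have h1 := ((((hasDerivAt_logDistance (T := T) (σ := σ) (t := t) hK hx).pow 2).mul_const
    ((2 * σ ^ 2)⁻¹ * (T - t)⁻¹)).neg.exp).const_mul (√(T - t))⁻¹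
  convert! h1 using 1
  rw [diracDelta, diracPrice]
  simp only [Nat.cast_ofNat, Pi.neg_apply, Pi.pow_apply]
  field_simp
  simp

theorem hasDerivAt_diracDelta (hσ : 0 < σ) (hK : 0 < K) (ht : t < T) (hx : 0 < x) :
    HasDerivAt (fun x ↦ diracDelta T σ K t x) (diracGamma T σ K t x) x := by
  have hτ : 0 < T - t := sub_pos.2 ht
  have h1 := ((((hasDerivAt_logDistance (T := T) (σ := σ) (t := t) hK hx).mul_const
    ((σ ^ 2)⁻¹)).mul (hasDerivAt_inv hx.ne')).neg).mul
    ((hasDerivAt_diracPrice hσ hK ht hx).const_mul (T - t)⁻¹)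
  convert! h1 using 1
  rw [diracGamma, diracDelta]
  simp only [Pi.neg_apply, Pi.mul_apply]
  field_simp
  ring

/-- This is the Black–Scholes equation with zero interest rate, satisfied because the function is a
multiple of the lognormal transition density in its backward variables. It cancels the drift in the
Itô formula, whatever `μ` and the fractional part are. -/
theorem hasDerivAt_diracPrice_time (hσ : 0 < σ) (ht : t < T) (hx : 0 < x) :
    HasDerivAt (fun t ↦ diracPrice T σ K t x)
      (-(σ ^ 2 / 2) * (x ^ 2 * diracGamma T σ K t x)) t := by
  have hτ : 0 < T - t := sub_pos.2 ht
  have hd : HasDerivAt (fun t ↦ T - t) (-1) t := (hasDerivAt_id t).const_sub T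
  have h1 := ((hd.sqrt hτ.ne').inv (Real.sqrt_pos.2 hτ).ne').mul
    ((((hasDerivAt_logDistance_time (T := T) (σ := σ) (K := K) (x := x) (t := t)).pow 2).mul
    ((hd.inv hτ.ne').const_mul ((2 * σ ^ 2)⁻¹))).neg.exp)
  convert! h1 using 1
  rw [diracGamma, diracPrice]
  simp only [Nat.cast_ofNat, Pi.neg_apply, Pi.pow_apply, Pi.mul_apply, Pi.inv_apply]
  have hs : √(T - t) ^ 2 = T - t := Real.sq_sqrt hτ.le
  have hs0 : 0 < √(T - t) := Real.sqrt_pos.2 hτ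
  rw [show (T - t)⁻¹ = (√(T - t) ^ 2)⁻¹ by rw [hs]]
  set s := √(T - t)
  set L := logDistance T σ K t x
  set E := Real.exp (-(L ^ 2 * ((2 * σ ^ 2)⁻¹ * (s ^ 2)⁻¹)))
  rw [← hs]
  field_simp
  ring

end Derivatives

/-- Points at which `diracPrice` and its derivatives are continuous from the left in time. -/
def diracDomain (T K : ℝ) : Set (ℝ × ℝ) := {p | 0 < p.2 ∧ p ≠ (T, K)}

theorem isOpen_diracDomain (T K : ℝ) : IsOpen (diracDomain T K) :=
  (isOpen_lt continuous_const continuous_snd).inter isOpen_ne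

theorem continuousOn_logDistance {T σ K : ℝ} (hK : 0 < K) :
    ContinuousOn (fun p : ℝ × ℝ ↦ logDistance T σ K p.1 p.2) {p | 0 < p.2} := by
  unfold logDistance
  refine ContinuousOn.sub (ContinuousOn.log (by fun_prop) fun p hp ↦ ?_) (by fun_prop)
  have : 0 < p.2 := hp
  positivity

/-- The exponential beats every power. The point `τ = 0` may be included since `0⁻¹ = 0` and the
exponent `k + 1` is positive. -/
theorem tendsto_inv_pow_mul_exp_neg_inv {β : ℝ} (hβ : 0 < β) (k : ℕ) :
    Tendsto (fun τ : ℝ ↦ τ⁻¹ ^ (k + 1) * Real.exp (-(β * τ⁻¹))) (𝓝[≥] 0) (𝓝 0) := by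
  rw [← Set.Ioi_insert, nhdsWithin_insert, tendsto_sup]
  constructor
  · rw [tendsto_pure_left]
    intro s hs
    simpa using mem_of_mem_nhds hs
  · have h := (Real.tendsto_pow_mul_exp_neg_atTop_nhds_zero (k + 1)).comp
      ((tendsto_inv_nhdsGT_zero (𝕜 := ℝ)).const_mul_atTop hβ)
    have h2 := h.const_mul ((β ^ (k + 1))⁻¹)
    rw [mul_zero] at h2
    refine h2.congr fun τ ↦ ?_
    simp only [Function.comp, mul_pow]
    field_simp

/-- Near a point `(T, x)` with `x ≠ K` the logarithmic distance is bounded away from zero, so the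
Gaussian factor is at most `exp (-β / τ)` and absorbs all negative powers of `τ = T - t`. The value
at maturity is `0` by the convention `(√0)⁻¹ = 0`, which is the right limit. The cases `k = 1, 2`
serve the second derivative. -/
theorem continuousOn_inv_pow_mul_diracPrice {T σ K : ℝ} (hσ : 0 < σ) (hK : 0 < K) (k : ℕ) :
    ContinuousOn (fun p : ℝ × ℝ ↦ (T - p.1)⁻¹ ^ k * diracPrice T σ K p.1 p.2)
      (diracDomain T K ∩ {p | p.1 ≤ T}) := by
  rintro ⟨t, x⟩ ⟨⟨hx, hne⟩, ht⟩
  simp only at hx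
  have ht : t ≤ T := ht
  have hL : ContinuousAt (fun p : ℝ × ℝ ↦ logDistance T σ K p.1 p.2) (t, x) :=
    (continuousOn_logDistance hK).continuousAt
      ((isOpen_lt continuous_const continuous_snd).mem_nhds hx)
  rcases ht.lt_or_eq with ht' | rfl
  · have hτ : 0 < T - t := sub_pos.2 ht'
    apply ContinuousAt.continuousWithinAt
    have h1 : ContinuousAt (fun p : ℝ × ℝ ↦ T - p.1) (t, x) := by fun_prop
    have h2 := h1.inv₀ hτ.ne'
    have h3 : ContinuousAt (fun p : ℝ × ℝ ↦ (√(T - p.1))⁻¹) (t, x) :=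
      h1.sqrt.inv₀ (Real.sqrt_pos.2 hτ).ne'
    exact (h2.pow k).mul (h3.mul
      (((hL.pow 2).mul (continuousAt_const.mul h2)).neg.rexp))
  · have hxK : x ≠ K := fun h ↦ hne (by rw [h])
    have hL0 : logDistance t σ K t x ≠ 0 := by
      simp only [logDistance, sub_self, mul_zero, zero_div, sub_zero]
      refine Real.log_ne_zero_of_pos_of_ne_one (by positivity) ?_
      rwa [Ne, div_eq_one_iff_eq hK.ne']
    set b := |logDistance t σ K t x| / 2 with hb
    have hbpos : 0 < b := by positivity
    have hbig : ∀ᶠ p : ℝ × ℝ in 𝓝 (t, x), b < |logDistance t σ K p.1 p.2| :=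
      hL.abs.eventually_const_lt (by
        show b < |logDistance t σ K t x|
        rw [hb]; exact half_lt_self (abs_pos.2 hL0))
    have hτ1 : ∀ᶠ p : ℝ × ℝ in 𝓝 (t, x), t - p.1 < 1 := by
      have : ContinuousAt (fun p : ℝ × ℝ ↦ t - p.1) (t, x) := by fun_prop
      exact this.eventually_lt_const (by simp)
    set β := b ^ 2 * (2 * σ ^ 2)⁻¹ with hβ
    have hlim : Tendsto (fun p : ℝ × ℝ ↦ (t - p.1)⁻¹ ^ (k + 1) *
        Real.exp (-(β * (t - p.1)⁻¹))) (𝓝[diracDomain t K ∩ {p | p.1 ≤ t}] (t, x)) (𝓝 0) := by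
      refine (tendsto_inv_pow_mul_exp_neg_inv (β := β) (by positivity) k).comp
        (tendsto_nhdsWithin_iff.2 ⟨?_, ?_⟩)
      · have : ContinuousAt (fun p : ℝ × ℝ ↦ t - p.1) (t, x) := by fun_prop
        have h := this.tendsto
        simp only [sub_self] at h
        exact h.mono_left nhdsWithin_le_nhds
      · filter_upwards [self_mem_nhdsWithin] with p hp
        exact sub_nonneg.2 (show p.1 ≤ t from hp.2)
    have hval : (t - t)⁻¹ ^ k * diracPrice t σ K t x = 0 := by
      simp [diracPrice]
    rw [ContinuousWithinAt, hval]
    refine squeeze_zero_norm' ?_ hlim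
    filter_upwards [self_mem_nhdsWithin, nhdsWithin_le_nhds hbig, nhdsWithin_le_nhds hτ1]
      with p hp hbp hp1
    have hp0 : 0 ≤ t - p.1 := sub_nonneg.2 (show p.1 ≤ t from hp.2)
    set τ := t - p.1 with hτ
    -- The prefactor costs one more power of `τ⁻¹` once `τ < 1`; hence the exponent `k + 1` in the
    -- majorant.
    have hsq : (√τ)⁻¹ ≤ τ⁻¹ := by
      rcases hp0.eq_or_lt with h | h
      · rw [← h]; simp
      · refine inv_anti₀ h ?_
        rw [Real.le_sqrt h.le h.le]
        nlinarith
    have hexp : Real.exp (-(logDistance t σ K p.1 p.2 ^ 2 * ((2 * σ ^ 2)⁻¹ * τ⁻¹))) ≤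
        Real.exp (-(β * τ⁻¹)) := by
      refine Real.exp_le_exp.2 (neg_le_neg ?_)
      rw [hβ, mul_assoc]
      refine mul_le_mul_of_nonneg_right ?_ (by positivity)
      rw [← sq_abs (logDistance t σ K p.1 p.2)]
      gcongr
    rw [Real.norm_eq_abs, abs_of_nonneg (by unfold diracPrice; positivity), pow_succ, mul_assoc]
    unfold diracPrice
    gcongr

theorem continuousOn_diracPrice {T σ K : ℝ} (hσ : 0 < σ) (hK : 0 < K) :
    ContinuousOn (fun p : ℝ × ℝ ↦ diracPrice T σ K p.1 p.2)
      (diracDomain T K ∩ {p | p.1 ≤ T}) := by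
  simpa using continuousOn_inv_pow_mul_diracPrice (T := T) hσ hK 0

theorem continuousOn_diracGamma {T σ K : ℝ} (hσ : 0 < σ) (hK : 0 < K) :
    ContinuousOn (fun p : ℝ × ℝ ↦ diracGamma T σ K p.1 p.2)
      (diracDomain T K ∩ {p | p.1 ≤ T}) := by
  have hL : ContinuousOn (fun p : ℝ × ℝ ↦ logDistance T σ K p.1 p.2)
      (diracDomain T K ∩ {p | p.1 ≤ T}) :=
    (continuousOn_logDistance hK).mono fun p hp ↦ hp.1.1
  have hx : ContinuousOn (fun p : ℝ × ℝ ↦ p.2⁻¹) (diracDomain T K ∩ {p | p.1 ≤ T}) :=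
    continuousOn_snd.inv₀ fun p hp ↦ hp.1.1.ne'
  exact (hx.pow 2).mul ((((hL.sub continuousOn_const).mul continuousOn_const).mul
    (continuousOn_inv_pow_mul_diracPrice hσ hK 1)).add
    (((hL.mul continuousOn_const).pow 2).mul (continuousOn_inv_pow_mul_diracPrice hσ hK 2)))

/-- Along a path that does not end at the strike, the forward integral of `diracDelta` is the
increment of `diracPrice`. -/
theorem tendsto_pathSum_diracDelta {T σ K : ℝ} (hT : 0 < T) (hσ : 0 < σ) (hK : 0 < K) {η : ℝ → ℝ}
    (hη : Continuous η) (hpos : ∀ s, 0 < η s) (hqv : HasLogQuadraticVariation T σ η)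
    (hne : η T ≠ K) {t : ℝ} (ht : t ∈ Set.Icc 0 T) :
    Tendsto (fun n ↦ pathSum T (fun s ↦ diracDelta T σ K s (η s)) η n t) atTop
      (𝓝 (diracPrice T σ K t (η t) - diracPrice T σ K 0 (η 0))) := by
  have hgc : Continuous fun s ↦ (s, η s) := by fun_prop
  have hΓ : IsCompact ((fun s ↦ (s, η s)) '' Set.Icc 0 T) := isCompact_Icc.image hgc
  have hΓD : (fun s ↦ (s, η s)) '' Set.Icc 0 T ⊆ diracDomain T K := by
    rintro _ ⟨s, -, rfl⟩
    refine ⟨hpos s, fun h ↦ hne ?_⟩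
    rw [Prod.mk.injEq] at h
    rw [← h.1]; exact h.2
  -- The graph of the path is compact and avoids the singular point `(T, K)`. Hence so does a
  -- compact neighbourhood, on which, cut at time `T`, the price and its second derivative are
  -- uniformly continuous up to maturity.
  obtain ⟨ρ, hρ, hρD⟩ := hΓ.exists_cthickening_subset_open (isOpen_diracDomain T K) hΓD
  set B : Set (ℝ × ℝ) := Metric.cthickening ρ ((fun s ↦ (s, η s)) '' Set.Icc 0 T) ∩
    {p | p.1 ≤ T} with hB
  have hBc : IsCompact B := hΓ.cthickening.inter_right (isClosed_le continuous_fst continuous_const)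
  have hBD : B ⊆ diracDomain T K ∩ {p | p.1 ≤ T} := fun p hp ↦ ⟨hρD hp.1, hp.2⟩
  have hmemB : ∀ s ∈ Set.Icc 0 T, ∀ p : ℝ × ℝ, p.1 ≤ T → dist p (s, η s) ≤ ρ → p ∈ B :=
    fun s hs p hp hd ↦ ⟨Metric.mem_cthickening_of_dist_le _ _ _ _ ⟨s, hs, rfl⟩ hd, hp⟩
  have hgraph : Set.MapsTo (fun s ↦ (s, η s)) (Set.Icc 0 T) B := fun s hs ↦
    hmemB s hs _ hs.2 (by rw [dist_self]; exact hρ.le)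
  have hγB := (continuousOn_diracGamma (T := T) hσ hK).mono hBD
  have hvB := (continuousOn_diracPrice (T := T) hσ hK).mono hBD
  set θ : ℝ × ℝ → ℝ := fun p ↦ -(σ ^ 2 / 2) * (p.2 ^ 2 * diracGamma T σ K p.1 p.2) with hθ
  have hθB : ContinuousOn θ B := continuousOn_const.mul ((continuousOn_snd.pow 2).mul hγB)
  have hk₂ : ContinuousOn (fun s ↦ -(1 / 2) * diracGamma T σ K s (η s)) (Set.Icc 0 T) :=
    continuousOn_const.mul (hγB.comp hgc.continuousOn hgraph)
  have hk₁ : ContinuousOn (fun s ↦ -θ (s, η s)) (Set.Icc 0 T) :=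
    (hθB.comp hgc.continuousOn hgraph).neg
  have hU : ContinuousOn (fun s ↦ diracPrice T σ K s (η s)) (Set.Icc 0 T) :=
    hvB.comp hgc.continuousOn hgraph
  have huc1 := hBc.uniformContinuousOn_of_continuous hγB
  have huc2 := hBc.uniformContinuousOn_of_continuous hθB
  rw [Metric.uniformContinuousOn_iff] at huc1 huc2
  have key : ∀ ε > 0, ∀ᶠ n : ℕ in atTop, ∀ i : ℕ, i < 2 ^ n →
      |diracDelta T σ K (T * i / 2 ^ n) (η (T * i / 2 ^ n)) *
          (η (T * (i + 1) / 2 ^ n) - η (T * i / 2 ^ n)) -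
        (diracPrice T σ K (T * (i + 1) / 2 ^ n) (η (T * (i + 1) / 2 ^ n)) -
          diracPrice T σ K (T * i / 2 ^ n) (η (T * i / 2 ^ n))) -
        (-θ (T * i / 2 ^ n, η (T * i / 2 ^ n))) * (T / 2 ^ n) -
        (-(1 / 2) * diracGamma T σ K (T * i / 2 ^ n) (η (T * i / 2 ^ n))) *
          (η (T * (i + 1) / 2 ^ n) - η (T * i / 2 ^ n)) ^ 2| ≤
      ε * (T / 2 ^ n + (η (T * (i + 1) / 2 ^ n) - η (T * i / 2 ^ n)) ^ 2) + 0 := by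
    intro ε hε
    obtain ⟨δ₁, hδ₁, hm1⟩ := huc1 ε hε
    obtain ⟨δ₂, hδ₂, hm2⟩ := huc2 ε hε
    set δ := min ρ (min δ₁ δ₂) / 2 with hδ
    have hδpos : 0 < δ := by positivity
    have hδρ : δ ≤ ρ := (half_le_self (by positivity)).trans (min_le_left _ _)
    have hδ1 : δ < δ₁ := (half_lt_self (by positivity)).trans_le
      ((min_le_right _ _).trans (min_le_left _ _))
    have hδ2 : δ < δ₂ := (half_lt_self (by positivity)).trans_le
      ((min_le_right _ _).trans (min_le_right _ _))
    filter_upwards [eventually_abs_increment_le hT hη.continuousOn hδpos,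
      (tendsto_mesh T).eventually_lt_const hδpos] with n h1 h2 i hi
    have h1 := h1 i hi
    have haI : T * (i : ℝ) / 2 ^ n ∈ Set.Icc 0 T := dyadic_mem_Icc hT hi.le
    have hbI : T * ((i : ℝ) + 1) / 2 ^ n ∈ Set.Icc 0 T := dyadic_succ_mem_Icc hT hi
    have hba : T * ((i : ℝ) + 1) / 2 ^ n - T * (i : ℝ) / 2 ^ n = T / 2 ^ n := dyadic_succ_sub T n i
    set a := T * (i : ℝ) / 2 ^ n with ha
    set b := T * ((i : ℝ) + 1) / 2 ^ n with hb
    have hh : 0 < T / 2 ^ n := by positivity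
    have hab : a < b := by linarith
    have haT : a < T := hab.trans_le hbI.2
    have hnear : ∀ s ∈ Set.Icc a b, ∀ x ∈ Set.uIcc (η a) (η b), dist (s, x) (a, η a) ≤ δ := by
      intro s hs x hx
      rw [Prod.dist_eq, Real.dist_eq, Real.dist_eq]
      refine max_le ?_ ((Set.abs_sub_left_of_mem_uIcc hx).trans h1)
      rw [abs_of_nonneg (by linarith [hs.1])]
      linarith [hs.2]
    have hnB : ∀ s ∈ Set.Icc a b, ∀ x ∈ Set.uIcc (η a) (η b), (s, x) ∈ B := fun s hs x hx ↦
      hmemB a haI _ (hs.2.trans hbI.2) ((hnear s hs x hx).trans hδρ)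
    have haa : a ∈ Set.Icc a b := Set.left_mem_Icc.2 hab.le
    have hxpos : ∀ x ∈ Set.uIcc (η a) (η b), 0 < x := fun x hx ↦ (hBD (hnB a haa x hx)).1.1
    have haB : (a, η a) ∈ B := hnB a haa _ Set.left_mem_uIcc
    -- The step in time is made at the price `η b`, the step in price at the time `a < T`. The
    -- interval may end at `T`, where the mean value theorem needs continuity only.
    have hbr1 : |diracPrice T σ K b (η b) - diracPrice T σ K a (η b) - θ (a, η a) * (T / 2 ^ n)| ≤
        ε * (T / 2 ^ n) := by
      obtain ⟨c, hc, hc'⟩ := exists_hasDerivAt_eq_slope (fun s ↦ diracPrice T σ K s (η b))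
        (fun s ↦ θ (s, η b)) hab
        (hvB.comp (f := fun s ↦ (s, η b)) (by fun_prop)
          fun s hs ↦ hnB s hs _ Set.right_mem_uIcc)
        (fun s hs ↦ hasDerivAt_diracPrice_time hσ (hs.2.trans_le hbI.2) (hpos b))
      have hcI := Set.Ioo_subset_Icc_self hc
      rw [hba, eq_div_iff hh.ne'] at hc'
      rw [← hc', ← sub_mul, abs_mul, abs_of_pos hh]
      refine mul_le_mul_of_nonneg_right ?_ hh.le
      exact (hm2 _ (hnB c hcI _ Set.right_mem_uIcc) _ haB
        ((hnear c hcI _ Set.right_mem_uIcc).trans_lt hδ2)).le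
    have hbr2 : |diracPrice T σ K a (η b) - diracPrice T σ K a (η a) -
        diracDelta T σ K a (η a) * (η b - η a) - diracGamma T σ K a (η a) / 2 * (η b - η a) ^ 2| ≤
        ε * (η b - η a) ^ 2 := by
      have h3 := abs_integral_sub_taylor_le (f := fun x ↦ diracDelta T σ K a x)
        (f' := fun x ↦ diracGamma T σ K a x) (a := η a) (b := η b) (ω := ε)
        (fun x hx ↦ hasDerivAt_diracDelta hσ hK haT (hxpos x hx))
        (fun x hx ↦ (hm1 _ (hnB a haa x hx) _ haB ((hnear a haa x hx).trans_lt hδ1)).le)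
      rwa [intervalIntegral.integral_eq_sub_of_hasDerivAt
        (fun x hx ↦ hasDerivAt_diracPrice hσ hK haT (hxpos x hx))
        (ContinuousOn.intervalIntegrable fun x hx ↦
          (hasDerivAt_diracDelta hσ hK haT (hxpos x hx)).continuousAt.continuousWithinAt)] at h3
    have a1 := abs_le.1 hbr1
    have a2 := abs_le.1 hbr2
    rw [abs_le]
    constructor <;> linarith
  -- By the Black–Scholes equation the time term and the Itô correction cancel pointwise.
  have hzero : ((∫ u in (0 : ℝ)..t, -θ (u, η u)) +
      σ ^ 2 * ∫ u in (0 : ℝ)..t, -(1 / 2) * diracGamma T σ K u (η u) * η u ^ 2) = 0 := by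
    rw [← intervalIntegral.integral_const_mul, ← intervalIntegral.integral_add]
    · refine (intervalIntegral.integral_congr (g := fun _ ↦ (0 : ℝ)) fun u _ ↦ ?_).trans
        intervalIntegral.integral_zero
      simp only [hθ]
      ring
    · exact (hk₁.mono (by
        rw [Set.uIcc_of_le ht.1]; exact Set.Icc_subset_Icc_right ht.2)).intervalIntegrable
    · exact ((continuousOn_const.mul (hk₂.mul (hη.pow 2).continuousOn)).mono (by
        rw [Set.uIcc_of_le ht.1]; exact Set.Icc_subset_Icc_right ht.2)).intervalIntegrable
  rw [Metric.tendsto_atTop']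
  suffices H : ∀ ε > 0, ∀ᶠ n in atTop,
      |pathSum T (fun s ↦ diracDelta T σ K s (η s)) η n t -
        (diracPrice T σ K t (η t) - diracPrice T σ K 0 (η 0))| < ε by
    intro ε hε
    obtain ⟨n, hn⟩ := eventually_atTop.1 (H ε hε)
    exact ⟨n, fun m hm ↦ hn m hm.le⟩
  intro ε hε
  set Q := T + σ ^ 2 * (∫ u in (0 : ℝ)..T, η u ^ 2) + 2 with hQ
  have hQpos : 0 < Q := by
    have : 0 ≤ ∫ u in (0 : ℝ)..T, η u ^ 2 :=
      intervalIntegral.integral_nonneg hT.le fun u _ ↦ sq_nonneg _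
    positivity
  filter_upwards [eventually_abs_pathSum_sub_le hT hη.continuousOn (fun s _ ↦ hpos s) hqv
    (y := fun s ↦ diracDelta T σ K s (η s)) (U := fun s ↦ diracPrice T σ K s (η s)) (E := 0)
    hk₁ hk₂ (show 0 < ε / (3 * Q) by positivity) (fun _ _ _ ↦ le_rfl) (by simp)
    (key _ (by positivity)) ht,
    eventually_abs_sub_le_of_continuousOn hU (show 0 < ε / 3 by positivity)]
    with n ⟨s, hs, hst, hn⟩ h2
  have h3 := abs_le.1 (h2 s hs t ht hst)
  rw [hzero, ← hQ, add_zero, add_zero, show ε / (3 * Q) * Q = ε / 3 by field_simp] at hn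
  have h4 := abs_le.1 hn
  rw [abs_lt]
  constructor <;> linarith

/-! ### Quadratic variation of Brownian and fractional Brownian motion -/

/-- By Tonelli the sum of the series has finite mean, so it is almost surely finite and its terms
tend to zero. -/
theorem ae_tendsto_zero_of_summable_integral {Ω : Type*} [MeasurableSpace Ω] {P : Measure Ω}
    {f : ℕ → Ω → ℝ} (h0 : ∀ n, 0 ≤ᵐ[P] f n) (hf : ∀ n, Integrable (f n) P) {b : ℕ → ℝ}
    (hb : ∀ n, ∫ ω, f n ω ∂P ≤ b n) (hs : Summable b) :
    ∀ᵐ ω ∂P, Tendsto (fun n ↦ f n ω) atTop (𝓝 0) := by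
  have h1 : ∀ n, ∫⁻ ω, ENNReal.ofReal (f n ω) ∂P ≤ ENNReal.ofReal (b n) := fun n ↦ by
    rw [← ofReal_integral_eq_lintegral_ofReal (hf n) (h0 n)]
    exact ENNReal.ofReal_le_ofReal (hb n)
  have h2 : ∫⁻ ω, ∑' n, ENNReal.ofReal (f n ω) ∂P ≠ ∞ := by
    rw [lintegral_tsum fun n ↦ (hf n).aemeasurable.ennreal_ofReal]
    refine ne_top_of_le_ne_top ?_ (ENNReal.tsum_le_tsum h1)
    exact hs.tsum_ofReal_ne_top
  filter_upwards [ae_lt_top' (AEMeasurable.tsum fun n ↦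
    (hf n).aemeasurable.ennreal_ofReal) h2, ae_all_iff.2 h0] with ω hω hω0
  have h3 := ENNReal.tendsto_atTop_zero_of_tsum_ne_top hω.ne
  have h4 := (ENNReal.tendsto_toReal ENNReal.zero_ne_top).comp h3
  simp only [ENNReal.toReal_zero] at h4
  exact h4.congr fun n ↦ ENNReal.toReal_ofReal (hω0 n)

theorem memLp_sq_gaussianReal (v : ℝ≥0) : MemLp (fun x : ℝ ↦ x ^ 2) 2 (gaussianReal 0 v) := by
  rw [memLp_two_iff_integrable_sq (by fun_prop)]
  have h := (memLp_id_gaussianReal (μ := 0) (v := v) 4).integrable_norm_pow (by norm_num)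
  refine h.congr (ae_of_all _ fun x ↦ ?_)
  simp only [id, Real.norm_eq_abs]
  rw [← pow_mul]
  exact (even_two_mul 2).pow_abs x

/-- Scaling by `√v`. Only the order `v²` matters later, so the variance for `v = 1` is not computed.
-/
theorem variance_sq_gaussianReal (v : ℝ≥0) :
    Var[fun x : ℝ ↦ x ^ 2; gaussianReal 0 v] =
      (v : ℝ) ^ 2 * Var[fun x : ℝ ↦ x ^ 2; gaussianReal 0 1] := by
  have h := gaussianReal_map_const_mul (μ := 0) (v := 1) (√v)
  have e : NNReal.mk (√v ^ 2) (sq_nonneg _) * 1 = v := by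
    ext; simp [Real.sq_sqrt]
  rw [mul_zero, e] at h
  rw [← h, variance_map (by fun_prop) (by fun_prop), ← variance_const_mul]
  congr 1
  ext x
  simp only [Function.comp, mul_pow]
  rw [Real.sq_sqrt (NNReal.coe_nonneg v)]

section BrownianMotion

variable {Ω : Type*} [MeasurableSpace Ω] {P : Measure Ω} {W : ℝ≥0 → Ω → ℝ}

theorem hasLaw_brownian_increment (hW : IsPreBrownianReal W P) {s t : ℝ} (hs : 0 ≤ s)
    (hst : s ≤ t) :
    HasLaw (fun ω ↦ W t.toNNReal ω - W s.toNNReal ω) (gaussianReal 0 (t - s).toNNReal) P := by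
  have h := hW.hasLaw_sub t.toNNReal s.toNNReal
  have e : nndist (t.toNNReal : ℝ) (s.toNNReal : ℝ) = (t - s).toNNReal := by
    ext
    rw [coe_nndist, Real.coe_toNNReal _ hs, Real.coe_toNNReal _ (hs.trans hst),
      Real.coe_toNNReal _ (sub_nonneg.2 hst), Real.dist_eq, abs_of_nonneg (sub_nonneg.2 hst)]
  rw [← e]
  exact h

/-- Brownian motion has quadratic variation `t` along the dyadic partitions. -/
theorem ae_tendsto_sum_brownian_increment_sq (hW : IsPreBrownianReal W P) {T : ℝ} (hT : 0 < T)
    {t : ℝ} (ht : t ∈ Set.Icc 0 T) :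
    ∀ᵐ ω ∂P, Tendsto (fun n ↦ ∑ i ∈ dyadicIndices T n t,
      (W (T * (i + 1) / 2 ^ n).toNNReal ω - W (T * i / 2 ^ n).toNNReal ω) ^ 2) atTop (𝓝 t) := by
  have : IsProbabilityMeasure P := hW.isGaussianProcess.isProbabilityMeasure
  set c := Var[fun x : ℝ ↦ x ^ 2; gaussianReal 0 1] with hc
  have hc0 : 0 ≤ c := variance_nonneg _ _
  set X : ℕ → ℕ → Ω → ℝ := fun n i ω ↦
    (W (T * (i + 1) / 2 ^ n).toNNReal ω - W (T * i / 2 ^ n).toNNReal ω) ^ 2 with hX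
  have hlaw : ∀ n i : ℕ, HasLaw (fun ω ↦ W (T * (i + 1) / 2 ^ n).toNNReal ω -
      W (T * i / 2 ^ n).toNNReal ω) (gaussianReal 0 (T / 2 ^ n).toNNReal) P := fun n i ↦ by
    rw [← dyadic_succ_sub T n i]
    exact hasLaw_brownian_increment hW (by positivity) (by gcongr; linarith)
  have hmem : ∀ n i, MemLp (X n i) 2 P := fun n i ↦ by
    have h := memLp_sq_gaussianReal (T / 2 ^ n).toNNReal
    rw [← (hlaw n i).map_eq] at h
    exact (memLp_map_measure_iff h.1 (hlaw n i).aemeasurable).1 h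
  have hvar : ∀ n i, Var[X n i; P] = (T / 2 ^ n) ^ 2 * c := fun n i ↦ by
    have h := variance_sq_gaussianReal (T / 2 ^ n).toNNReal
    rw [← (hlaw n i).map_eq, variance_map (by fun_prop) (hlaw n i).aemeasurable,
      Real.coe_toNNReal _ (by positivity)] at h
    exact h
  have hmean : ∀ n i, ∫ ω, X n i ω ∂P = T / 2 ^ n := fun n i ↦ by
    have h1 : ∫ ω, (W (T * (i + 1) / 2 ^ n).toNNReal ω - W (T * i / 2 ^ n).toNNReal ω) ∂P = 0 := by
      rw [(hlaw n i).integral_eq, integral_id_gaussianReal]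
    have h2 := (hlaw n i).variance_eq
    rw [variance_id_gaussianReal, Real.coe_toNNReal _ (by positivity),
      variance_of_integral_eq_zero (hlaw n i).aemeasurable h1] at h2
    exact h2
  have hind : ∀ n, Set.Pairwise (dyadicIndices T n t : Set ℕ) fun i j ↦ X n i ⟂ᵢ[P] X n j := by
    intro n i _ j _ hij
    have hm : Monotone fun i : ℕ ↦ (T * (i : ℝ) / 2 ^ n).toNNReal := fun i j hij ↦
      Real.toNNReal_le_toNNReal (by gcongr)
    have h := (hW.hasIndepIncrements.nat hm).indepFun hij
    push_cast at h
    exact h.comp (φ := fun x : ℝ ↦ x ^ 2) (ψ := fun x : ℝ ↦ x ^ 2) (by fun_prop) (by fun_prop)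
  set Z : ℕ → Ω → ℝ := fun n ↦ ∑ i ∈ dyadicIndices T n t, X n i with hZ
  have hZmem : ∀ n, MemLp (Z n) 2 P := fun n ↦ memLp_finsetSum' _ fun i _ ↦ hmem n i
  have hZvar : ∀ n, Var[Z n; P] = ((dyadicIndices T n t).card : ℝ) * ((T / 2 ^ n) ^ 2 * c) := by
    intro n
    rw [hZ, IndepFun.variance_sum (fun i _ ↦ hmem n i) (hind n), Finset.sum_congr rfl
      (fun i _ ↦ hvar n i), Finset.sum_const, nsmul_eq_mul]
  have hZmean : ∀ n, ∫ ω, Z n ω ∂P = ((dyadicIndices T n t).card : ℝ) * (T / 2 ^ n) := by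
    intro n
    simp only [hZ, Finset.sum_apply]
    rw [integral_finsetSum _ (fun i _ ↦ (hmem n i).integrable one_le_two), Finset.sum_congr rfl
      (fun i _ ↦ hmean n i), Finset.sum_const, nsmul_eq_mul]
  have hcard : ∀ n, t ≤ ((dyadicIndices T n t).card : ℝ) * (T / 2 ^ n) ∧
      ((dyadicIndices T n t).card : ℝ) * (T / 2 ^ n) ≤ t + T / 2 ^ n ∧
      ((dyadicIndices T n t).card : ℝ) ≤ 2 ^ n := by
    intro n
    obtain ⟨N, hN2, hN, h1, h2⟩ := exists_dyadicIndices_eq_range hT n ht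
    rw [hN, Finset.card_range, show (N : ℝ) * (T / 2 ^ n) = T * N / 2 ^ n by ring]
    exact ⟨h1, h2, by exact_mod_cast hN2⟩
  -- At most `2 ^ n` pairwise independent terms with variance of order `4⁻ⁿ` each: the variance of
  -- the sum is of order `2⁻ⁿ`, which is summable.
  have hlim := ae_tendsto_zero_of_summable_integral (P := P)
    (f := fun n ω ↦ (Z n ω - P[Z n]) ^ 2) (b := fun n ↦ T ^ 2 * c * (1 / 2) ^ n)
    (fun n ↦ ae_of_all _ fun ω ↦ sq_nonneg _)
    (fun n ↦ ((hZmem n).sub (memLp_const _)).integrable_sq) (fun n ↦ by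
      rw [← variance_eq_integral (hZmem n).aemeasurable, hZvar]
      calc _ ≤ 2 ^ n * ((T / 2 ^ n) ^ 2 * c) := by gcongr; exact (hcard n).2.2
        _ = _ := by rw [one_div, inv_pow]; field_simp)
    ((summable_geometric_of_lt_one (by norm_num) (by norm_num)).mul_left _)
  have hEt : Tendsto (fun n ↦ ((dyadicIndices T n t).card : ℝ) * (T / 2 ^ n)) atTop (𝓝 t) := by
    have hup : Tendsto (fun n : ℕ ↦ t + T / 2 ^ n) atTop (𝓝 t) := by
      simpa using (tendsto_mesh T).const_add t
    exact tendsto_of_tendsto_of_tendsto_of_le_of_le tendsto_const_nhds hup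
      (fun n ↦ (hcard n).1) (fun n ↦ (hcard n).2.1)
  filter_upwards [hlim] with ω hω
  have h1 : Tendsto (fun n ↦ Z n ω - P[Z n]) atTop (𝓝 0) := by
    rw [tendsto_zero_iff_abs_tendsto_zero]
    have := hω.sqrt
    rw [Real.sqrt_zero] at this
    exact this.congr fun n ↦ Real.sqrt_sq_eq_abs _
  have h2 := h1.add hEt
  rw [zero_add] at h2
  refine h2.congr fun n ↦ ?_
  rw [hZmean]
  simp [hZ, hX]

end BrownianMotion

/-- Fractional Brownian motion with Hurst index `H > 1 / 2` has zero quadratic variation. -/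
theorem ae_tendsto_sum_fractional_increment_sq {Ω : Type*} [MeasurableSpace Ω] {P : Measure Ω}
    [IsProbabilityMeasure P] {T H : ℝ} (hT : 0 < T) (hH : 1 / 2 < H)
    {B : Set.Icc (0 : ℝ) T → Ω → ℝ} (hB : IsFractionalBrownianMotion H B P) :
    ∀ᵐ ω ∂P, Tendsto (fun n ↦ ∑ i ∈ Finset.range (2 ^ n),
      (B (Set.projIcc 0 T hT.le (T * (i + 1) / 2 ^ n)) ω -
        B (Set.projIcc 0 T hT.le (T * i / 2 ^ n)) ω) ^ 2) atTop (𝓝 0) := by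
  have hmem : ∀ s, MemLp (B s) 2 P := fun s ↦ (hB.gaussian.hasGaussianLaw_eval s).memLp_two
  have hinc : ∀ s t : Set.Icc (0 : ℝ) T, ∫ ω, (B s ω - B t ω) ^ 2 ∂P =
      |(s : ℝ) - t| ^ (2 * H) := by
    intro s t
    have h0 : ∫ ω, (B s ω - B t ω) ∂P = 0 := by
      rw [integral_sub ((hmem s).integrable one_le_two) ((hmem t).integrable one_le_two),
        hB.centered, hB.centered, sub_zero]
    have h1 := variance_of_integral_eq_zero (μ := P) (X := fun ω ↦ B s ω - B t ω)
      ((hmem s).sub (hmem t)).aemeasurable h0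
    rw [← h1, variance_fun_sub (hmem s) (hmem t), ← covariance_self (hmem s).aemeasurable,
      ← covariance_self (hmem t).aemeasurable, hB.covariance, hB.covariance, hB.covariance]
    simp only [sub_self, abs_zero]
    rw [Real.zero_rpow (by linarith)]
    ring
  have hint : ∀ s t : Set.Icc (0 : ℝ) T, Integrable (fun ω ↦ (B s ω - B t ω) ^ 2) P :=
    fun s t ↦ ((hmem s).sub (hmem t)).integrable_sq
  -- The mean of the sum is `2ⁿ (T / 2ⁿ)^(2H)`, a geometric sequence whose ratio `2^(1 - 2H)` is
  -- below `1` exactly because `H > 1/2`.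
  refine ae_tendsto_zero_of_summable_integral (b := fun n ↦ T ^ (2 * H) * (2 ^ (1 - 2 * H)) ^ n)
    (fun n ↦ ae_of_all _ fun ω ↦ Finset.sum_nonneg fun i _ ↦ sq_nonneg _)
    (fun n ↦ integrable_finsetSum _ fun i _ ↦ hint _ _)
    (fun n ↦ ?_) ((summable_geometric_of_lt_one (by positivity)
      (Real.rpow_lt_one_of_one_lt_of_neg one_lt_two (by linarith))).mul_left _)
  rw [integral_finsetSum _ fun i _ ↦ hint _ _]
  have h2 : ∀ i ∈ Finset.range (2 ^ n),
      ∫ ω, (B (Set.projIcc 0 T hT.le (T * (i + 1) / 2 ^ n)) ω -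
        B (Set.projIcc 0 T hT.le (T * i / 2 ^ n)) ω) ^ 2 ∂P = (T / 2 ^ n) ^ (2 * H) := by
    intro i hi
    have hi := Finset.mem_range.1 hi
    rw [hinc, Set.projIcc_of_mem hT.le (dyadic_mem_Icc hT hi.le),
      Set.projIcc_of_mem hT.le (dyadic_succ_mem_Icc hT hi)]
    simp only
    rw [dyadic_succ_sub, abs_of_pos (by positivity)]
  rw [Finset.sum_congr rfl h2, Finset.sum_const, Finset.card_range, nsmul_eq_mul]
  apply le_of_eq
  rw [Real.div_rpow hT.le (by positivity), ← Real.rpow_natCast (2 ^ (1 - 2 * H)) n,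
    ← Real.rpow_natCast 2 n, ← Real.rpow_mul two_pos.le, ← Real.rpow_mul two_pos.le]
  push_cast
  rw [← Real.rpow_natCast 2 n, mul_div_assoc', mul_comm, mul_div_assoc,
    ← Real.rpow_sub two_pos]
  congr 2
  ring

/-- Cauchy–Schwarz bounds the cross sum by the root of a product of a convergent sum and a vanishing
one; independence plays no role here. -/
theorem tendsto_sum_add_sq {T σ t : ℝ} {w z : ℕ → ℕ → ℝ}
    (hw : Tendsto (fun n ↦ ∑ i ∈ dyadicIndices T n t, w n i ^ 2) atTop (𝓝 t))
    (hz : Tendsto (fun n ↦ ∑ i ∈ Finset.range (2 ^ n), z n i ^ 2) atTop (𝓝 0)) :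
    Tendsto (fun n ↦ ∑ i ∈ dyadicIndices T n t, (σ * w n i + z n i) ^ 2) atTop
      (𝓝 (σ ^ 2 * t)) := by
  have hz' : Tendsto (fun n ↦ ∑ i ∈ dyadicIndices T n t, z n i ^ 2) atTop (𝓝 0) :=
    squeeze_zero (fun n ↦ Finset.sum_nonneg fun i _ ↦ sq_nonneg _)
      (fun n ↦ Finset.sum_le_sum_of_subset_of_nonneg (Finset.filter_subset _ _)
        fun i _ _ ↦ sq_nonneg _) hz
  have hcross : Tendsto (fun n ↦ ∑ i ∈ dyadicIndices T n t, w n i * z n i) atTop (𝓝 0) := by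
    have h1 := (hw.mul hz').sqrt
    rw [mul_zero, Real.sqrt_zero] at h1
    refine squeeze_zero_norm (fun n ↦ ?_) h1
    rw [Real.norm_eq_abs]
    exact Real.abs_le_sqrt (Finset.sum_mul_sq_le_sq_mul_sq _ _ _)
  have := ((hw.const_mul (σ ^ 2)).add (hcross.const_mul (2 * σ))).add hz'
  simp only [mul_zero, add_zero] at this
  refine this.congr fun n ↦ ?_
  rw [Finset.mul_sum, Finset.mul_sum, ← Finset.sum_add_distrib, ← Finset.sum_add_distrib]
  exact Finset.sum_congr rfl fun i _ ↦ by ring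

/-! ### Full support of Brownian motion -/

/-- The deviation of the path `w` from its linear interpolation between the points `j h`. -/
def bridge (w : ℝ≥0 → ℝ) (h : ℝ≥0) (p : ℕ × Set.Iic (1 : ℝ≥0)) : ℝ :=
  w ((p.1 + p.2) * h) - (1 - (p.2 : ℝ≥0)) * w (p.1 * h) - (p.2 : ℝ≥0) * w ((p.1 + 1) * h)

/-- The bridge is a convex combination of the increments of `w` from the two ends of a grid cell,
both taken over at most one mesh. -/
theorem eventually_abs_bridge_le {w : ℝ≥0 → ℝ} (hw : Continuous w) (T : ℝ≥0) {ε : ℝ}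
    (hε : 0 < ε) : ∀ᶠ n : ℕ in atTop, ∀ p : ℕ × Set.Iic (1 : ℝ≥0), p.1 ≤ n →
      |bridge w (T / (n + 1)) p| ≤ ε := by
  have huc := (isCompact_Icc (a := (0 : ℝ≥0)) (b := T)).uniformContinuousOn_of_continuous
    hw.continuousOn
  rw [Metric.uniformContinuousOn_iff] at huc
  obtain ⟨δ, hδ, hmod⟩ := huc ε hε
  have hlim : Tendsto (fun n : ℕ ↦ (T : ℝ) * (1 / ((n : ℝ) + 1))) atTop (𝓝 0) := by
    simpa using (tendsto_one_div_add_atTop_nhds_zero_nat (𝕜 := ℝ)).const_mul (T : ℝ)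
  filter_upwards [hlim.eventually_lt_const hδ] with n hn
  rintro ⟨j, l, hl⟩ hj
  have hl : l ≤ 1 := hl
  simp only at hj
  set h : ℝ≥0 := T / (n + 1) with hh
  have hhδ : (h : ℝ) < δ := by
    rw [hh]; push_cast
    rw [mul_one_div] at hn
    exact hn
  have hnh : ((n : ℝ≥0) + 1) * h = T := by
    rw [hh]; field_simp
  have hjn : (j : ℝ≥0) ≤ n := by exact_mod_cast hj
  have hmem : ∀ m : ℝ≥0, m ≤ 1 → ((j : ℝ≥0) + m) * h ∈ Set.Icc 0 T := fun m hm ↦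
    ⟨zero_le, by rw [← hnh]; gcongr⟩
  have h0 : (j : ℝ≥0) * h ∈ Set.Icc 0 T := by simpa using hmem 0 zero_le_one
  have hl1 : (l : ℝ) ≤ 1 := by exact_mod_cast hl
  have hl0 : (0 : ℝ) ≤ l := l.2
  have hh0 : (0 : ℝ) ≤ h := h.2
  have d1 : |w ((j + l) * h) - w (j * h)| < ε := by
    refine hmod _ (hmem l hl) _ h0 (lt_of_le_of_lt ?_ hhδ)
    rw [NNReal.dist_eq]; push_cast
    rw [show ((j : ℝ) + l) * h - j * h = l * h by ring, abs_of_nonneg (by positivity)]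
    nlinarith
  have d2 : |w ((j + l) * h) - w ((j + 1) * h)| < ε := by
    refine hmod _ (hmem l hl) _ (hmem 1 le_rfl) (lt_of_le_of_lt ?_ hhδ)
    rw [NNReal.dist_eq]; push_cast
    rw [show ((j : ℝ) + l) * h - (j + 1) * h = -((1 - l) * h) by ring, abs_neg,
      abs_of_nonneg (mul_nonneg (by linarith) hh0)]
    nlinarith
  have e : bridge w h (j, ⟨l, hl⟩) = (1 - l) * (w ((j + l) * h) - w (j * h)) +
      l * (w ((j + l) * h) - w ((j + 1) * h)) := by
    simp only [bridge]; ring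
  rw [e]
  calc _ ≤ |(1 - (l : ℝ)) * (w ((j + l) * h) - w (j * h))| +
        |l * (w ((j + l) * h) - w ((j + 1) * h))| := abs_add_le _ _
    _ = (1 - l) * |w ((j + l) * h) - w (j * h)| + l * |w ((j + l) * h) - w ((j + 1) * h)| := by
        rw [abs_mul, abs_mul, abs_of_nonneg (by linarith : 0 ≤ 1 - (l : ℝ)), abs_of_nonneg hl0]
    _ ≤ (1 - l) * ε + l * ε := by gcongr
    _ = ε := by ring

theorem exists_eq_add_mul {T s : ℝ≥0} (hT : 0 < T) (hs : s ≤ T) (n : ℕ) :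
    ∃ p : ℕ × Set.Iic (1 : ℝ≥0), p.1 ≤ n ∧ s = (p.1 + p.2) * (T / (n + 1)) := by
  have hh : 0 < T / ((n : ℝ≥0) + 1) := by positivity
  rcases hs.lt_or_eq with hlt | rfl
  · have hx : s / (T / ((n : ℝ≥0) + 1)) < n + 1 := by
      rw [div_lt_iff₀ hh]
      rwa [mul_div_cancel₀ _ (by positivity)]
    have h1 := Nat.floor_le (zero_le (a := s / (T / ((n : ℝ≥0) + 1))))
    have h2 := Nat.lt_floor_add_one (s / (T / ((n : ℝ≥0) + 1)))
    refine ⟨(⌊s / (T / ((n : ℝ≥0) + 1))⌋₊, ⟨s / (T / ((n : ℝ≥0) + 1)) -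
      ⌊s / (T / ((n : ℝ≥0) + 1))⌋₊, ?_⟩), ?_, ?_⟩
    · rw [Set.mem_Iic, tsub_le_iff_left]
      exact h2.le
    · have : (⌊s / (T / ((n : ℝ≥0) + 1))⌋₊ : ℝ≥0) < n + 1 := h1.trans_lt hx
      exact Nat.lt_succ_iff.1 (by exact_mod_cast this)
    · simp only
      rw [add_tsub_cancel_of_le h1, div_mul_cancel₀ _ hh.ne']
  -- At `s = T` the floor would be `n + 1`; the right end of the last cell is used instead.
  · refine ⟨(n, ⟨1, Set.mem_Iic.2 le_rfl⟩), le_rfl, ?_⟩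
    simp only
    rw [mul_div_cancel₀ _ (by positivity)]

section BrownianMotion

variable {Ω : Type*} [MeasurableSpace Ω] {P : Measure Ω} {W : ℝ≥0 → Ω → ℝ}

/-- Both families are linear in one Gaussian process, so vanishing covariances suffice. The
covariance with `W (k h)` is the bridge of `s ↦ min s (k h)`, which is affine on every grid cell. -/
theorem indepFun_bridge (hW : IsPreBrownianReal W P) (h : ℝ≥0) :
    IndepFun (fun ω p ↦ bridge (fun s ↦ W s ω) h p) (fun ω (k : ℕ) ↦ W (k * h) ω) P := by
  have hprob : IsProbabilityMeasure P := hW.isGaussianProcess.isProbabilityMeasure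
  have hm : ∀ s, MemLp (W s) 2 P := fun s ↦ (hW.isGaussianProcess.hasGaussianLaw_eval s).memLp_two
  have mW s := hW.aemeasurable s
  apply IsGaussianProcess.indepFun_of_covariance_eq_zero
    (X := fun (p : ℕ × Set.Iic (1 : ℝ≥0)) ω ↦ bridge (fun s ↦ W s ω) h p)
    (Y := fun (k : ℕ) ω ↦ W (k * h) ω)
  · apply hW.isGaussianProcess.of_isGaussianProcess
    classical
    rintro (p | k)
    · exact ⟨({((p.1 : ℝ≥0) + (p.2 : ℝ≥0)) * h, (p.1 : ℝ≥0) * h,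
          ((p.1 : ℝ≥0) + 1) * h} : Finset ℝ≥0),
        { toFun x := x ⟨((p.1 : ℝ≥0) + (p.2 : ℝ≥0)) * h, by simp⟩ -
            (1 - ((p.2 : ℝ≥0) : ℝ)) * x ⟨(p.1 : ℝ≥0) * h, by simp⟩ -
            ((p.2 : ℝ≥0) : ℝ) * x ⟨((p.1 : ℝ≥0) + 1) * h, by simp⟩
          map_add' x y := by simp; ring
          map_smul' c x := by simp; ring }, by simp [bridge]⟩
    · exact ⟨({(k : ℝ≥0) * h} : Finset ℝ≥0),
        { toFun x := x ⟨(k : ℝ≥0) * h, by simp⟩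
          map_add' x y := by simp
          map_smul' c x := by simp }, by simp⟩
  · intro p
    exact ((mW _).sub ((mW _).const_mul _)).sub ((mW _).const_mul _)
  · exact fun k ↦ mW _
  · rintro ⟨j, l, hl⟩ k
    have hl : l ≤ 1 := hl
    simp only [bridge]
    have m1 : ∀ c s, MemLp (fun ω ↦ c * W s ω) 2 P := fun c s ↦ (hm s).const_mul c
    have m2 : ∀ c s s', MemLp (fun ω ↦ W s ω - c * W s' ω) 2 P := fun c s s' ↦
      (hm s).sub (m1 c s')
    rw [covariance_fun_sub_left (m2 _ _ _) (m1 _ _) (hm _),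
      covariance_fun_sub_left (hm _) (m1 _ _) (hm _),
      covariance_const_mul_left, covariance_const_mul_left, hW.covariance_fun_eval,
      hW.covariance_fun_eval, hW.covariance_fun_eval]
    have hlr : (l : ℝ) ≤ 1 := by exact_mod_cast hl
    rcases le_or_gt k j with hkj | hkj
    · have hkj' : (k : ℝ≥0) ≤ j := by exact_mod_cast hkj
      rw [min_eq_right (by gcongr; exact hkj'.trans le_self_add), min_eq_right (by gcongr),
        min_eq_right (by gcongr; exact hkj'.trans le_self_add)]
      ring
    · have hkj' : (j : ℝ≥0) + 1 ≤ k := by exact_mod_cast hkj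
      rw [min_eq_left (by gcongr; exact (add_le_add_right hl _).trans hkj'),
        min_eq_left (by gcongr), min_eq_left (by gcongr)]
      push_cast
      ring

theorem measure_abs_sub_le_pos_of_hasLaw {X : Ω → ℝ} {v : ℝ≥0} (hv : v ≠ 0)
    (hX : HasLaw X (gaussianReal 0 v) P) (c : ℝ) {ε : ℝ} (hε : 0 < ε) :
    0 < P (X ⁻¹' Metric.closedBall c ε) := by
  have h := hX.measure_eq (p := fun x ↦ x ∈ Metric.closedBall c ε) measurableSet_closedBall
  have h2 : gaussianReal 0 v {x | x ∈ Metric.closedBall c ε} ≠ 0 := fun h0 ↦ by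
    have h3 := gaussianReal_absolutelyContinuous' 0 hv h0
    have h4 := Metric.measure_closedBall_pos volume c hε
    exact h4.ne' h3
  rw [← h] at h2
  exact pos_iff_ne_zero.2 h2

/-- The increments over the grid are independent nondegenerate Gaussians. Each is within `ε / (n +
1)` of the increment of `f` with positive probability, and at most `n` such errors accumulate. -/
theorem measure_grid_pos (hW : IsPreBrownianReal W P) {h : ℝ≥0} (hh : 0 < h) (n : ℕ)
    {f : ℝ≥0 → ℝ} (hf : f 0 = 0) {ε : ℝ} (hε : 0 < ε) :
    0 < P {ω | ∀ k ≤ n, |W (k * h) ω - f (k * h)| ≤ ε} := by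
  have hprob : IsProbabilityMeasure P := hW.isGaussianProcess.isProbabilityMeasure
  have hm : Monotone fun i : ℕ ↦ (i : ℝ≥0) * h := fun i j hij ↦
    mul_le_mul_left (by exact_mod_cast hij : (i : ℝ≥0) ≤ j) h
  have hind := hW.hasIndepIncrements.nat hm
  have hδ : 0 < ε / (n + 1) := by positivity
  have hlaw : ∀ i : ℕ, HasLaw (fun ω ↦ W (((i + 1 : ℕ) : ℝ≥0) * h) ω - W ((i : ℝ≥0) * h) ω)
      (gaussianReal 0 h) P := fun i ↦ by
    have h1 := hasLaw_brownian_increment hW (s := ((i : ℝ≥0) * h : ℝ≥0))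
      (t := (((i + 1 : ℕ) : ℝ≥0) * h : ℝ≥0)) (NNReal.coe_nonneg _) (by
        have := hm (Nat.le_succ i)
        exact_mod_cast this)
    rw [Real.toNNReal_coe, Real.toNNReal_coe] at h1
    have e : ((((i + 1 : ℕ) : ℝ≥0) * h : ℝ≥0) : ℝ) - ((i : ℝ≥0) * h : ℝ≥0) = h := by
      push_cast; ring
    rwa [e, Real.toNNReal_coe] at h1
  have hprod := hind.measure_inter_preimage_eq_mul (Finset.range n)
    (sets := fun i ↦ Metric.closedBall (f (((i + 1 : ℕ) : ℝ≥0) * h) - f ((i : ℝ≥0) * h))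
      (ε / (n + 1))) (fun i _ ↦ measurableSet_closedBall)
  have hpos : 0 < P (⋂ i ∈ Finset.range n, (fun ω ↦ W (((i + 1 : ℕ) : ℝ≥0) * h) ω -
      W ((i : ℝ≥0) * h) ω) ⁻¹' Metric.closedBall (f (((i + 1 : ℕ) : ℝ≥0) * h) -
        f ((i : ℝ≥0) * h)) (ε / (n + 1))) := by
    rw [hprod, pos_iff_ne_zero]
    refine Finset.prod_ne_zero_iff.2 fun i _ ↦ ?_
    exact (measure_abs_sub_le_pos_of_hasLaw hh.ne' (hlaw i) _ hδ).ne'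
  have hae : ∀ᵐ ω ∂P, ω ∈ (⋂ i ∈ Finset.range n, (fun ω ↦ W (((i + 1 : ℕ) : ℝ≥0) * h) ω -
      W ((i : ℝ≥0) * h) ω) ⁻¹' Metric.closedBall (f (((i + 1 : ℕ) : ℝ≥0) * h) -
        f ((i : ℝ≥0) * h)) (ε / (n + 1))) →
      ω ∈ {ω | ∀ k ≤ n, |W (k * h) ω - f (k * h)| ≤ ε} := by
    filter_upwards [hW.eval_zero_ae_eq_zero] with ω h0 hω k hk
    simp only [Set.mem_iInter, Finset.mem_range, Set.mem_preimage, Metric.mem_closedBall,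
      Real.dist_eq] at hω
    have key : ∀ k ≤ n, |W (k * h) ω - f (k * h)| ≤ k * (ε / (n + 1)) := by
      intro k
      induction k with
      | zero => intro _; simp [h0, hf]
      | succ k ih =>
        intro hk
        have h1 := abs_le.1 (ih (by omega))
        have h2 := abs_le.1 (hω k (by omega))
        have e : ((k + 1 : ℕ) : ℝ) * (ε / (n + 1)) = k * (ε / (n + 1)) + ε / (n + 1) := by
          push_cast; ring
        rw [e, abs_le]
        constructor <;> linarith
    refine (key k hk).trans ?_
    have hk' : (k : ℝ) ≤ n := by exact_mod_cast hk
    rw [mul_div_assoc', div_le_iff₀ (by positivity)]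
    nlinarith
  exact hpos.trans_le (measure_mono_ae hae)

/-- The law of Brownian motion has full support. -/
theorem measure_brownian_near_pos (hW : IsBrownianReal W P) {T : ℝ≥0} (hT : 0 < T)
    {f : ℝ≥0 → ℝ} (hfc : Continuous f) (hf : f 0 = 0) {ε : ℝ} (hε : 0 < ε) :
    0 < P {ω | ∀ s ≤ T, |W s ω - f s| ≤ ε} := by
  have hprob : IsProbabilityMeasure P := hW.isGaussianProcess.isProbabilityMeasure
  have hε3 : 0 < ε / 3 := by positivity
  set d := TopologicalSpace.denseSeq (Set.Iic (1 : ℝ≥0)) with hd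
  set A : ℕ → Set (ℕ × Set.Iic (1 : ℝ≥0) → ℝ) := fun n ↦
    {x | ∀ j ≤ n, ∀ m, |x (j, d m)| ≤ ε / 3} with hA
  have hAm : ∀ n, MeasurableSet (A n) := fun n ↦ by
    simp only [hA, Set.ofPred_forall]
    exact MeasurableSet.iInter fun j ↦ MeasurableSet.iInter fun _ ↦ MeasurableSet.iInter fun m ↦
      measurableSet_le (measurable_pi_apply _).abs measurable_const
  set X : ℕ → Ω → ℕ × Set.Iic (1 : ℝ≥0) → ℝ := fun n ω p ↦
    bridge (fun s ↦ W s ω) (T / (n + 1)) p with hX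
  obtain ⟨n0, hn0⟩ := eventually_atTop.1 (eventually_abs_bridge_le hfc T hε3)
  -- On a continuous path all bridges are small once the mesh is fine, so these events cannot be
  -- null for all large `n`.
  have hex : ∃ n ≥ n0, 0 < P (X n ⁻¹' A n) := by
    by_contra! hcon
    have h1 : ∀ᵐ ω ∂P, ∀ n ≥ n0, ω ∉ X n ⁻¹' A n := by
      rw [ae_all_iff]
      intro n
      by_cases hn : n ≥ n0
      · have := hcon n hn
        filter_upwards [measure_eq_zero_iff_ae_notMem.1 (nonpos_iff_eq_zero.1 this)] with ω hω _
        exact hω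
      · exact ae_of_all _ fun ω h ↦ absurd h hn
    obtain ⟨ω, hω1, hω2⟩ := (h1.and hW.cont).exists
    obtain ⟨n1, hn1⟩ := eventually_atTop.1 (eventually_abs_bridge_le hω2 T hε3)
    exact hω1 (max n0 n1) (le_max_left _ _)
      fun j hj m ↦ hn1 _ (le_max_right _ _) (j, d m) hj
  obtain ⟨n, hn, hPA⟩ := hex
  set h : ℝ≥0 := T / (n + 1) with hh
  have hhpos : 0 < h := by positivity
  set C : Set (ℕ → ℝ) := {y | ∀ k ≤ n + 1, |y k - f (k * h)| ≤ ε / 3} with hC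
  have hCm : MeasurableSet C := by
    simp only [hC, Set.ofPred_forall]
    exact MeasurableSet.iInter fun j ↦ MeasurableSet.iInter fun _ ↦
      measurableSet_le ((measurable_pi_apply _).sub_const _).abs measurable_const
  have hPC : 0 < P ((fun ω (k : ℕ) ↦ W (k * h) ω) ⁻¹' C) :=
    measure_grid_pos hW.toIsPreBrownianReal hhpos (n + 1) hf hε3
  have hind := (indepFun_bridge hW.toIsPreBrownianReal h).measure_inter_preimage_eq_mul _ _
    (hAm n) hCm
  have hpos : 0 < P (X n ⁻¹' A n ∩ (fun ω (k : ℕ) ↦ W (k * h) ω) ⁻¹' C) := by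
    rw [hX, hind]
    exact ENNReal.mul_pos hPA.ne' hPC.ne'
  refine hpos.trans_le (measure_mono_ae ?_)
  filter_upwards [hW.cont] with ω hc hω s hs
  obtain ⟨⟨j, l⟩, hj, hs'⟩ := exists_eq_add_mul hT hs n
  simp only at hj
  have hb : |bridge (fun s ↦ W s ω) h (j, l)| ≤ ε / 3 := by
    have hcl : IsClosed {l : Set.Iic (1 : ℝ≥0) | |bridge (fun s ↦ W s ω) h (j, l)| ≤ ε / 3} := by
      refine isClosed_le ?_ continuous_const
      unfold bridge
      fun_prop
    exact (TopologicalSpace.denseRange_denseSeq (Set.Iic (1 : ℝ≥0))).induction_on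
      (p := fun l ↦ |bridge (fun s ↦ W s ω) h (j, l)| ≤ ε / 3) l hcl (fun m ↦ hω.1 j hj m)
  have hbf : |bridge f h (j, l)| ≤ ε / 3 := hn0 n hn (j, l) hj
  have h1 : |W (j * h) ω - f (j * h)| ≤ ε / 3 := hω.2 j (by omega)
  have h2 : |W ((j + 1) * h) ω - f ((j + 1) * h)| ≤ ε / 3 := by
    have := hω.2 (j + 1) (by omega)
    push_cast at this
    exact this
  have hl1 : ((l : ℝ≥0) : ℝ) ≤ 1 := by exact_mod_cast l.2
  have hl0 : (0 : ℝ) ≤ (l : ℝ≥0) := NNReal.coe_nonneg _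
  rw [hs']
  simp only [bridge] at hb hbf
  have a1 := abs_le.1 hb
  have a2 := abs_le.1 hbf
  have a3 := abs_le.1 h1
  have a4 := abs_le.1 h2
  set x := W (j * h) ω - f (j * h)
  set y := W ((j + 1) * h) ω - f ((j + 1) * h)
  -- A path is its linear interpolation plus its bridge: the distance to `f` splits into the bridge
  -- of `W`, the bridge of `f` and the interpolated grid errors, each at most `ε / 3`.
  have hxy : |(1 - ((l : ℝ≥0) : ℝ)) * x + (l : ℝ≥0) * y| ≤ ε / 3 := by
    rw [abs_le]
    constructor <;> nlinarith
  have a5 := abs_le.1 hxy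
  have e : (1 - ((l : ℝ≥0) : ℝ)) * x + (l : ℝ≥0) * y =
    ((1 - ((l : ℝ≥0) : ℝ)) * W (j * h) ω + (l : ℝ≥0) * W ((j + 1) * h) ω) -
    ((1 - ((l : ℝ≥0) : ℝ)) * f (j * h) + (l : ℝ≥0) * f ((j + 1) * h)) := by ring
  rw [e] at a5
  rw [abs_le]
  constructor <;> linarith

end BrownianMotion

/-! ### Geometric Brownian motion with an independent perturbation -/

/-- A process with continuous paths stays near some continuous path with positive probability. -/
theorem exists_measure_near_pos {Ω K : Type*} [MeasurableSpace Ω] {P : Measure Ω}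
    [IsProbabilityMeasure P] [TopologicalSpace K] [CompactSpace K]
    [TopologicalSpace.SeparableSpace C(K, ℝ)] {Z : K → Ω → ℝ}
    (hZ : ∀ᵐ ω ∂P, Continuous fun t ↦ Z t ω) {ε : ℝ} (hε : 0 < ε) :
    ∃ b : C(K, ℝ), 0 < P {ω | ∀ t, |Z t ω - b t| ≤ ε} := by
  -- Countably many balls of radius `ε` cover the separable space of continuous functions; they
  -- cannot all be null.
  by_contra! hcon
  have h1 : ∀ᵐ ω ∂P, ∀ k, ω ∉ {ω | ∀ t, |Z t ω -
      TopologicalSpace.denseSeq C(K, ℝ) k t| ≤ ε} := by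
    rw [ae_all_iff]
    intro k
    exact measure_eq_zero_iff_ae_notMem.1 (nonpos_iff_eq_zero.1 (hcon _))
  obtain ⟨ω, hω1, hω2⟩ := (h1.and hZ).exists
  obtain ⟨k, hk⟩ := (TopologicalSpace.denseRange_denseSeq C(K, ℝ)).exists_dist_lt
    ⟨fun t ↦ Z t ω, hω2⟩ hε
  refine hω1 k fun t ↦ ?_
  exact ((ContinuousMap.dist_apply_le_dist t).trans_lt hk).le

/-- Adding a linear function does not affect the vanishing of the quadratic variation. -/
theorem tendsto_sum_linear_add_sq {T : ℝ} (hT : 0 < T) (c ν : ℝ) {b : Set.Icc (0 : ℝ) T → ℝ}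
    (hb : Tendsto (fun n ↦ ∑ i ∈ Finset.range (2 ^ n),
      (b (Set.projIcc 0 T hT.le (T * (i + 1) / 2 ^ n)) -
        b (Set.projIcc 0 T hT.le (T * i / 2 ^ n))) ^ 2) atTop (𝓝 0)) :
    Tendsto (fun n ↦ ∑ i ∈ Finset.range (2 ^ n),
      ((c * (Set.projIcc 0 T hT.le (T * (i + 1) / 2 ^ n) : ℝ) +
          ν * b (Set.projIcc 0 T hT.le (T * (i + 1) / 2 ^ n))) -
        (c * (Set.projIcc 0 T hT.le (T * i / 2 ^ n) : ℝ) +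
          ν * b (Set.projIcc 0 T hT.le (T * i / 2 ^ n)))) ^ 2) atTop (𝓝 0) := by
  have h1 : Tendsto (fun n : ℕ ↦ 2 * (c ^ 2 * T) * (T / 2 ^ n) + 2 * ν ^ 2 *
      ∑ i ∈ Finset.range (2 ^ n), (b (Set.projIcc 0 T hT.le (T * (i + 1) / 2 ^ n)) -
        b (Set.projIcc 0 T hT.le (T * i / 2 ^ n))) ^ 2) atTop (𝓝 0) := by
    simpa using ((tendsto_mesh T).const_mul (2 * (c ^ 2 * T))).add (hb.const_mul (2 * ν ^ 2))
  refine squeeze_zero (fun n ↦ Finset.sum_nonneg fun i _ ↦ sq_nonneg _) (fun n ↦ ?_) h1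
  have h2 : 2 * (c ^ 2 * T) * (T / 2 ^ n) =
      ∑ i ∈ Finset.range (2 ^ n), 2 * (c * (T / 2 ^ n)) ^ 2 := by
    rw [Finset.sum_const, Finset.card_range, nsmul_eq_mul]
    push_cast
    field_simp
  rw [h2, Finset.mul_sum, ← Finset.sum_add_distrib]
  refine Finset.sum_le_sum fun i hi ↦ ?_
  have hi := Finset.mem_range.1 hi
  rw [Set.projIcc_of_mem hT.le (dyadic_succ_mem_Icc hT hi),
    Set.projIcc_of_mem hT.le (dyadic_mem_Icc hT hi.le), ← dyadic_succ_sub T n i]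
  simp only
  set x := b ⟨T * (i + 1) / 2 ^ n, dyadic_succ_mem_Icc hT hi⟩
  set y := b ⟨T * i / 2 ^ n, dyadic_mem_Icc hT hi.le⟩
  nlinarith [sq_nonneg (c * (T * ((i : ℝ) + 1) / 2 ^ n - T * i / 2 ^ n) - ν * (x - y))]

section Perturbation

variable {Ω : Type*} [MeasurableSpace Ω] {P : Measure Ω} {W : ℝ≥0 → Ω → ℝ} {T : ℝ}
  {Z : Set.Icc (0 : ℝ) T → Ω → ℝ}

/-- The logarithm of a geometric Brownian motion that is perturbed by a process of zero quadratic
variation has the quadratic variation of the Brownian part. -/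
theorem ae_hasLogQuadraticVariation (hW : IsPreBrownianReal W P) (hT : 0 < T) {s₀ : ℝ}
    (hs₀ : 0 < s₀) (σ : ℝ)
    (hZ : ∀ᵐ ω ∂P, Tendsto (fun n ↦ ∑ i ∈ Finset.range (2 ^ n),
      (Z (Set.projIcc 0 T hT.le (T * (i + 1) / 2 ^ n)) ω -
        Z (Set.projIcc 0 T hT.le (T * i / 2 ^ n)) ω) ^ 2) atTop (𝓝 0)) :
    ∀ᵐ ω ∂P, HasLogQuadraticVariation T σ (Set.IccExtend hT.le
      fun t ↦ s₀ * Real.exp (σ * W (t : ℝ).toNNReal ω + Z t ω)) := by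
  -- The exceptional sets are united over the countably many dyadic times only; monotonicity of the
  -- masses then covers all times.
  have h1 : ∀ᵐ ω ∂P, ∀ m i : ℕ, i ≤ 2 ^ m →
      Tendsto (fun n ↦ ∑ j ∈ dyadicIndices T n (T * i / 2 ^ m),
        (W (T * (j + 1) / 2 ^ n).toNNReal ω - W (T * j / 2 ^ n).toNNReal ω) ^ 2) atTop
        (𝓝 (T * i / 2 ^ m)) := by
    refine ae_all_iff.2 fun m ↦ ae_all_iff.2 fun i ↦ ?_
    by_cases hi : i ≤ 2 ^ m
    · filter_upwards [ae_tendsto_sum_brownian_increment_sq hW hT (dyadic_mem_Icc hT hi)] with ω h _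
      exact h
    · exact ae_of_all _ fun ω h ↦ absurd h hi
  filter_upwards [h1, hZ] with ω hω hZω t ht
  refine tendsto_sum_of_tendsto_sum_dyadic hT (fun n i ↦ sq_nonneg _) (sq_nonneg σ)
    (fun m i hi ↦ ?_) ht
  refine (tendsto_sum_add_sq (σ := σ) (hω m i hi) hZω).congr fun n ↦
    Finset.sum_congr rfl fun j hj ↦ ?_
  have hj := (mem_dyadicIndices.1 hj).1
  have hlog : ∀ x, Real.log (s₀ * Real.exp x) = Real.log s₀ + x := fun x ↦ by
    rw [Real.log_mul hs₀.ne' (Real.exp_ne_zero _), Real.log_exp]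
  rw [Set.IccExtend_of_mem _ _ (dyadic_succ_mem_Icc hT hj),
    Set.IccExtend_of_mem _ _ (dyadic_mem_Icc hT hj.le), hlog, hlog,
    Set.projIcc_of_mem hT.le (dyadic_succ_mem_Icc hT hj),
    Set.projIcc_of_mem hT.le (dyadic_mem_Icc hT hj.le)]
  ring

/-- A geometric Brownian motion that is perturbed by an independent process with continuous paths
has full support. -/
theorem measure_perturbation_near_pos [IsProbabilityMeasure P] (hW : IsBrownianReal W P)
    (hT : 0 < T) {s₀ σ : ℝ} (hs₀ : 0 < s₀) (hσ : 0 < σ) (hZ : ∀ᵐ ω ∂P, Continuous fun t ↦ Z t ω)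
    (hZ0 : ∀ᵐ ω ∂P, Z ⟨0, Set.left_mem_Icc.2 hT.le⟩ ω = 0)
    (hind : IndepFun (fun ω (t : Set.Icc (0 : ℝ) T) ↦ W (t : ℝ).toNNReal ω) (fun ω t ↦ Z t ω) P)
    {f : Set.Icc (0 : ℝ) T → ℝ} (hf : Continuous f) (hpos : ∀ t, 0 < f t)
    (hf0 : f ⟨0, Set.left_mem_Icc.2 hT.le⟩ = s₀) {δ : ℝ} (hδ : 0 < δ) :
    0 < P {ω | ∀ t : Set.Icc (0 : ℝ) T,
      |s₀ * Real.exp (σ * W (t : ℝ).toNNReal ω + Z t ω) - f t| ≤ δ} := by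
  set o : Set.Icc (0 : ℝ) T := ⟨0, Set.left_mem_Icc.2 hT.le⟩ with ho
  obtain ⟨M, hM⟩ := isCompact_univ.exists_bound_of_continuousOn hf.continuousOn
  have hfM : ∀ t, f t ≤ M := fun t ↦ (le_abs_self _).trans (hM t (Set.mem_univ _))
  have hM0 : 0 < M := (hpos o).trans_le (hfM o)
  set ε := min (1 / (σ + 2)) (δ / (2 * M * (σ + 2))) with hε
  have hε0 : 0 < ε := by positivity
  have hε1 : (σ + 2) * ε ≤ 1 := by
    have := min_le_left (1 / (σ + 2)) (δ / (2 * M * (σ + 2)))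
    rw [← hε, le_div_iff₀ (by positivity)] at this
    linarith
  have hε2 : M * (2 * ((σ + 2) * ε)) ≤ δ := by
    have := min_le_right (1 / (σ + 2)) (δ / (2 * M * (σ + 2)))
    rw [← hε, le_div_iff₀ (by positivity)] at this
    linarith
  obtain ⟨b, hb⟩ := exists_measure_near_pos hZ hε0
  set g : Set.Icc (0 : ℝ) T → ℝ := fun t ↦ (Real.log (f t / s₀) - (b t - b o)) / σ with hg
  have hgc : Continuous g := by
    refine Continuous.div_const (Continuous.sub (Continuous.log (by fun_prop) fun t ↦ ?_)
      (by fun_prop)) _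
    exact (div_pos (hpos t) hs₀).ne'
  have hg0 : g o = 0 := by
    simp only [hg]
    rw [hf0, div_self hs₀.ne']; simp
  have hWg : 0 < P {ω | ∀ s ≤ T.toNNReal, |W s ω - g (Set.projIcc 0 T hT.le s)| ≤ ε} := by
    refine measure_brownian_near_pos hW (Real.toNNReal_pos.2 hT)
      (f := fun s ↦ g (Set.projIcc 0 T hT.le s))
      (hgc.comp (continuous_projIcc.comp (by fun_prop))) ?_ hε0
    simp only [NNReal.coe_zero]
    rw [Set.projIcc_left]
    exact hg0
  have hne : Nonempty (Set.Icc (0 : ℝ) T) := ⟨o⟩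
  set d := TopologicalSpace.denseSeq (Set.Icc (0 : ℝ) T) with hd
  have hdense : DenseRange d := TopologicalSpace.denseRange_denseSeq _
  have hms : ∀ c : Set.Icc (0 : ℝ) T → ℝ,
      MeasurableSet {x : Set.Icc (0 : ℝ) T → ℝ | ∀ k, |x (d k) - c (d k)| ≤ ε} := fun c ↦ by
    rw [Set.ofPred_forall]
    exact MeasurableSet.iInter fun k ↦
      measurableSet_le ((measurable_pi_apply _).sub_const _).abs measurable_const
  have hprod := hind.measure_inter_preimage_eq_mul _ _ (hms g) (hms b)
  have hp1 : 0 < P ((fun ω (t : Set.Icc (0 : ℝ) T) ↦ W (t : ℝ).toNNReal ω) ⁻¹'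
      {x | ∀ k, |x (d k) - g (d k)| ≤ ε}) := by
    refine hWg.trans_le (measure_mono fun ω hω k ↦ ?_)
    have := hω (d k : ℝ).toNNReal (Real.toNNReal_le_toNNReal (d k).2.2)
    rwa [Real.coe_toNNReal _ (d k).2.1, Set.projIcc_val] at this
  have hp2 : 0 < P ((fun ω t ↦ Z t ω) ⁻¹' {x | ∀ k, |x (d k) - b (d k)| ≤ ε}) :=
    hb.trans_le (measure_mono fun ω hω k ↦ hω (d k))
  have hp : 0 < P ((fun ω (t : Set.Icc (0 : ℝ) T) ↦ W (t : ℝ).toNNReal ω) ⁻¹'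
      {x | ∀ k, |x (d k) - g (d k)| ≤ ε} ∩
      (fun ω t ↦ Z t ω) ⁻¹' {x | ∀ k, |x (d k) - b (d k)| ≤ ε}) := by
    rw [hprod]; exact ENNReal.mul_pos hp1.ne' hp2.ne'
  refine hp.trans_le (measure_mono_ae ?_)
  filter_upwards [hW.cont, hZ, hZ0] with ω hWc hZc hz0 hω t
  have hW' : Continuous fun t : Set.Icc (0 : ℝ) T ↦ W (t : ℝ).toNNReal ω :=
    hWc.comp (by fun_prop)
  have c1 : ∀ t : Set.Icc (0 : ℝ) T, |W (t : ℝ).toNNReal ω - g t| ≤ ε := fun t ↦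
    hdense.induction_on (p := fun t : Set.Icc (0 : ℝ) T ↦ |W (t : ℝ).toNNReal ω - g t| ≤ ε) t
      (isClosed_le (by fun_prop) continuous_const) hω.1
  have c2 : ∀ t : Set.Icc (0 : ℝ) T, |Z t ω - b t| ≤ ε := fun t ↦
    hdense.induction_on (p := fun t : Set.Icc (0 : ℝ) T ↦ |Z t ω - b t| ≤ ε) t
      (isClosed_le (by fun_prop) continuous_const) hω.2
  have hb0 := c2 o
  rw [hz0] at hb0
  set x := σ * W (t : ℝ).toNNReal ω + Z t ω - Real.log (f t / s₀) with hx
  have hxe : x = σ * (W (t : ℝ).toNNReal ω - g t) + (Z t ω - b t) - (0 - b o) := by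
    simp only [hx, hg]
    field_simp
    ring
  have hxa : |x| ≤ (σ + 2) * ε := by
    have h1 := abs_le.1 (c1 t)
    have h2 := abs_le.1 (c2 t)
    have h3 := abs_le.1 hb0
    rw [hxe, abs_le]
    constructor <;> nlinarith
  have e : s₀ * Real.exp (σ * W (t : ℝ).toNNReal ω + Z t ω) - f t = f t * (Real.exp x - 1) := by
    rw [show σ * W (t : ℝ).toNNReal ω + Z t ω = x + Real.log (f t / s₀) by rw [hx]; ring,
      Real.exp_add, Real.exp_log (div_pos (hpos t) hs₀)]
    field_simp
  change |_ - _| ≤ δ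
  rw [e, abs_mul, abs_of_pos (hpos t)]
  calc f t * |Real.exp x - 1| ≤ M * (2 * ((σ + 2) * ε)) := by
        refine mul_le_mul (hfM t) ?_ (abs_nonneg _) hM0.le
        exact (Real.abs_exp_sub_one_le (hxa.trans hε1)).trans (by linarith)
    _ ≤ δ := hε2

/-- At a positive time, a perturbed geometric Brownian motion does not charge points. -/
theorem ae_perturbation_ne [IsProbabilityMeasure P] (hW : IsPreBrownianReal W P) {s₀ σ : ℝ}
    (hs₀ : 0 < s₀) (hσ : 0 < σ)
    (hZm : ∀ t, AEMeasurable (Z t) P)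
    (hind : IndepFun (fun ω (t : Set.Icc (0 : ℝ) T) ↦ W (t : ℝ).toNNReal ω) (fun ω t ↦ Z t ω) P)
    {t : Set.Icc (0 : ℝ) T} (ht : 0 < (t : ℝ)) :
    ∀ᵐ ω ∂P, s₀ * Real.exp (σ * W (t : ℝ).toNNReal ω + Z t ω) ≠ s₀ := by
  have hind' : IndepFun (fun ω ↦ W (t : ℝ).toNNReal ω) (fun ω ↦ Z t ω) P :=
    hind.comp (measurable_pi_apply t) (measurable_pi_apply t)
  have hWm : AEMeasurable (fun ω ↦ W (t : ℝ).toNNReal ω) P := hW.aemeasurable _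
  have hmap := (indepFun_iff_map_prod_eq_prod_map_map (hZm t) hWm).1 hind'.symm
  have hlaw := (hW.hasLaw_eval (t : ℝ).toNNReal).map_eq
  have hatoms := nullSingletonClass_gaussianReal (μ := 0) (Real.toNNReal_pos.2 ht).ne'
  have hms : MeasurableSet {p : ℝ × ℝ | σ * p.2 + p.1 ≠ 0} :=
    (measurableSet_eq_fun (by fun_prop) measurable_const).compl
  have key : ∀ᵐ p ∂((P.map fun ω ↦ Z t ω).prod (P.map fun ω ↦ W (t : ℝ).toNNReal ω)),
      σ * p.2 + p.1 ≠ 0 := by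
    -- Given the value `z` of the perturbation, a single value of `W` leads to `s₀`, and the
    -- Gaussian law has no atoms.
    rw [hlaw, Measure.ae_prod_iff_ae_ae hms]
    refine ae_of_all _ fun z ↦ ?_
    filter_upwards [(measure_eq_zero_iff_ae_notMem.1 (measure_singleton (-z / σ)) :
      ∀ᵐ w ∂(gaussianReal 0 (t : ℝ).toNNReal), _)] with w hw h
    refine hw ?_
    rw [Set.mem_singleton_iff, eq_div_iff hσ.ne']
    linarith
  rw [← hmap, ae_map_iff ((hZm t).prodMk hWm) hms] at key
  filter_upwards [key] with ω hω h
  apply hω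
  have : Real.exp (σ * W (t : ℝ).toNNReal ω + Z t ω) = 1 := by
    have h' := mul_left_cancel₀ hs₀.ne' (h.trans (mul_one s₀).symm)
    exact h'
  simpa using this

end Perturbation

/-! ### Transfer to the mixed model -/

/-- Having a log-price of quadratic variation `σ² t` is a measurable property of the path. -/
theorem measurableSet_hasLogQuadraticVariation {T : ℝ} (hT : 0 < T) (σ : ℝ) :
    MeasurableSet {x : Set.Icc (0 : ℝ) T → ℝ |
      HasLogQuadraticVariation T σ (Set.IccExtend hT.le x)} := by
  have h : {x : Set.Icc (0 : ℝ) T → ℝ | HasLogQuadraticVariation T σ (Set.IccExtend hT.le x)} =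
      ⋂ m : ℕ, ⋂ i : ℕ, ⋂ _ : i ≤ 2 ^ m, {x | Tendsto (fun n ↦
        ∑ j ∈ dyadicIndices T n (T * i / 2 ^ m),
          (Real.log (Set.IccExtend hT.le x (T * (j + 1) / 2 ^ n)) -
            Real.log (Set.IccExtend hT.le x (T * j / 2 ^ n))) ^ 2) atTop
        (𝓝 (σ ^ 2 * (T * i / 2 ^ m)))} := by
    ext x
    simp only [Set.mem_iInter, Set.mem_ofPred_eq]
    exact ⟨fun h m i hi ↦ h _ (dyadic_mem_Icc hT hi), fun h t ht ↦
      tendsto_sum_of_tendsto_sum_dyadic hT (fun n i ↦ sq_nonneg _) (sq_nonneg σ) h ht⟩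
  rw [h]
  refine MeasurableSet.iInter fun m ↦ MeasurableSet.iInter fun i ↦ MeasurableSet.iInter fun _ ↦
    measurableSet_tendsto _ fun n ↦ Finset.measurable_fun_sum _ fun j _ ↦ ?_
  have hm : ∀ s, Measurable fun x : Set.Icc (0 : ℝ) T → ℝ ↦ Set.IccExtend hT.le x s :=
    fun s ↦ measurable_pi_apply _
  exact ((hm _).log.sub (hm _).log).pow_const 2

/-- A positive continuous function on `[0, T]` is bounded away from zero and infinity. -/
theorem exists_forall_iccExtend_mem_Icc {T : ℝ} (hT : 0 < T) {x : Set.Icc (0 : ℝ) T → ℝ}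
    (hx : Continuous x) (hpos : ∀ t, 0 < x t) :
    ∃ r R, 0 < r ∧ ∀ s, Set.IccExtend hT.le x s ∈ Set.Icc r R := by
  have hne : (Set.univ : Set (Set.Icc (0 : ℝ) T)).Nonempty :=
    ⟨⟨0, Set.left_mem_Icc.2 hT.le⟩, trivial⟩
  obtain ⟨a, -, ha⟩ := isCompact_univ.exists_isMinOn hne hx.continuousOn
  obtain ⟨b, -, hb⟩ := isCompact_univ.exists_isMaxOn hne hx.continuousOn
  exact ⟨x a, x b, hpos a, fun s ↦ ⟨ha (Set.mem_univ _), hb (Set.mem_univ _)⟩⟩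

namespace IsMixedFractionalBlackScholes

variable {Ω : Type*} [MeasurableSpace Ω] {P : Measure Ω} {T H s₀ μ σ ν : ℝ} {S : ℝ → Ω → ℝ}

theorem continuous_path (hS : IsMixedFractionalBlackScholes P T H s₀ μ σ ν S) (ω : Ω) :
    Continuous fun t : Set.Icc (0 : ℝ) T ↦ S t ω :=
  continuousOn_iff_continuous_domRestrict.1 (hS.cont ω)

/-- The price is distributed as a geometric Brownian motion with an independent perturbation of
zero quadratic variation. -/
theorem exists_perturbation (hS : IsMixedFractionalBlackScholes P T H s₀ μ σ ν S) (hT : 0 < T)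
    (hH : 1 / 2 < H) : ∃ (Ω' : Type) (_ : MeasurableSpace Ω') (P' : Measure Ω')
      (_ : IsProbabilityMeasure P') (W : ℝ≥0 → Ω' → ℝ) (Z : Set.Icc (0 : ℝ) T → Ω' → ℝ),
      IsBrownianReal W P' ∧ (∀ᵐ ω ∂P', Continuous fun t ↦ Z t ω) ∧
      (∀ᵐ ω ∂P', Z ⟨0, Set.left_mem_Icc.2 hT.le⟩ ω = 0) ∧ (∀ t, AEMeasurable (Z t) P') ∧
      (∀ᵐ ω ∂P', Tendsto (fun n ↦ ∑ i ∈ Finset.range (2 ^ n),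
        (Z (Set.projIcc 0 T hT.le (T * (i + 1) / 2 ^ n)) ω -
          Z (Set.projIcc 0 T hT.le (T * i / 2 ^ n)) ω) ^ 2) atTop (𝓝 0)) ∧
      IndepFun (fun ω (t : Set.Icc (0 : ℝ) T) ↦ W (t : ℝ).toNNReal ω) (fun ω t ↦ Z t ω) P' ∧
      IdentDistrib (fun ω (t : Set.Icc (0 : ℝ) T) ↦
        s₀ * Real.exp (σ * W (t : ℝ).toNNReal ω + Z t ω))
        (fun ω (t : Set.Icc (0 : ℝ) T) ↦ S t ω) P' P := by
  obtain ⟨Ω', mΩ', P', hP', W, B, hW, hB, hind, hid⟩ := hS.law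
  -- The whole drift joins the fractional part: both have zero quadratic variation and are
  -- independent of `W`.
  refine ⟨Ω', mΩ', P', hP', W, fun t ω ↦ (μ - σ ^ 2 / 2) * t + ν * B t ω, hW,
    ?_, ?_, ?_, ?_, ?_, ?_⟩
  · filter_upwards [hB.cont] with ω h
    fun_prop
  · filter_upwards [hB.start ⟨0, Set.left_mem_Icc.2 hT.le⟩ rfl] with ω h
    simp [h]
  · intro t
    exact ((hB.gaussian.aemeasurable t).const_mul ν).const_add _
  · filter_upwards [ae_tendsto_sum_fractional_increment_sq hT hH hB] with ω h
    exact tendsto_sum_linear_add_sq hT (μ - σ ^ 2 / 2) ν (b := fun t ↦ B t ω) h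
  · have := hind.comp (φ := id) (ψ := fun (x : Set.Icc (0 : ℝ) T → ℝ) (t : Set.Icc (0 : ℝ) T) ↦
      (μ - σ ^ 2 / 2) * (t : ℝ) + ν * x t) measurable_id (by fun_prop)
    exact this
  · have e : (fun ω (t : Set.Icc (0 : ℝ) T) ↦
        s₀ * Real.exp (σ * W (t : ℝ).toNNReal ω + ((μ - σ ^ 2 / 2) * (t : ℝ) + ν * B t ω))) =
      (fun ω (t : Set.Icc (0 : ℝ) T) ↦
        s₀ * Real.exp (μ * t + σ * W (t : ℝ).toNNReal ω - σ ^ 2 * t / 2 + ν * B t ω)) := by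
      funext ω t
      congr 2
      ring
    rw [e]
    exact hid.symm

theorem ae_hasLogQuadraticVariation (hS : IsMixedFractionalBlackScholes P T H s₀ μ σ ν S)
    (hT : 0 < T) (hH : 1 / 2 < H) (hs₀ : 0 < s₀) :
    ∀ᵐ ω ∂P, HasLogQuadraticVariation T σ (Set.IccExtend hT.le fun t ↦ S t ω) := by
  obtain ⟨Ω', mΩ', P', hP', W, Z, hW, -, -, -, hZ, -, hid⟩ := hS.exists_perturbation hT hH
  exact hid.ae_snd (measurableSet_hasLogQuadraticVariation hT σ)
    (MixedFBS.ae_hasLogQuadraticVariation hW.toIsPreBrownianReal hT hs₀ σ hZ)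

theorem ae_ne_start (hS : IsMixedFractionalBlackScholes P T H s₀ μ σ ν S)
    (hT : 0 < T) (hH : 1 / 2 < H) (hs₀ : 0 < s₀) (hσ : 0 < σ) : ∀ᵐ ω ∂P, S T ω ≠ s₀ := by
  obtain ⟨Ω', mΩ', P', hP', W, Z, hW, -, -, hZm, -, hind, hid⟩ := hS.exists_perturbation hT hH
  set e : Set.Icc (0 : ℝ) T := ⟨T, Set.right_mem_Icc.2 hT.le⟩
  exact hid.ae_snd (p := fun x ↦ x e ≠ s₀)
    (measurableSet_eq_fun (measurable_pi_apply e) measurable_const).compl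
    (ae_perturbation_ne hW.toIsPreBrownianReal hs₀ hσ hZm hind (t := e) hT)

/-- The price has full support. -/
theorem measure_near_pos (hS : IsMixedFractionalBlackScholes P T H s₀ μ σ ν S)
    (hT : 0 < T) (hH : 1 / 2 < H) (hs₀ : 0 < s₀) (hσ : 0 < σ)
    {f : Set.Icc (0 : ℝ) T → ℝ} (hf : Continuous f) (hpos : ∀ t, 0 < f t)
    (hf0 : f ⟨0, Set.left_mem_Icc.2 hT.le⟩ = s₀) {δ : ℝ} (hδ : 0 < δ) :
    0 < P {ω | ∀ t : Set.Icc (0 : ℝ) T, |S t ω - f t| ≤ δ} := by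
  obtain ⟨Ω', mΩ', P', hP', W, Z, hW, hZ, hZ0, -, -, hind, hid⟩ := hS.exists_perturbation hT hH
  have hne : Nonempty (Set.Icc (0 : ℝ) T) := ⟨⟨0, Set.left_mem_Icc.2 hT.le⟩⟩
  set d := TopologicalSpace.denseSeq (Set.Icc (0 : ℝ) T) with hd
  -- Equality in law is on the product space, whose events see countably many times only. A dense
  -- sequence of times suffices, since the paths are continuous.
  have hms : MeasurableSet {x : Set.Icc (0 : ℝ) T → ℝ | ∀ k, |x (d k) - f (d k)| ≤ δ} := by
    rw [Set.ofPred_forall]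
    exact MeasurableSet.iInter fun k ↦
      measurableSet_le ((measurable_pi_apply _).sub_const _).abs measurable_const
  have h1 := measure_perturbation_near_pos hW hT hs₀ hσ hZ hZ0 hind hf hpos hf0 hδ
  have h2 : 0 < P' ((fun ω (t : Set.Icc (0 : ℝ) T) ↦
      s₀ * Real.exp (σ * W (t : ℝ).toNNReal ω + Z t ω)) ⁻¹' {x | ∀ k, |x (d k) - f (d k)| ≤ δ}) :=
    h1.trans_le (measure_mono fun ω hω k ↦ hω (d k))
  rw [hid.measure_mem_eq hms] at h2
  refine h2.trans_le (measure_mono fun ω hω t ↦ ?_)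
  have hc := hS.continuous_path ω
  exact (TopologicalSpace.denseRange_denseSeq (Set.Icc (0 : ℝ) T)).induction_on
    (p := fun t : Set.Icc (0 : ℝ) T ↦ |S t ω - f t| ≤ δ) t
    (isClosed_le (hc.sub hf).abs continuous_const) hω

end IsMixedFractionalBlackScholes

/-! ### Measurability of the state and continuous modifications -/

section Measurability

/-- A continuous path stays in a closed set throughout `[0, t]` if it does so at the points of a
certain sequence. -/
theorem exists_seq_forall_mem_Icc_iff {t : ℝ} (ht : 0 ≤ t) : ∃ d : ℕ → ℝ,
    (∀ k, d k ∈ Set.Icc 0 t) ∧ ∀ η : ℝ → ℝ, Continuous η → ∀ C : Set ℝ, IsClosed C →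
      ((∀ u ∈ Set.Icc 0 t, η u ∈ C) ↔ ∀ k, η (d k) ∈ C) := by
  have hne : Nonempty (Set.Icc (0 : ℝ) t) := ⟨⟨0, Set.left_mem_Icc.2 ht⟩⟩
  refine ⟨fun k ↦ TopologicalSpace.denseSeq (Set.Icc (0 : ℝ) t) k, fun k ↦ Subtype.coe_prop _,
    fun η hη C hC ↦ ⟨fun h k ↦ h _ (Subtype.coe_prop _), fun h u hu ↦ ?_⟩⟩
  exact (TopologicalSpace.denseRange_denseSeq (Set.Icc (0 : ℝ) t)).induction_on
    (p := fun u : Set.Icc (0 : ℝ) t ↦ η u ∈ C) ⟨u, hu⟩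
    (hC.preimage (hη.comp continuous_subtype_val)) h

variable {Ω : Type*} {m : MeasurableSpace Ω} {X : ℝ → Ω → ℝ} {t : ℝ}

theorem measurableSet_forall_mem_Icc (hc : ∀ ω, Continuous fun u ↦ X u ω) (ht : 0 ≤ t)
    (hX : ∀ u ∈ Set.Icc 0 t, Measurable (X u)) {C : Set ℝ} (hC : IsClosed C) :
    MeasurableSet {ω | ∀ u ∈ Set.Icc 0 t, X u ω ∈ C} := by
  obtain ⟨d, hd, h⟩ := exists_seq_forall_mem_Icc_iff ht
  have e : {ω | ∀ u ∈ Set.Icc 0 t, X u ω ∈ C} = ⋂ k, X (d k) ⁻¹' C := by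
    ext ω
    rw [Set.mem_iInter]
    exact h _ (hc ω) C hC
  rw [e]
  exact MeasurableSet.iInter fun k ↦ hX _ (hd k) hC.measurableSet

/-- The state of a process with continuous paths at time `t` is measurable with respect to the
process up to time `t`. -/
theorem measurable_pathState (hc : ∀ ω, Continuous fun u ↦ X u ω) (ht : 0 ≤ t)
    (hX : ∀ u ∈ Set.Icc 0 t, Measurable (X u)) :
    Measurable fun ω ↦ pathState (fun u ↦ X u ω) t (X t ω) := by
  have h1 : Measurable fun ω ↦ sSup ((fun u ↦ X u ω) '' Set.Icc 0 t) := by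
    refine measurable_of_Iic fun c ↦ ?_
    convert! measurableSet_forall_mem_Icc hc ht hX (isClosed_Iic (a := c)) using 1
    ext ω
    simp only [Set.mem_preimage, Set.mem_Iic, Set.mem_ofPred_eq]
    rw [csSup_le_iff (bddAbove_image_Icc (hc ω) t) (nonempty_image_Icc _ ht), Set.forall_mem_image]
  have h2 : Measurable fun ω ↦ sInf ((fun u ↦ X u ω) '' Set.Icc 0 t) := by
    refine measurable_of_Ici fun c ↦ ?_
    convert! measurableSet_forall_mem_Icc hc ht hX (isClosed_Ici (a := c)) using 1
    ext ω
    simp only [Set.mem_preimage, Set.mem_Ici, Set.mem_ofPred_eq]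
    rw [le_csInf_iff (bddBelow_image_Icc (hc ω) t) (nonempty_image_Icc _ ht), Set.forall_mem_image]
  have h3 : Measurable fun ω ↦ ∫ u in (0 : ℝ)..t, X u ω := by
    have hY : Measurable (Function.uncurry fun (u : ℝ) ω ↦ X (Set.projIcc 0 t ht u) ω) :=
      measurable_uncurry_of_continuous_of_measurable
        (fun ω ↦ (hc ω).comp (continuous_subtype_val.comp continuous_projIcc))
        fun u ↦ hX _ (Subtype.coe_prop _)
    have hI := (hY.stronglyMeasurable.integral_prod_left'
      (μ := volume.restrict (Set.Ioc 0 t))).measurable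
    convert hI using 1
    funext ω
    rw [intervalIntegral.integral_of_le ht]
    refine setIntegral_congr_fun measurableSet_Ioc fun u hu ↦ ?_
    simp only [Function.uncurry]
    rw [Set.projIcc_of_mem ht ⟨hu.1.le, hu.2⟩]
  exact measurable_const.prodMk (h1.prodMk (h2.prodMk (h3.prodMk (hX t ⟨ht, le_rfl⟩))))

end Measurability

/-- A process with almost surely continuous paths has a measurable modification all of whose paths
are continuous. -/
theorem exists_continuous_modification {Ω : Type*} [MeasurableSpace Ω] {P : Measure Ω}
    {W : ℝ≥0 → Ω → ℝ} (hW : ∀ s, AEMeasurable (W s) P) (hc : ∀ᵐ ω ∂P, Continuous fun s ↦ W s ω) :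
    ∃ W' : ℝ≥0 → Ω → ℝ, (∀ s, Measurable (W' s)) ∧ (∀ ω, Continuous fun s ↦ W' s ω) ∧
      ∀ᵐ ω ∂P, ∀ s, W' s ω = W s ω := by
  set d := TopologicalSpace.denseSeq ℝ≥0 with hd
  have hG : ∀ᵐ ω ∂P, (∀ k, W (d k) ω = (hW (d k)).mk _ ω) ∧ Continuous fun s ↦ W s ω :=
    (ae_all_iff.2 fun k ↦ (hW (d k)).ae_eq_mk).and hc
  obtain ⟨G, hGsub, hGm, hG0⟩ := exists_measurable_superset_of_null hG
  have hmem : ∀ ω ∈ Gᶜ, (∀ k, W (d k) ω = (hW (d k)).mk _ ω) ∧ Continuous fun s ↦ W s ω :=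
    fun ω hω ↦ by
      by_contra hcon
      exact hω (hGsub hcon)
  refine ⟨fun s ↦ Gᶜ.indicator (W s), fun s ↦ ?_, fun ω ↦ ?_, ?_⟩
  · have hs : s ∈ closure (Set.range d) := TopologicalSpace.denseRange_denseSeq _ s
    obtain ⟨x, hx, hxs⟩ := mem_closure_iff_seq_limit.1 hs
    choose k hk using hx
    refine measurable_of_tendsto_metrizable
      (f := fun n ↦ Gᶜ.indicator ((hW (d (k n))).mk _)) (fun n ↦
        (hW (d (k n))).measurable_mk.indicator hGm.compl) (tendsto_pi_nhds.2 fun ω ↦ ?_)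
    by_cases hω : ω ∈ Gᶜ
    · simp only [Set.indicator_of_mem hω]
      have h1 := ((hmem ω hω).2.tendsto s).comp hxs
      refine h1.congr fun n ↦ ?_
      rw [Function.comp_apply, ← hk n]
      exact (hmem ω hω).1 _
    · simp only [Set.indicator_of_notMem hω]
      exact tendsto_const_nhds
  · by_cases hω : ω ∈ Gᶜ
    · simp only [Set.indicator_of_mem hω]
      exact (hmem ω hω).2
    · simp only [Set.indicator_of_notMem hω]
      exact continuous_const
  · filter_upwards [measure_eq_zero_iff_ae_notMem.1 hG0] with ω hω s
    exact Set.indicator_of_mem (show ω ∈ Gᶜ from hω) _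

/-! ### Martingale transforms and stopped gains under geometric Brownian motion -/

/-- A martingale transform with bounded coefficients is centered, with a bound on its second
moment. -/
theorem integral_martingaleTransform {Ω : Type*} [m : MeasurableSpace Ω] {P : Measure Ω}
    [IsProbabilityMeasure P] {F : ℕ → MeasurableSpace Ω} (hF : ∀ i, F i ≤ m) (hmono : Monotone F)
    {Z ξ : ℕ → Ω → ℝ} (hZ : ∀ i, Measurable[F i] (Z i)) {M : ℝ} (hM : ∀ i ω, |Z i ω| ≤ M)
    (hξ : ∀ i, Measurable[F (i + 1)] (ξ i))
    (hind : ∀ i, Indep (F i) (MeasurableSpace.comap (ξ i) inferInstance) P)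
    (hξ2 : ∀ i, MemLp (ξ i) 2 P) (hξ0 : ∀ i, ∫ ω, ξ i ω ∂P = 0) {q : ℝ}
    (hq : ∀ i, ∫ ω, ξ i ω ^ 2 ∂P ≤ q) (N : ℕ) :
    MemLp (fun ω ↦ ∑ i ∈ Finset.range N, Z i ω * ξ i ω) 2 P ∧
    ∫ ω, ∑ i ∈ Finset.range N, Z i ω * ξ i ω ∂P = 0 ∧
    ∫ ω, (∑ i ∈ Finset.range N, Z i ω * ξ i ω) ^ 2 ∂P ≤ N * (M ^ 2 * q) := by
  have hindY : ∀ i (Y : Ω → ℝ), Measurable[F i] Y → IndepFun Y (ξ i) P := fun i Y hY ↦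
    (IndepFun_iff_Indep _ _ _).2 (indep_of_indep_of_le_left (hind i) hY.comap_le)
  have hZm : ∀ i, Measurable (Z i) := fun i ↦ (hZ i).mono (hF i) le_rfl
  have hZξ : ∀ i, MemLp (fun ω ↦ Z i ω * ξ i ω) 2 P := fun i ↦ by
    refine ((hξ2 i).const_mul M).of_le (((hZm i).aestronglyMeasurable).mul (hξ2 i).1)
      (ae_of_all _ fun ω ↦ ?_)
    simp only [norm_mul, Real.norm_eq_abs]
    exact mul_le_mul_of_nonneg_right ((hM i ω).trans (le_abs_self M)) (abs_nonneg _)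
  have hD : ∀ N, MemLp (fun ω ↦ ∑ i ∈ Finset.range N, Z i ω * ξ i ω) 2 P := fun N ↦
    memLp_finsetSum _ fun i _ ↦ hZξ i
  have hDF : ∀ N, Measurable[F N] fun ω ↦ ∑ i ∈ Finset.range N, Z i ω * ξ i ω := fun N ↦
    Finset.measurable_fun_sum (m := F N) _ fun i hi ↦
      ((hZ i).mono (hmono (Finset.mem_range.1 hi).le) le_rfl).mul
        ((hξ i).mono (hmono (Finset.mem_range.1 hi)) le_rfl)
  have hmul : ∀ i (Y : Ω → ℝ), Measurable[F i] Y → Integrable Y P →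
      ∫ ω, Y ω * ξ i ω ∂P = 0 := fun i Y hY hYi ↦ by
    have := (hindY i Y hY).integral_mul_eq_mul_integral hYi.1 (hξ2 i).1
    rw [hξ0, mul_zero] at this
    exact this
  refine ⟨hD N, ?_, ?_⟩
  · rw [integral_finsetSum _ fun i _ ↦ (hZξ i).integrable (by norm_num)]
    exact Finset.sum_eq_zero fun i _ ↦ hmul i _ (hZ i)
      ((memLp_of_bounded (a := -M) (b := M) (ae_of_all _ fun ω ↦ abs_le.1 (hM i ω))
        (hZm i).aestronglyMeasurable 1).integrable le_rfl)
  · induction N with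
    | zero => simp
    | succ N ih =>
      set D : Ω → ℝ := fun ω ↦ ∑ i ∈ Finset.range N, Z i ω * ξ i ω with hDdef
      -- `D * Z N` is known at time `N`, hence independent of the centered `ξ N`: the cross term has
      -- mean zero and the second moments add up.
      have e : ∀ ω, (∑ i ∈ Finset.range (N + 1), Z i ω * ξ i ω) ^ 2 =
          D ω ^ 2 + 2 * (D ω * Z N ω * ξ N ω) + (Z N ω * ξ N ω) ^ 2 := fun ω ↦ by
        rw [Finset.sum_range_succ]; ring
      have hDZ : Integrable (fun ω ↦ D ω * Z N ω) P := by
        refine (((hD N).integrable (by norm_num)).const_mul M).mono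
          ((hD N).1.mul (hZm N).aestronglyMeasurable) (ae_of_all _ fun ω ↦ ?_)
        simp only [norm_mul, Real.norm_eq_abs]
        rw [mul_comm]
        exact mul_le_mul_of_nonneg_right ((hM N ω).trans (le_abs_self M)) (abs_nonneg _)
      have i1 : Integrable (fun ω ↦ D ω ^ 2) P := (hD N).integrable_sq
      have i2 : Integrable (fun ω ↦ 2 * (D ω * Z N ω * ξ N ω)) P :=
        ((hindY N _ ((hDF N).mul (hZ N))).integrable_mul hDZ
          ((hξ2 N).integrable (by norm_num))).const_mul 2
      have i3 : Integrable (fun ω ↦ (Z N ω * ξ N ω) ^ 2) P := (hZξ N).integrable_sq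
      have h3 : ∫ ω, (Z N ω * ξ N ω) ^ 2 ∂P ≤ M ^ 2 * q := by
        calc _ ≤ ∫ ω, M ^ 2 * ξ N ω ^ 2 ∂P := by
              refine integral_mono i3 ((hξ2 N).integrable_sq.const_mul _) fun ω ↦ ?_
              simp only [mul_pow]
              gcongr ?_ * _
              exact sq_le_sq' (abs_le.1 (hM N ω)).1 (abs_le.1 (hM N ω)).2
          _ ≤ M ^ 2 * q := by
              rw [integral_const_mul]
              gcongr
              exact hq N
      simp only [e]
      rw [integral_add (f := fun ω ↦ D ω ^ 2 + 2 * (D ω * Z N ω * ξ N ω))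
          (i1.add i2) i3, integral_add i1 i2, integral_const_mul,
        hmul N (fun ω ↦ D ω * Z N ω) ((hDF N).mul (hZ N)) hDZ]
      push_cast
      linarith

section ExponentialMoments

variable {Ω : Type*} [MeasurableSpace Ω] {P : Measure Ω} {Y : Ω → ℝ} {v : ℝ≥0}

theorem integrable_exp_mul_of_hasLaw (hY : HasLaw Y (gaussianReal 0 v) P) (c : ℝ) :
    Integrable (fun ω ↦ Real.exp (c * Y ω)) P := by
  have h := integrable_exp_mul_gaussianReal (μ := 0) (v := v) c
  rw [← hY.map_eq] at h
  exact h.comp_aemeasurable hY.aemeasurable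

theorem integral_exp_mul_of_hasLaw (hY : HasLaw Y (gaussianReal 0 v) P) (c : ℝ) :
    ∫ ω, Real.exp (c * Y ω) ∂P = Real.exp (v * c ^ 2 / 2) := by
  have h := mgf_gaussianReal hY.map_eq c
  rw [zero_mul, zero_add] at h
  exact h

variable [IsProbabilityMeasure P]

theorem integral_stochasticExp_sub_one (hY : HasLaw Y (gaussianReal 0 v) P) (c : ℝ) :
    ∫ ω, (Real.exp (c * Y ω - c ^ 2 * v / 2) - 1) ∂P = 0 := by
  have e : ∀ ω, Real.exp (c * Y ω - c ^ 2 * v / 2) - 1 =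
      Real.exp (-(c ^ 2 * v / 2)) * Real.exp (c * Y ω) - 1 := fun ω ↦ by
    rw [← Real.exp_add]; ring_nf
  simp only [e]
  rw [integral_sub ((integrable_exp_mul_of_hasLaw hY c).const_mul _) (integrable_const _),
    integral_const_mul, integral_exp_mul_of_hasLaw hY, ← Real.exp_add]
  simp only [integral_const, probReal_univ, one_smul]
  rw [show -(c ^ 2 * (v : ℝ) / 2) + v * c ^ 2 / 2 = 0 by ring, Real.exp_zero, sub_self]

theorem stochasticExp_sub_one_sq (c x w : ℝ) : (Real.exp (c * x - c ^ 2 * w / 2) - 1) ^ 2 =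
    Real.exp (-(c ^ 2 * w)) * Real.exp (2 * c * x) -
      2 * (Real.exp (c * x - c ^ 2 * w / 2) - 1) - 1 := by
  have e : Real.exp (-(c ^ 2 * w)) * Real.exp (2 * c * x) =
      Real.exp (c * x - c ^ 2 * w / 2) ^ 2 := by
    rw [← Real.exp_add, ← Real.exp_nat_mul]; congr 1; push_cast; ring
  rw [e]; ring

theorem integrable_stochasticExp_sub_one (hY : HasLaw Y (gaussianReal 0 v) P) (c : ℝ) :
    Integrable (fun ω ↦ Real.exp (c * Y ω - c ^ 2 * v / 2) - 1) P := by
  have e : ∀ ω, Real.exp (c * Y ω - c ^ 2 * v / 2) - 1 =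
      Real.exp (-(c ^ 2 * v / 2)) * Real.exp (c * Y ω) - 1 := fun ω ↦ by
    rw [← Real.exp_add]; ring_nf
  simp only [e]
  exact ((integrable_exp_mul_of_hasLaw hY c).const_mul _).sub (integrable_const _)

theorem memLp_stochasticExp_sub_one (hY : HasLaw Y (gaussianReal 0 v) P) (c : ℝ) :
    MemLp (fun ω ↦ Real.exp (c * Y ω - c ^ 2 * v / 2) - 1) 2 P := by
  rw [memLp_two_iff_integrable_sq (integrable_stochasticExp_sub_one hY c).1]
  simp only [stochasticExp_sub_one_sq]
  exact (((integrable_exp_mul_of_hasLaw hY _).const_mul _).sub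
    ((integrable_stochasticExp_sub_one hY c).const_mul 2)).sub (integrable_const _)

theorem integral_stochasticExp_sub_one_sq (hY : HasLaw Y (gaussianReal 0 v) P) (c : ℝ) :
    ∫ ω, (Real.exp (c * Y ω - c ^ 2 * v / 2) - 1) ^ 2 ∂P = Real.exp (c ^ 2 * v) - 1 := by
  simp only [stochasticExp_sub_one_sq]
  have i1 := (integrable_exp_mul_of_hasLaw hY (2 * c)).const_mul (Real.exp (-(c ^ 2 * v)))
  have i2 := (integrable_stochasticExp_sub_one hY c).const_mul 2
  rw [integral_sub (f := fun ω ↦ Real.exp (-(c ^ 2 * v)) * Real.exp (2 * c * Y ω) -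
      2 * (Real.exp (c * Y ω - c ^ 2 * v / 2) - 1)) (i1.sub i2) (integrable_const _),
    integral_sub i1 i2, integral_const_mul, integral_const_mul,
    integral_exp_mul_of_hasLaw hY, integral_stochasticExp_sub_one hY, ← Real.exp_add]
  simp only [integral_const, probReal_univ, one_smul]
  rw [show -(c ^ 2 * (v : ℝ)) + v * (2 * c) ^ 2 / 2 = c ^ 2 * v by ring]
  ring

end ExponentialMoments

/-- The driftless geometric Brownian motion on `[0, T]`, constant outside this interval. -/
def geometricBM {Ω : Type*} {T : ℝ} (hT : 0 < T) (s₀ σ : ℝ) (W : ℝ≥0 → Ω → ℝ) (u : ℝ) (ω : Ω) : ℝ :=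
  Set.IccExtend hT.le (fun t : Set.Icc (0 : ℝ) T ↦
    s₀ * Real.exp (σ * W (t : ℝ).toNNReal ω + -(σ ^ 2 / 2) * t)) u

section GeometricBM

variable {Ω : Type*} {T : ℝ} (hT : 0 < T) {s₀ σ : ℝ} {W : ℝ≥0 → Ω → ℝ}

theorem geometricBM_of_mem {u : ℝ} (hu : u ∈ Set.Icc 0 T) (ω : Ω) :
    geometricBM hT s₀ σ W u ω = s₀ * Real.exp (σ * W u.toNNReal ω + -(σ ^ 2 / 2) * u) :=
  Set.IccExtend_of_mem _ _ hu

theorem continuous_geometricBM {ω : Ω} (hc : Continuous fun s ↦ W s ω) :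
    Continuous fun u ↦ geometricBM hT s₀ σ W u ω := by
  refine Continuous.Icc_extend' ?_
  have : Continuous fun t : Set.Icc (0 : ℝ) T ↦ W (t : ℝ).toNNReal ω := hc.comp (by fun_prop)
  fun_prop

theorem geometricBM_sub {n i : ℕ} (hi : i < 2 ^ n) (ω : Ω) :
    geometricBM hT s₀ σ W (T * (i + 1) / 2 ^ n) ω - geometricBM hT s₀ σ W (T * i / 2 ^ n) ω =
      geometricBM hT s₀ σ W (T * i / 2 ^ n) ω *
        (Real.exp (σ * (W (T * (i + 1) / 2 ^ n).toNNReal ω - W (T * i / 2 ^ n).toNNReal ω) -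
          σ ^ 2 * (T / 2 ^ n).toNNReal / 2) - 1) := by
  rw [geometricBM_of_mem hT (dyadic_succ_mem_Icc hT hi),
    geometricBM_of_mem hT (dyadic_mem_Icc hT hi.le), mul_sub, mul_one, mul_assoc, ← Real.exp_add,
    Real.coe_toNNReal _ (by positivity), ← dyadic_succ_sub T n i]
  congr 3
  ring

/-- The gain, on a dyadic partition, of holding `φ` shares of a geometric Brownian motion until
it leaves `[1 / R, R]`. -/
def stoppedGain (φ : ℝ × ℝ × ℝ × ℝ × ℝ → ℝ) (s₀ σ : ℝ) (W : ℝ≥0 → Ω → ℝ) (R : ℝ) (n : ℕ) (ω : Ω) :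
    ℝ :=
  ∑ i ∈ Finset.range (2 ^ n),
    {ω | ∀ u ∈ Set.Icc 0 (T * i / 2 ^ n), geometricBM hT s₀ σ W u ω ∈ Set.Icc R⁻¹ R}.indicator
      (fun ω ↦ φ (pathState (fun u ↦ geometricBM hT s₀ σ W u ω) (T * i / 2 ^ n)
        (geometricBM hT s₀ σ W (T * i / 2 ^ n) ω))) ω *
      (geometricBM hT s₀ σ W (T * (i + 1) / 2 ^ n) ω - geometricBM hT s₀ σ W (T * i / 2 ^ n) ω)

/-- Each price increment is the current price times `exp (σ ΔW - σ² h / 2) - 1`, which is centered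
and independent of the past. Until the exit from `[R⁻¹, R]` the state stays in a compact box, so the
coefficients are bounded and the gain is a martingale transform. -/
theorem exists_integral_stoppedGain [MeasurableSpace Ω] {P : Measure Ω} [IsProbabilityMeasure P]
    (hW : IsPreBrownianReal W P)
    (hWm : ∀ s, Measurable (W s)) (hWc : ∀ ω, Continuous fun s ↦ W s ω)
    {φ : ℝ × ℝ × ℝ × ℝ × ℝ → ℝ} (hφ : ContinuousOn φ (stateDomain T)) {R : ℝ} (hR : 0 < R) :
    ∃ K, ∀ n, MemLp (stoppedGain hT φ s₀ σ W R n) 2 P ∧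
      ∫ ω, stoppedGain hT φ s₀ σ W R n ω ∂P = 0 ∧
      ∫ ω, stoppedGain hT φ s₀ σ W R n ω ^ 2 ∂P ≤ K := by
  have hbox := stateBox_subset_stateDomain (T := T) (R := R) (inv_pos.2 hR)
  obtain ⟨M, hM⟩ := (isCompact_stateBox T R⁻¹ R).exists_bound_of_continuousOn (hφ.mono hbox)
  have hboxm : MeasurableSet (stateBox T R⁻¹ R) := (isCompact_stateBox T R⁻¹ R).measurableSet
  classical
  -- Nothing is known of `φ` outside its domain. Cutting it off outside the box gives a measurable
  -- function and leaves the stopped gain unchanged.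
  have hψ : Measurable ((stateBox T R⁻¹ R).indicator φ) := by
    rw [← Set.piecewise_eq_indicator]
    exact (hφ.mono hbox).measurable_piecewise continuousOn_const hboxm
  refine ⟨(|M| * R) ^ 2 * (σ ^ 2 * T * Real.exp (σ ^ 2 * T)), fun n ↦ ?_⟩
  set h : ℝ := T / 2 ^ n with hh
  have hh0 : 0 < h := by positivity
  set t : ℕ → ℝ≥0 := fun i ↦ (T * i / 2 ^ n).toNNReal with ht
  have ht0 : ∀ i : ℕ, 0 ≤ T * (i : ℝ) / 2 ^ n := fun i ↦ by positivity
  have htmono : Monotone t := fun i j hij ↦ by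
    have : (i : ℝ) ≤ j := by exact_mod_cast hij
    simp only [ht]
    gcongr
  set F : ℕ → MeasurableSpace Ω := fun i ↦
    MeasurableSpace.comap (fun ω (s : Set.Iic (t i)) ↦ W s ω) inferInstance with hF
  have hWF : ∀ i s, s ≤ t i → Measurable[F i] (W s) := fun i s hs ↦ by
    have h1 : Measurable[F i] fun ω (s : Set.Iic (t i)) ↦ W s ω := comap_measurable _
    exact (measurable_pi_apply (⟨s, hs⟩ : Set.Iic (t i))).comp h1
  have hFle : ∀ i, F i ≤ ‹MeasurableSpace Ω› := fun i ↦
    (measurable_pi_lambda _ fun s : Set.Iic (t i) ↦ hWm s).comap_le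
  have hFmono : Monotone F := fun i j hij ↦ by
    have h1 : Measurable[F j] (fun ω (s : Set.Iic (t i)) ↦ W s ω) :=
      @measurable_pi_lambda _ _ _ (F j) _ _ fun s ↦ hWF j s (s.2.trans (htmono hij))
    exact h1.comap_le
  set X := geometricBM hT s₀ σ W with hX
  have hXc : ∀ ω, Continuous fun u ↦ X u ω := fun ω ↦ continuous_geometricBM hT (hWc ω)
  have hXF : ∀ i : ℕ, i < 2 ^ n → ∀ u ∈ Set.Icc 0 (T * (i : ℝ) / 2 ^ n), Measurable[F i] (X u) := by
    intro i hi u hu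
    have hu' : u ∈ Set.Icc 0 T := ⟨hu.1, hu.2.trans (dyadic_mem_Icc hT hi.le).2⟩
    have e : X u = fun ω ↦ s₀ * Real.exp (σ * W u.toNNReal ω + -(σ ^ 2 / 2) * u) :=
      funext fun ω ↦ geometricBM_of_mem hT hu' ω
    rw [e]
    have h1 := hWF i u.toNNReal (Real.toNNReal_le_toNNReal hu.2)
    exact ((((h1.const_mul σ).add_const _).exp).const_mul s₀)
  set A : ℕ → Set Ω := fun i ↦ {ω | ∀ u ∈ Set.Icc 0 (T * (i : ℝ) / 2 ^ n), X u ω ∈ Set.Icc R⁻¹ R}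
    with hA
  set Z : ℕ → Ω → ℝ := fun i ↦ if i < 2 ^ n then (A i).indicator fun ω ↦
    (stateBox T R⁻¹ R).indicator φ
        (pathState (fun u ↦ X u ω) (T * i / 2 ^ n) (X (T * i / 2 ^ n) ω)) *
      X (T * i / 2 ^ n) ω else 0 with hZ
  set ξ : ℕ → Ω → ℝ := fun i ω ↦ Real.exp (σ * (W (T * ((i : ℝ) + 1) / 2 ^ n).toNNReal ω -
    W (T * i / 2 ^ n).toNNReal ω) - σ ^ 2 * h.toNNReal / 2) - 1 with hξ
  have hbox : ∀ i : ℕ, i < 2 ^ n → ∀ ω ∈ A i,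
      pathState (fun u ↦ X u ω) (T * i / 2 ^ n) (X (T * i / 2 ^ n) ω) ∈ stateBox T R⁻¹ R :=
    fun i hi ω hω ↦ pathState_mem_stateBox (hXc ω) (inv_pos.2 hR).le (dyadic_mem_Icc hT hi.le) hω
      (hω _ ⟨ht0 i, le_rfl⟩)
  have hlaw : ∀ i : ℕ, HasLaw (fun ω ↦ W (T * ((i : ℝ) + 1) / 2 ^ n).toNNReal ω -
      W (T * i / 2 ^ n).toNNReal ω) (gaussianReal 0 h.toNNReal) P := fun i ↦ by
    have := hasLaw_brownian_increment hW (ht0 i)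
      (t := T * ((i : ℝ) + 1) / 2 ^ n) (by rw [← sub_nonneg, dyadic_succ_sub]; exact hh0.le)
    rwa [dyadic_succ_sub] at this
  have hsucc : ∀ i : ℕ, (T * ((i : ℝ) + 1) / 2 ^ n).toNNReal = t (i + 1) := fun i ↦ by
    simp [ht]
  have hZm : ∀ i, Measurable[F i] (Z i) := fun i ↦ by
    by_cases hi : i < 2 ^ n
    · simp only [hZ, if_pos hi]
      have h1 := measurable_pathState (m := F i) hXc (ht0 i) (hXF i hi)
      have h2 := hXF i hi _ ⟨ht0 i, le_rfl⟩
      have h3 := measurableSet_forall_mem_Icc (m := F i) hXc (ht0 i) (hXF i hi)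
        (isClosed_Icc (a := R⁻¹) (b := R))
      exact ((hψ.comp h1).mul h2).indicator h3
    · simp only [hZ, if_neg hi]
      exact measurable_const
  have hZM : ∀ i ω, |Z i ω| ≤ |M| * R := fun i ω ↦ by
    by_cases hi : i < 2 ^ n
    · simp only [hZ, if_pos hi]
      by_cases hω : ω ∈ A i
      · rw [Set.indicator_of_mem hω, Set.indicator_of_mem (hbox i hi ω hω), abs_mul]
        have h1 := hω _ ⟨ht0 i, le_rfl⟩
        have h2 : 0 ≤ X (T * i / 2 ^ n) ω := (inv_pos.2 hR).le.trans h1.1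
        refine mul_le_mul ((hM _ (hbox i hi ω hω)).trans (le_abs_self M)) ?_ (abs_nonneg _)
          (abs_nonneg _)
        rw [abs_of_nonneg h2]
        exact h1.2
      · rw [Set.indicator_of_notMem hω, abs_zero]
        positivity
    · simp only [hZ, if_neg hi, Pi.zero_apply, abs_zero]
      positivity
  have hξF : ∀ i, Measurable[F (i + 1)] (ξ i) := fun i ↦ by
    have h1 := hWF (i + 1) _ (hsucc i).le
    have h2 := hWF (i + 1) _ (htmono (Nat.le_succ i))
    exact ((((h1.sub h2).const_mul σ).sub_const _).exp).sub_const 1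
  have hind : ∀ i, Indep (F i) (MeasurableSpace.comap (ξ i) inferInstance) P := fun i ↦ by
    have h1 := (IndepFun_iff_Indep _ _ _).1 (hW.indepFun_shift (t i)).symm
    refine indep_of_indep_of_le_right h1 ?_
    have e : ξ i = (fun y : ℝ≥0 → ℝ ↦ Real.exp (σ * y h.toNNReal - σ ^ 2 * h.toNNReal / 2) - 1) ∘
        fun ω s ↦ W (t i + s) ω - W (t i) ω := by
      funext ω
      have : (T * ((i : ℝ) + 1) / 2 ^ n).toNNReal = t i + h.toNNReal := by
        rw [ht, ← Real.toNNReal_add (ht0 i) hh0.le, hh]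
        congr 1
        ring
      simp only [hξ, Function.comp_apply, this]
      rfl
    rw [e, ← MeasurableSpace.comap_comp]
    refine MeasurableSpace.comap_mono ?_
    exact Measurable.comap_le (by fun_prop)
  have main := integral_martingaleTransform hFle hFmono hZm hZM hξF hind
    (fun i ↦ memLp_stochasticExp_sub_one (hlaw i) σ)
    (fun i ↦ integral_stochasticExp_sub_one (hlaw i) σ)
    (fun i ↦ (integral_stochasticExp_sub_one_sq (hlaw i) σ).le) (2 ^ n)
  have e : ∀ ω, ∑ i ∈ Finset.range (2 ^ n), Z i ω * ξ i ω = stoppedGain hT φ s₀ σ W R n ω := by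
    intro ω
    refine Finset.sum_congr rfl fun i hi ↦ ?_
    have hi := Finset.mem_range.1 hi
    rw [geometricBM_sub hT hi ω, ← hX, ← mul_assoc]
    change Z i ω * ξ i ω = (A i).indicator _ ω * X _ ω * ξ i ω
    congr 1
    simp only [hZ, if_pos hi]
    by_cases hω : ω ∈ A i
    · rw [Set.indicator_of_mem hω, Set.indicator_of_mem hω, Set.indicator_of_mem (hbox i hi ω hω)]
    · rw [Set.indicator_of_notMem hω, Set.indicator_of_notMem hω, zero_mul]
  have e' : (fun ω ↦ ∑ i ∈ Finset.range (2 ^ n), Z i ω * ξ i ω) = stoppedGain hT φ s₀ σ W R n :=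
    funext e
  rw [e'] at main
  simp only [e] at main
  refine ⟨main.1, main.2.1, main.2.2.trans ?_⟩
  rw [Real.coe_toNNReal _ hh0.le]
  -- The variance of one factor is of order `h = T / 2 ^ n`, so the `2 ^ n` steps together are
  -- bounded independently of `n`.
  have hx : Real.exp (σ ^ 2 * h) - 1 ≤ σ ^ 2 * h * Real.exp (σ ^ 2 * h) := by
    have h1 := Real.add_one_le_exp (-(σ ^ 2 * h))
    have h2 := Real.exp_pos (σ ^ 2 * h)
    have h3 : Real.exp (σ ^ 2 * h) * Real.exp (-(σ ^ 2 * h)) = 1 := by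
      rw [← Real.exp_add, add_neg_cancel, Real.exp_zero]
    nlinarith
  have hhT : h ≤ T := by
    rw [hh]
    exact div_le_self hT.le (one_le_pow₀ (by norm_num))
  have h2 : (2 : ℝ) ^ n * h = T := by rw [hh]; field_simp
  have hx2 : Real.exp (σ ^ 2 * h) ≤ Real.exp (σ ^ 2 * T) := by gcongr
  push_cast
  calc (2 : ℝ) ^ n * ((|M| * R) ^ 2 * (Real.exp (σ ^ 2 * h) - 1))
      ≤ 2 ^ n * ((|M| * R) ^ 2 * (σ ^ 2 * h * Real.exp (σ ^ 2 * T))) := by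
        gcongr
        exact hx.trans (by gcongr)
    _ = (|M| * R) ^ 2 * (σ ^ 2 * (2 ^ n * h) * Real.exp (σ ^ 2 * T)) := by ring
    _ = _ := by rw [h2]

end GeometricBM

/-! ### No arbitrage along the paths of geometric Brownian motion -/

/-- Almost sure limits of centered variables that are bounded in `L²` cannot be bounded from below
by a variable with positive mean. -/
theorem mul_measureReal_le_of_tendsto {Ω : Type*} [MeasurableSpace Ω] {P : Measure Ω}
    [IsProbabilityMeasure P] {D : ℕ → Ω → ℝ} (hD : ∀ n, MemLp (D n) 2 P)
    (hD0 : ∀ n, ∫ ω, D n ω ∂P = 0) {K : ℝ} (hK : ∀ n, ∫ ω, D n ω ^ 2 ∂P ≤ K) {A B : Set Ω}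
    (hA : MeasurableSet A) (hB : MeasurableSet B) {a c : ℝ} (ha : 0 ≤ a) (hc : 0 < c)
    (h : ∀ᵐ ω ∂P, ∃ v, Tendsto (fun n ↦ D n ω) atTop (𝓝 v) ∧ -a ≤ v ∧ (ω ∈ B → 0 ≤ v) ∧
      (ω ∈ A ∩ B → c ≤ v)) :
    c * P.real (A ∩ B) ≤ a * P.real Bᶜ := by
  have key : ∀ k : ℝ, 1 ≤ k → a ≤ k → c * P.real (A ∩ B) - a * P.real Bᶜ ≤ K / k := by
    intro k hk1 hka
    have hk : 0 < k := by linarith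
    -- Since `f x ≤ x + x² / k`, centering and the `L²` bound give `E f(D n) ≤ K / k` for all `n`.
    -- This passes to the limit by dominated convergence, and then `k → ∞`. As `a ≤ k`, the
    -- truncation keeps the assumed lower bounds of the limit.
    set f : ℝ → ℝ := fun x ↦ min (max x (-k)) c with hf
    have hfc : Continuous f := by fun_prop
    have hfb : ∀ x, |f x| ≤ k + c := fun x ↦ by
      rw [abs_le]
      refine ⟨le_min ?_ ?_, (min_le_right _ _).trans (by linarith)⟩
      · exact le_trans (by linarith) (le_max_right _ _)
      · linarith
    have hfx : ∀ x, f x ≤ x + x ^ 2 / k := fun x ↦ by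
      refine (min_le_left _ _).trans (max_le ?_ ?_)
      · have : 0 ≤ x ^ 2 / k := by positivity
        linarith
      · have e : x + x ^ 2 / k - -k = ((x + k / 2) ^ 2 + 3 / 4 * k ^ 2) / k := by
          field_simp; ring
        have : 0 ≤ ((x + k / 2) ^ 2 + 3 / 4 * k ^ 2) / k := by positivity
        linarith
    set g : Ω → ℝ := fun ω ↦ limUnder atTop fun n ↦ D n ω with hg
    have hlim : ∀ᵐ ω ∂P, Tendsto (fun n ↦ f (D n ω)) atTop (𝓝 (f (g ω))) ∧
        (A ∩ B).indicator (fun _ ↦ c) ω - Bᶜ.indicator (fun _ ↦ a) ω ≤ f (g ω) := by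
      filter_upwards [h] with ω ⟨v, hv, h1, h2, h3⟩
      have hgv : g ω = v := hv.limUnder_eq
      rw [hgv]
      refine ⟨(hfc.tendsto v).comp hv, ?_⟩
      by_cases hωB : ω ∈ B
      · rw [Set.indicator_of_notMem (fun h ↦ h hωB : ω ∉ Bᶜ), sub_zero]
        by_cases hωA : ω ∈ A ∩ B
        · rw [Set.indicator_of_mem hωA]
          exact le_min ((h3 hωA).trans (le_max_left _ _)) le_rfl
        · rw [Set.indicator_of_notMem hωA]
          exact le_min ((h2 hωB).trans (le_max_left _ _)) hc.le
      · rw [Set.indicator_of_mem (show ω ∈ Bᶜ from hωB),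
          Set.indicator_of_notMem (fun h ↦ hωB h.2 : ω ∉ A ∩ B), zero_sub]
        exact le_min (h1.trans (le_max_left _ _)) (by linarith)
    have hfm : ∀ n, AEStronglyMeasurable (fun ω ↦ f (D n ω)) P := fun n ↦
      hfc.comp_aestronglyMeasurable (hD n).1
    have hconv := tendsto_integral_of_dominated_convergence (fun _ ↦ k + c) hfm
      (integrable_const _) (fun n ↦ ae_of_all _ fun ω ↦ hfb _) (hlim.mono fun ω h ↦ h.1)
    have hle : ∀ n, ∫ ω, f (D n ω) ∂P ≤ K / k := fun n ↦ by
      have i1 : Integrable (D n) P := (hD n).integrable (by norm_num)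
      have i2 : Integrable (fun ω ↦ D n ω ^ 2 / k) P := (hD n).integrable_sq.div_const k
      calc ∫ ω, f (D n ω) ∂P ≤ ∫ ω, (D n ω + D n ω ^ 2 / k) ∂P :=
            integral_mono ((integrable_const (k + c)).mono' (hfm n) (ae_of_all _ fun ω ↦ hfb _))
              (i1.add i2) fun ω ↦ hfx _
        _ ≤ K / k := by
            rw [integral_add i1 i2, hD0, zero_add, integral_div]
            exact div_le_div_of_nonneg_right (hK n) hk.le
    have hgle : ∫ ω, f (g ω) ∂P ≤ K / k := le_of_tendsto' hconv hle
    have hgm : AEStronglyMeasurable (fun ω ↦ f (g ω)) P :=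
      aestronglyMeasurable_of_tendsto_ae _ hfm (hlim.mono fun ω h ↦ h.1)
    have j1 : Integrable ((A ∩ B).indicator fun _ : Ω ↦ c) P :=
      (integrable_const c).indicator (hA.inter hB)
    have j2 : Integrable (Bᶜ.indicator fun _ : Ω ↦ a) P := (integrable_const a).indicator hB.compl
    have hlow : ∫ ω, ((A ∩ B).indicator (fun _ ↦ c) ω - Bᶜ.indicator (fun _ ↦ a) ω) ∂P ≤
        ∫ ω, f (g ω) ∂P :=
      integral_mono_ae (j1.sub j2) ((integrable_const (k + c)).mono' hgm
        (ae_of_all _ fun ω ↦ hfb _)) (hlim.mono fun ω h ↦ h.2)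
    rw [integral_sub j1 j2, integral_indicator_const _ (hA.inter hB),
      integral_indicator_const _ hB.compl, smul_eq_mul, smul_eq_mul] at hlow
    linarith
  have hlim : Tendsto (fun k : ℝ ↦ K / k) atTop (𝓝 0) := tendsto_const_nhds.div_atTop tendsto_id
  have := ge_of_tendsto hlim ((eventually_ge_atTop (max 1 a)).mono fun k hk ↦
    key k ((le_max_left _ _).trans hk) ((le_max_right _ _).trans hk))
  linarith

/-- The times up to which a continuous path has stayed in a closed set form an interval. -/
theorem exists_exit_time {T : ℝ} (hT : 0 < T) {η : ℝ → ℝ} (hη : Continuous η) {C : Set ℝ}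
    (hC : IsClosed C) (h0 : η 0 ∈ C) :
    ∃ τ ∈ Set.Icc 0 T, ∀ t ∈ Set.Icc 0 T, (∀ u ∈ Set.Icc 0 t, η u ∈ C) ↔ t ≤ τ := by
  -- Rescaling `[0, t]` to `[0, 1]` expresses the constraint as closed conditions on `t`; the set is
  -- compact and contains its supremum.
  set E : Set ℝ := Set.Icc 0 T ∩ ⋂ s ∈ Set.Icc (0 : ℝ) 1, (fun t ↦ η (s * t)) ⁻¹' C with hE
  have hEc : IsCompact E := isCompact_Icc.inter_right (isClosed_biInter fun s _ ↦
    hC.preimage (by fun_prop))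
  have hE0 : (0 : ℝ) ∈ E := by
    refine ⟨⟨le_rfl, hT.le⟩, Set.mem_iInter₂.2 fun s _ ↦ ?_⟩
    simpa using h0
  have hmem : ∀ t ∈ E, ∀ u ∈ Set.Icc 0 t, η u ∈ C := by
    rintro t ⟨ht, ht2⟩ u hu
    rcases hu.1.eq_or_lt with rfl | hu0
    · exact h0
    · have ht0 : 0 < t := hu0.trans_le hu.2
      have := Set.mem_iInter₂.1 ht2 (u / t) ⟨by positivity, (div_le_one ht0).2 hu.2⟩
      rwa [Set.mem_preimage, div_mul_cancel₀ _ ht0.ne'] at this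
  have hτ := hEc.sSup_mem ⟨0, hE0⟩
  refine ⟨sSup E, hτ.1, fun t ht ↦ ⟨fun h ↦ ?_, fun h u hu ↦ hmem _ hτ u ⟨hu.1, hu.2.trans h⟩⟩⟩
  refine le_csSup hEc.bddAbove ⟨ht, Set.mem_iInter₂.2 fun s hs ↦ ?_⟩
  exact h _ ⟨mul_nonneg hs.1 ht.1, mul_le_of_le_one_left ht.1 hs.2⟩

/-- The gain at time `t`, on the `n`-th dyadic partition, of holding `φ` shares along the path
`η`. -/
def pathGain (T : ℝ) (φ : ℝ × ℝ × ℝ × ℝ × ℝ → ℝ) (η : ℝ → ℝ) (n : ℕ) (t : ℝ) : ℝ :=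
  pathSum T (fun s ↦ φ (pathState η s (η s))) η n t

/-- A possible path of the price: it is positive and continuous, it starts at `s₀`, and its
logarithm has quadratic variation `σ² t`. -/
structure IsPricePath {T : ℝ} (hT : 0 < T) (s₀ σ : ℝ) (x : Set.Icc (0 : ℝ) T → ℝ) : Prop where
  cont : Continuous x
  pos : ∀ t, 0 < x t
  start : x ⟨0, Set.left_mem_Icc.2 hT.le⟩ = s₀
  quadraticVariation : HasLogQuadraticVariation T σ (Set.IccExtend hT.le x)

theorem IsPricePath.exists_tendsto_pathGain {T : ℝ} {hT : 0 < T} {s₀ σ : ℝ}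
    {x : Set.Icc (0 : ℝ) T → ℝ} (hx : IsPricePath hT s₀ σ x)
    {φ : ℝ × ℝ × ℝ × ℝ × ℝ → ℝ} (hφ : ContDiffOn ℝ 1 φ (stateDomain T)) {t : ℝ}
    (ht : t ∈ Set.Icc 0 T) :
    ∃ v, Tendsto (fun n ↦ pathGain T φ (Set.IccExtend hT.le x) n t) atTop (𝓝 v) := by
  obtain ⟨r, R, hr, hR⟩ := exists_forall_iccExtend_mem_Icc hT hx.cont hx.pos
  exact exists_tendsto_pathSum_functional hT hφ hr hx.cont.Icc_extend' hR hx.quadraticVariation ht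

theorem stoppedGain_eq_pathGain {Ω : Type*} {T : ℝ} (hT : 0 < T)
    (φ : ℝ × ℝ × ℝ × ℝ × ℝ → ℝ) {s₀ σ : ℝ} {W : ℝ≥0 → Ω → ℝ} {R : ℝ} {ω : Ω} {τ : ℝ}
    (hτ : ∀ t ∈ Set.Icc 0 T,
      (∀ u ∈ Set.Icc 0 t, geometricBM hT s₀ σ W u ω ∈ Set.Icc R⁻¹ R) ↔ t ≤ τ) (n : ℕ) :
    stoppedGain hT φ s₀ σ W R n ω = pathGain T φ (fun u ↦ geometricBM hT s₀ σ W u ω) n τ := by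
  rw [stoppedGain, pathGain, pathSum, dyadicIndices, Finset.sum_filter]
  refine Finset.sum_congr rfl fun i hi ↦ ?_
  have h : ω ∈ {ω | ∀ u ∈ Set.Icc 0 (T * (i : ℝ) / 2 ^ n),
      geometricBM hT s₀ σ W u ω ∈ Set.Icc R⁻¹ R} ↔ T * (i : ℝ) / 2 ^ n ≤ τ :=
    hτ _ (dyadic_mem_Icc hT (Finset.mem_range.1 hi).le)
  by_cases hi' : T * (i : ℝ) / 2 ^ n ≤ τ
  · rw [if_pos hi', Set.indicator_of_mem (h.2 hi')]
  · rw [if_neg hi', Set.indicator_of_notMem (mt h.1 hi'), zero_mul]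

/-- Along the paths of a geometric Brownian motion, the gains of a smooth strategy that are bounded
from below and nonnegative at the end cannot be positive near some path. -/
theorem not_pathGain_arbitrage {Ω : Type*} [MeasurableSpace Ω] {P : Measure Ω}
    [IsProbabilityMeasure P] {W₀ : ℝ≥0 → Ω → ℝ} (hW₀ : IsBrownianReal W₀ P) {T : ℝ} (hT : 0 < T)
    {s₀ σ : ℝ} (hs₀ : 0 < s₀) (hσ : 0 < σ) {φ : ℝ × ℝ × ℝ × ℝ × ℝ → ℝ}
    (hφ : ContDiffOn ℝ 1 φ (stateDomain T)) {a : ℝ} (ha : 0 ≤ a)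
    (h1 : ∀ x, IsPricePath hT s₀ σ x → ∀ t ∈ Set.Icc 0 T, ∀ v,
      Tendsto (fun n ↦ pathGain T φ (Set.IccExtend hT.le x) n t) atTop (𝓝 v) → -a ≤ v)
    (h2 : ∀ x, IsPricePath hT s₀ σ x → ∀ v,
      Tendsto (fun n ↦ pathGain T φ (Set.IccExtend hT.le x) n T) atTop (𝓝 v) → 0 ≤ v)
    {x₀ : Set.Icc (0 : ℝ) T → ℝ} (hx₀ : IsPricePath hT s₀ σ x₀) {δ c : ℝ} (hδ : 0 < δ) (hc : 0 < c)
    (h3 : ∀ x, IsPricePath hT s₀ σ x → (∀ t, |x₀ t - x t| ≤ δ) → ∀ v,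
      Tendsto (fun n ↦ pathGain T φ (Set.IccExtend hT.le x) n T) atTop (𝓝 v) → c ≤ v) : False := by
  obtain ⟨W, hWm, hWc, hWW⟩ := exists_continuous_modification
    (fun s ↦ hW₀.aemeasurable s) hW₀.cont
  have hW : IsBrownianReal W P :=
    { hW₀.toIsPreBrownianReal.congr fun s ↦ hWW.mono fun ω h ↦ (h s).symm with
      cont := ae_of_all _ hWc }
  set x : Ω → Set.Icc (0 : ℝ) T → ℝ := fun ω t ↦
    s₀ * Real.exp (σ * W (t : ℝ).toNNReal ω + -(σ ^ 2 / 2) * t) with hx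
  set X := geometricBM hT s₀ σ W with hX
  have hXx : ∀ ω, (fun u ↦ X u ω) = Set.IccExtend hT.le (x ω) := fun ω ↦ rfl
  have hXc : ∀ ω, Continuous fun u ↦ X u ω := fun ω ↦ continuous_geometricBM hT (hWc ω)
  have hXm : ∀ u, Measurable (X u) := fun u ↦
    (((hWm _).const_mul σ).add_const _).exp.const_mul s₀
  have hpath : ∀ᵐ ω ∂P, IsPricePath hT s₀ σ (x ω) := by
    have hz := tendsto_sum_linear_add_sq hT (-(σ ^ 2 / 2)) 0 (b := fun _ ↦ 0) (by simp)
    have hqv := ae_hasLogQuadraticVariation (Z := fun (t : Set.Icc (0 : ℝ) T) (_ : Ω) ↦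
      -(σ ^ 2 / 2) * (t : ℝ)) hW.toIsPreBrownianReal hT hs₀ σ
      (ae_of_all _ fun ω ↦ by simpa using hz)
    filter_upwards [hqv, hW.eval_zero_ae_eq_zero] with ω h1 h2
    refine ⟨?_, fun t ↦ by positivity, ?_, h1⟩
    · have : Continuous fun t : Set.Icc (0 : ℝ) T ↦ W (t : ℝ).toNNReal ω :=
        (hWc ω).comp (by fun_prop)
      simp only [hx]
      fun_prop
    · simp [hx, h2]
  set A : Set Ω := {ω | ∀ u ∈ Set.Icc 0 T, X u ω - Set.IccExtend hT.le x₀ u ∈ Set.Icc (-δ) δ}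
    with hA
  have hAm : MeasurableSet A := measurableSet_forall_mem_Icc
    (X := fun u ω ↦ X u ω - Set.IccExtend hT.le x₀ u)
    (fun ω ↦ (hXc ω).sub hx₀.cont.Icc_extend') hT.le (fun u _ ↦ (hXm u).sub_const _) isClosed_Icc
  have hA0 : 0 < P A := by
    have h := measure_perturbation_near_pos (Z := fun (t : Set.Icc (0 : ℝ) T) (_ : Ω) ↦
      -(σ ^ 2 / 2) * (t : ℝ)) hW hT hs₀ hσ (ae_of_all _ fun ω ↦ by fun_prop)
      (ae_of_all _ fun ω ↦ by simp) (indepFun_const_right _ _) hx₀.cont hx₀.pos hx₀.start hδ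
    refine h.trans_le (measure_mono fun ω hω u _ ↦ ?_)
    exact abs_le.1 (hω (Set.projIcc 0 T hT.le u))
  -- On `B m` the path never leaves the range and no stopping occurs; the complements shrink to the
  -- empty set because each path is positive and continuous on a compact interval.
  set B : ℕ → Set Ω := fun m ↦
    {ω | ∀ u ∈ Set.Icc 0 T, X u ω ∈ Set.Icc ((m : ℝ) + 1)⁻¹ ((m : ℝ) + 1)} with hB
  have hBm : ∀ m, MeasurableSet (B m) := fun m ↦
    measurableSet_forall_mem_Icc hXc hT.le (fun u _ ↦ hXm u) isClosed_Icc
  have hBmono : Antitone fun m ↦ (B m)ᶜ := by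
    refine fun m m' hm ↦ Set.compl_subset_compl.2 fun ω hω u hu ↦ ?_
    have hm' : (m : ℝ) ≤ m' := by exact_mod_cast hm
    exact Set.Icc_subset_Icc (by gcongr) (by gcongr) (hω u hu)
  have hBlim : Tendsto (fun m ↦ P.real (B m)ᶜ) atTop (𝓝 0) := by
    have h := tendsto_measure_iInter_atTop (μ := P) (s := fun m ↦ (B m)ᶜ)
      (fun m ↦ (hBm m).compl.nullMeasurableSet) hBmono ⟨0, measure_ne_top _ _⟩
    have he : ⋂ m, (B m)ᶜ = ∅ := by
      rw [← Set.compl_iUnion, Set.compl_empty_iff, Set.iUnion_eq_univ_iff]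
      intro ω
      have hxc : Continuous (x ω) := by
        have := (hXc ω).comp (continuous_subtype_val (p := fun t ↦ t ∈ Set.Icc 0 T))
        convert this using 1
        funext t
        exact (Set.IccExtend_val hT.le (x ω) t).symm
      obtain ⟨r, R, hr, hR⟩ := exists_forall_iccExtend_mem_Icc hT hxc fun t ↦ by
        simp only [hx]; positivity
      obtain ⟨m, hm⟩ := exists_nat_ge (max r⁻¹ R)
      refine ⟨m, fun u _ ↦ ⟨?_, ?_⟩⟩
      · refine le_trans ?_ (hR u).1
        refine inv_le_of_inv_le₀ hr ?_
        linarith [le_max_left r⁻¹ R]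
      · exact (hR u).2.trans (by linarith [le_max_right r⁻¹ R])
    rw [he, measure_empty] at h
    exact (ENNReal.tendsto_toReal ENNReal.zero_ne_top).comp h
  obtain ⟨m₀, hm₀⟩ := exists_nat_ge (max s₀⁻¹ s₀)
  -- The stopped gains tend to the gain at the exit time `τ`. The bound `-a` applies at this random
  -- time because `h1` holds for every price path and every `t`; on `B m` one has `τ = T`, where
  -- `h2` and `h3` apply.
  have key : ∀ m ≥ m₀, c * P.real (A ∩ B m) ≤ a * P.real (B m)ᶜ := by
    intro m hm
    have hmR : (m₀ : ℝ) ≤ m := by exact_mod_cast hm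
    have hR : (0 : ℝ) < (m : ℝ) + 1 := by positivity
    have hsR : s₀ ∈ Set.Icc ((m : ℝ) + 1)⁻¹ ((m : ℝ) + 1) := by
      constructor
      · refine inv_le_of_inv_le₀ hs₀ ?_
        linarith [le_max_left s₀⁻¹ s₀]
      · linarith [le_max_right s₀⁻¹ s₀]
    obtain ⟨K, hK⟩ := exists_integral_stoppedGain (s₀ := s₀) (σ := σ) hT hW.toIsPreBrownianReal
      hWm hWc hφ.continuousOn hR
    refine mul_measureReal_le_of_tendsto (fun n ↦ (hK n).1) (fun n ↦ (hK n).2.1)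
      (fun n ↦ (hK n).2.2) hAm (hBm m) ha hc ?_
    filter_upwards [hpath] with ω hω
    have hX0 : X 0 ω = s₀ := by
      have := hω.start
      rw [← this]
      exact Set.IccExtend_left hT.le (x ω)
    obtain ⟨τ, hτ, hτ'⟩ := exists_exit_time hT (hXc ω) isClosed_Icc (by rw [hX0]; exact hsR)
    obtain ⟨v, hv⟩ := hω.exists_tendsto_pathGain hφ hτ
    refine ⟨v, ?_, h1 _ hω τ hτ v hv, fun hωB ↦ ?_, fun hωA ↦ ?_⟩
    · simp only [stoppedGain_eq_pathGain hT φ hτ']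
      exact hv
    · have e : τ = T := le_antisymm hτ.2 ((hτ' T ⟨hT.le, le_rfl⟩).1 hωB)
      rw [e] at hv
      exact h2 _ hω v hv
    · have e : τ = T := le_antisymm hτ.2 ((hτ' T ⟨hT.le, le_rfl⟩).1 hωA.2)
      rw [e] at hv
      refine h3 _ hω (fun t ↦ ?_) v hv
      have := hωA.1 t t.2
      rw [hX, geometricBM, Set.IccExtend_val, Set.IccExtend_val] at this
      rw [abs_sub_comm]
      exact abs_le.2 this
  have hle : ∀ m ≥ m₀, c * P.real A ≤ (a + c) * P.real (B m)ᶜ := fun m hm ↦ by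
    have h4 : P.real A ≤ P.real (A ∩ B m) + P.real (B m)ᶜ := by
      refine (measureReal_mono (s₂ := (A ∩ B m) ∪ (B m)ᶜ) fun ω hω ↦ ?_).trans
        (measureReal_union_le _ _)
      by_cases h : ω ∈ B m
      · exact Or.inl ⟨hω, h⟩
      · exact Or.inr h
    have := key m hm
    nlinarith
  have hlim : Tendsto (fun m ↦ (a + c) * P.real (B m)ᶜ) atTop (𝓝 0) := by
    simpa using hBlim.const_mul (a + c)
  have hfin := ge_of_tendsto hlim ((eventually_ge_atTop m₀).mono hle)
  have hPA : 0 < P.real A := ENNReal.toReal_pos hA0.ne' (measure_ne_top _ _)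
  nlinarith

/-! ### No smooth arbitrage in the mixed model -/

/-- The state of a path at time `t ∈ [0, T]` depends only on the path on `[0, t]`. -/
theorem pathState_congr {η η' : ℝ → ℝ} {t : ℝ} (ht : 0 ≤ t) (h : ∀ u ∈ Set.Icc 0 t, η u = η' u) :
    pathState η t (η t) = pathState η' t (η' t) := by
  have h1 : (fun u ↦ η u) '' Set.Icc 0 t = (fun u ↦ η' u) '' Set.Icc 0 t := Set.image_congr h
  have h2 : ∫ u in (0 : ℝ)..t, η u = ∫ u in (0 : ℝ)..t, η' u :=
    intervalIntegral.integral_congr fun u hu ↦ h u (by rwa [Set.uIcc_of_le ht] at hu)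
  rw [pathState, pathState, h1, h2, h t ⟨ht, le_rfl⟩]

section Gains

variable {Ω : Type*} [MeasurableSpace Ω] {P : Measure Ω} {T H s₀ μ σ ν : ℝ} {S : ℝ → Ω → ℝ}

theorem IsMixedFractionalBlackScholes.ae_isPricePath
    (hS : IsMixedFractionalBlackScholes P T H s₀ μ σ ν S) (hT : 0 < T) (hH : 1 / 2 < H)
    (hs₀ : 0 < s₀) : ∀ᵐ ω ∂P, IsPricePath hT s₀ σ fun t ↦ S t ω := by
  filter_upwards [hS.ae_hasLogQuadraticVariation hT hH hs₀] with ω h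
  exact ⟨hS.continuous_path ω, fun t ↦ hS.pos ω t t.2, hS.start ω, h⟩

/-- The value of a smooth self-financing strategy is the limit of the gains along the paths of the
price. -/
theorem Portfolio.IsSelfFinancing.ae_tendsto_pathGain {Φ : Portfolio P T S}
    (hΦ : Φ.IsSelfFinancing) (hS : IsMixedFractionalBlackScholes P T H s₀ μ σ ν S) (hT : 0 < T)
    (hH : 1 / 2 < H) (hs₀ : 0 < s₀) {φ : ℝ × ℝ × ℝ × ℝ × ℝ → ℝ}
    (hφ : ContDiffOn ℝ 1 φ (stateDomain T))
    (hΦφ : ∀ᵐ ω ∂P, ∀ t ∈ Set.Icc 0 T,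
      Φ.shares t ω = φ (pathState (fun u ↦ S u ω) t (S t ω))) {t : ℝ} (ht : t ∈ Set.Icc 0 T) :
    ∀ᵐ ω ∂P, Tendsto (fun n ↦ pathGain T φ (Set.IccExtend hT.le fun t ↦ S t ω) n t) atTop
      (𝓝 (Φ.value t ω - Φ.value 0 ω)) := by
  have hext : ∀ ω, ∀ u ∈ Set.Icc 0 T, S u ω = Set.IccExtend hT.le (fun t ↦ S t ω) u :=
    fun ω u hu ↦ (Set.IccExtend_of_mem hT.le (fun t : Set.Icc (0 : ℝ) T ↦ S t ω) hu).symm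
  have heq : ∀ᵐ ω ∂P, ∀ n t, forwardSum T Φ.shares S n t ω =
      pathGain T φ (Set.IccExtend hT.le fun t ↦ S t ω) n t := by
    filter_upwards [hΦφ] with ω h n t
    rw [forwardSum_eq_pathSum, pathGain]
    refine pathSum_congr hT (fun s hs ↦ ?_) (hext ω) n t
    rw [h s hs, pathState_congr hs.1 fun u hu ↦ hext ω u ⟨hu.1, hu.2.trans hs.2⟩]
  rcases hΦ t ht with h | ⟨-, hno, -⟩
  · filter_upwards [h, heq] with ω h1 h2
    exact h1.congr fun n ↦ h2 n t
  -- The improper reading never applies to a smooth strategy, since its dyadic sums converge at `T`.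
  · refine absurd ⟨fun ω ↦ limUnder atTop fun n ↦ forwardSum T Φ.shares S n T ω, ?_⟩ hno
    filter_upwards [hS.ae_isPricePath hT hH hs₀, heq] with ω h1 h2
    obtain ⟨v, hv⟩ := h1.exists_tendsto_pathGain hφ ⟨hT.le, le_rfl⟩
    exact tendsto_nhds_limUnder ⟨v, hv.congr fun n ↦ (h2 n T).symm⟩

/-- A lower bound that holds for the gains along almost every path of the price holds along every
possible path. -/
theorem le_of_tendsto_pathGain (hS : IsMixedFractionalBlackScholes P T H s₀ μ σ ν S) (hT : 0 < T)
    (hH : 1 / 2 < H) (hs₀ : 0 < s₀) (hσ : 0 < σ) {φ : ℝ × ℝ × ℝ × ℝ × ℝ → ℝ}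
    (hφ : ContDiffOn ℝ 1 φ (stateDomain T)) {t : ℝ} (ht : t ∈ Set.Icc 0 T) {b : ℝ}
    (hb : ∀ᵐ ω ∂P, ∃ v, b ≤ v ∧
      Tendsto (fun n ↦ pathGain T φ (Set.IccExtend hT.le fun t ↦ S t ω) n t) atTop (𝓝 v))
    {x : Set.Icc (0 : ℝ) T → ℝ} (hx : IsPricePath hT s₀ σ x) {v : ℝ}
    (hv : Tendsto (fun n ↦ pathGain T φ (Set.IccExtend hT.le x) n t) atTop (𝓝 v)) : b ≤ v := by
  refine le_of_forall_pos_le_add fun ε hε ↦ ?_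
  obtain ⟨r, R, hr, hR⟩ := exists_forall_iccExtend_mem_Icc hT hx.cont hx.pos
  obtain ⟨δ, hδ, h⟩ := exists_abs_limit_sub_limit_le hT hφ hr hx.cont.Icc_extend' hR
    hx.quadraticVariation hε
  have hpos := hS.measure_near_pos hT hH hs₀ hσ hx.cont hx.pos hx.start hδ
  -- By full support, some typical path of the price lies within `δ` of `x`, and the gain there
  -- differs by at most `ε`.
  obtain ⟨ω, hω, ⟨v', hbv', hv'⟩, hp⟩ := Filter.Frequently.exists
    ((frequently_ae_iff.2 hpos.ne').and_eventually (hb.and (hS.ae_isPricePath hT hH hs₀)))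
  have := h _ hp.cont.Icc_extend' (fun s ↦ by
    rw [abs_sub_comm]; exact hω (Set.projIcc 0 T hT.le s)) hp.quadraticVariation t ht v v' hv hv'
  linarith [(abs_le.1 this).1]

/-- In the mixed fractional Black–Scholes model, smooth strategies without doubling are free of
arbitrage. -/
theorem not_exists_smooth_arbitrage [IsProbabilityMeasure P]
    (hS : IsMixedFractionalBlackScholes P T H s₀ μ σ ν S) (hT : 0 < T) (hH : 1 / 2 < H)
    (hs₀ : 0 < s₀) (hσ : 0 < σ) :
    ¬ ∃ Φ : Portfolio P T S, Φ.IsSmooth ∧ Φ.IsNDSAdmissible ∧ Φ.IsArbitrage := by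
  rintro ⟨Φ, ⟨hsf, φ, hφ, hΦφ⟩, ⟨a, ha, hadm⟩, hV0, hVT, hpos⟩
  have hlim : ∀ t ∈ Set.Icc 0 T, ∀ᵐ ω ∂P, Tendsto
      (fun n ↦ pathGain T φ (Set.IccExtend hT.le fun t ↦ S t ω) n t) atTop
      (𝓝 (Φ.value t ω)) := fun t ht ↦ by
    filter_upwards [hsf.ae_tendsto_pathGain hS hT hH hs₀ hφ hΦφ ht, hV0] with ω h1 h2
    rwa [h2, sub_zero] at h1
  have hTT : T ∈ Set.Icc 0 T := ⟨hT.le, le_rfl⟩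
  -- A typical path with positive final value; by continuity at least half of this value persists on
  -- a uniform neighbourhood.
  obtain ⟨ω₀, hω₀, hp₀, hl₀⟩ := Filter.Frequently.exists
    ((frequently_ae_iff.2 hpos.ne').and_eventually
      ((hS.ae_isPricePath hT hH hs₀).and (hlim T hTT)))
  obtain ⟨r, R, hr, hR⟩ := exists_forall_iccExtend_mem_Icc hT hp₀.cont hp₀.pos
  obtain ⟨δ, hδ, h⟩ := exists_abs_limit_sub_limit_le hT hφ hr hp₀.cont.Icc_extend' hR
    hp₀.quadraticVariation (half_pos hω₀)
  -- Only the Brownian motion of the model is kept; it drives the comparison geometric Brownian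
  -- motion.
  obtain ⟨Ω', mΩ', P', hP', W, -, hW, -⟩ := hS.exists_perturbation hT hH
  refine not_pathGain_arbitrage hW hT hs₀ hσ hφ ha (fun x hx t ht v hv ↦ ?_)
    (fun x hx v hv ↦ ?_) hp₀ hδ (half_pos hω₀) fun x hx hδx v hv ↦ ?_
  · refine le_of_tendsto_pathGain hS hT hH hs₀ hσ hφ ht ?_ hx hv
    filter_upwards [hlim t ht, hadm] with ω h1 h2
    exact ⟨_, h2 t ht, h1⟩
  · refine le_of_tendsto_pathGain hS hT hH hs₀ hσ hφ hTT ?_ hx hv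
    filter_upwards [hlim T hTT, hVT] with ω h1 h2
    exact ⟨_, h2, h1⟩
  · have := h _ hx.cont.Icc_extend' (fun s ↦ hδx (Set.projIcc 0 T hT.le s))
      hx.quadraticVariation T hTT _ v hl₀ hv
    linarith [(abs_le.1 this).2]

end Gains

/-! ### The strong arbitrage -/

section DiracStrategy

variable {Ω : Type*} [MeasurableSpace Ω] {P : Measure Ω} {T H s₀ μ σ ν : ℝ} {S : ℝ → Ω → ℝ}

/-- The price is adapted. -/
theorem measurable_information {t : ℝ} (ht : t ∈ Set.Icc 0 T) :
    Measurable[information P T S t] (S t) := by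
  refine Measurable.of_comap_le (le_iInf₂ fun s hs ↦ ?_)
  refine le_trans ?_ le_eventuallyMeasurableSpace
  exact le_iSup₂_of_le (f := fun u _ ↦ MeasurableSpace.comap (S u) inferInstance) t
    ⟨ht, (Set.mem_Ioi.1 hs).le⟩ le_rfl

theorem measurable_diracPrice (T σ K t : ℝ) : Measurable (diracPrice T σ K t) := by
  unfold diracPrice logDistance
  fun_prop

theorem measurable_diracDelta (T σ K t : ℝ) : Measurable (diracDelta T σ K t) := by
  have := measurable_diracPrice T σ K t
  unfold diracDelta logDistance
  fun_prop

/-- The strategy that sells the Dirac mass of the final price at `s₀` and replicates it. -/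
def diracPortfolio (P : Measure Ω) (T s₀ σ : ℝ) (S : ℝ → Ω → ℝ) : Portfolio P T S where
  bonds t ω := diracPrice T σ s₀ 0 s₀ - diracPrice T σ s₀ t (S t ω) +
    diracDelta T σ s₀ t (S t ω) * S t ω
  shares t ω := -diracDelta T σ s₀ t (S t ω)
  adapted_bonds t ht := by
    have h := measurable_information (P := P) (S := S) ht
    exact (measurable_const.sub ((measurable_diracPrice T σ s₀ t).comp h)).add
      (((measurable_diracDelta T σ s₀ t).comp h).mul h)
  adapted_shares t ht :=
    ((measurable_diracDelta T σ s₀ t).comp (measurable_information (P := P) (S := S) ht)).neg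

theorem value_diracPortfolio (t : ℝ) (ω : Ω) : (diracPortfolio P T s₀ σ S).value t ω =
    diracPrice T σ s₀ 0 s₀ - diracPrice T σ s₀ t (S t ω) := by
  simp only [Portfolio.value, diracPortfolio]
  ring

/-- In the mixed fractional Black–Scholes model there is a strong arbitrage among the spot
strategies. -/
theorem exists_spot_strongArbitrage
    (hS : IsMixedFractionalBlackScholes P T H s₀ μ σ ν S) (hT : 0 < T) (hH : 1 / 2 < H)
    (hs₀ : 0 < s₀) (hσ : 0 < σ) :
    ∃ Φ : Portfolio P T S, Φ.IsSpot ∧ Φ.IsStrongArbitrage := by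
  refine ⟨diracPortfolio P T s₀ σ S, ⟨fun t ht ↦ Or.inl ?_, fun t x ↦ -diracDelta T σ s₀ t x,
    ae_of_all _ fun ω t _ ↦ rfl⟩, ae_of_all _ fun ω ↦ ?_, diracPrice T σ s₀ 0 s₀, ?_,
    ae_of_all _ fun ω ↦ ?_⟩
  -- As the path does not end at the strike, the dyadic sums converge at `T` too and the improper
  -- integral is not needed.
  · filter_upwards [hS.ae_isPricePath hT hH hs₀, hS.ae_ne_start hT hH hs₀ hσ] with ω h1 h2
    set η := Set.IccExtend hT.le fun t : Set.Icc (0 : ℝ) T ↦ S t ω with hη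
    have hext : ∀ u ∈ Set.Icc 0 T, S u ω = η u := fun u hu ↦
      (Set.IccExtend_of_mem hT.le (fun t : Set.Icc (0 : ℝ) T ↦ S t ω) hu).symm
    have hlim := (tendsto_pathSum_diracDelta hT hσ hs₀ h1.cont.Icc_extend' (fun s ↦ h1.pos _)
      h1.quadraticVariation (by rw [← hη, ← hext T ⟨hT.le, le_rfl⟩]; exact h2) ht).neg
    simp only [value_diracPortfolio]
    rw [← hη, ← hext t ht, ← hext 0 ⟨le_rfl, hT.le⟩] at hlim
    rw [show diracPrice T σ s₀ 0 s₀ - diracPrice T σ s₀ t (S t ω) -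
      (diracPrice T σ s₀ 0 s₀ - diracPrice T σ s₀ 0 (S 0 ω)) =
      -(diracPrice T σ s₀ t (S t ω) - diracPrice T σ s₀ 0 (S 0 ω)) by ring]
    refine hlim.congr fun n ↦ ?_
    rw [forwardSum_eq_pathSum, ← pathSum_congr hT (y := fun s ↦ -diracDelta T σ s₀ s (η s))
      (x := η) (fun s hs ↦ by rw [← hext s hs]; rfl) (fun s hs ↦ (hext s hs).symm)]
    simp [pathSum, neg_mul]
  · rw [value_diracPortfolio, hS.start, sub_self]
  · unfold diracPrice
    have := Real.sqrt_pos.2 hT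
    rw [sub_zero]
    positivity
  -- At maturity `(√0)⁻¹ = 0` makes the claim worthless on every path, so the final value is the
  -- premium.
  · rw [value_diracPortfolio]
    simp [diracPrice]

end DiracStrategy

end MixedFBS

end

theorem mainTheorem3 {Ω : Type*} [MeasurableSpace Ω] (P : Measure Ω) [IsProbabilityMeasure P]
    (T H s₀ μ σ ν : ℝ) (hT : 0 < T) (hH : 1 / 2 < H) (hH' : H < 1)
    (hs₀ : 0 < s₀) (hσ : 0 < σ) (hν : 0 < ν) (S : ℝ → Ω → ℝ)
    (hS : MixedFBS.IsMixedFractionalBlackScholes P T H s₀ μ σ ν S) :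
    (∃ Φ : MixedFBS.Portfolio P T S, Φ.IsSpot ∧ Φ.IsStrongArbitrage) ∧
    ¬ ∃ Φ : MixedFBS.Portfolio P T S, Φ.IsSmooth ∧ Φ.IsNDSAdmissible ∧ Φ.IsArbitrage :=
  ⟨MixedFBS.exists_spot_strongArbitrage hS hT hH hs₀ hσ,
    MixedFBS.not_exists_smooth_arbitrage hS hT hH hs₀ hσ⟩
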